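/- Let $\Omega\subset\mathbb R^2$ be a bounded open set with $|\partial\Omega|=0$. For $\alpha,\beta>0$ let $\mathcal M(\alpha,\beta;\Omega)$ be the set of measurable invertible-matrix-valued functions $A:\Omega\to\mathbb R^{2\times2}$ with $A(x)\xi\cdot\xi\ge\alpha|\xi|^2$ and $A(x)^{-1}\xi\cdot\xi\ge\beta^{-1}|\xi|^2$ for all $\xi\in\mathbb R^2$, a.e. in $\Omega$. A sequence $A_n$, with $A_n\in\mathcal M(a_n,b_n;\Omega)$ for some $0<a_n\le b_n$, is said to $H(\mathcal M(\Omega)^2)$-converge to $A_*$ (with $A_*\in\mathcal M(a_*,b_*;\Omega)$ for some $0<a_*\le b_*$) if for every $f\in H^{-1}(\Omega)$ the solutions $u_n,u\in H^1_0(\Omega)$ of $\operatorname{div}(A_n\nabla u_n)=f$ and $\operatorname{div}(A_*\nabla u)=f$ in $\Omega$ satisfy $u_n\rightharpoonup u$ weakly in $H^1_0(\Omega)$ and $A_n\nabla u_n\rightharpoonup A_*\nabla u$ weakly-$*$ in $\mathcal M(\Omega)^2$, where $\mathcal M(\Omega)$ is the space of Radon measures on $\Omega$. Let $J=\begin{pmatrix}0&-1\\1&0\end{pmatrix}$.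 Let $\omega_n$, $n\in\mathbb N$, be open subsets of $\Omega$ with characteristic functions $\chi_n$, such that $\theta_n:=|\omega_n|\in(0,1)$, $\theta_n\to0$, and $\chi_n/\theta_n\rightharpoonup a\in L^\infty(\Omega)$ weakly-$*$ in $\mathcal M(\Omega)$. Then there exist a subsequence of $n$, still denoted by $n$, and a map $\sigma^0_*$ assigning to each $(\gamma_1,\gamma_2)\in(0,\infty)^2$ a matrix-valued function $\sigma_*^0(\gamma_1,\gamma_2)\in\mathcal M\big(\min(\gamma_1,\gamma_2),\,2(\gamma_1+\gamma_2\|a\|_{L^\infty(\Omega)});\Omega\big)$, locally Lipschitz for the norm of $L^1(\Omega)^{2\times2}$ (that is, Lipschitz on each compact subset of $(0,\infty)^2$), with the following two properties. (i) $\sigma^0_*$ is the homogenized map of the microstructure in the absence of a magnetic field: for all $\gamma_1,\gamma_2>0$ and all positive sequences $\gamma_{1,n}\to\gamma_1$, $\gamma_{2,n}$ with $\theta_n\gamma_{2,n}\to\gamma_2$, the sequence $(1-\chi_n)\gamma_{1,n}I_2+\chi_n\gamma_{2,n}I_2$ $H(\mathcal M(\Omega)^2)$-converges to $\sigma_*^0(\gamma_1,\gamma_2)$.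 (ii) For all $\alpha_1,\alpha_2>0$, all $(\beta_1,\beta_2)\in\mathbb R^2\setminus\{(0,0)\}$ and all $h\in\mathbb R$, the sequence $$\sigma_n(h)=(1-\chi_n)(\alpha_1I_2+h\beta_1J)+\frac{\chi_n}{\theta_n}(\alpha_2I_2+h\beta_2J)$$ $H(\mathcal M(\Omega)^2)$-converges to $\sigma_*^0\big(\alpha_1,\ \alpha_2+\alpha_2^{-1}\beta_2^2h^2\big)+h\beta_1J$. -/

import Mathlib

open Filter Topology MeasureTheory

noncomputable section

namespace HighContrast

/-- The Euclidean plane. -/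
abbrev Plane : Type := EuclideanSpace ℝ (Fin 2)

/-- Real `2 × 2` matrices. -/
abbrev Mat2 : Type := Matrix (Fin 2) (Fin 2) ℝ

/-- The rotation matrix `J`. -/
def J : Mat2 := !![0, -1; 1, 0]

/-- The action of a matrix on a vector of the Euclidean plane. -/
abbrev act (A : Mat2) (ξ : Plane) : Plane := Matrix.toEuclideanCLM (n := Fin 2) (𝕜 := ℝ) A ξ

/-- The matrix norm subordinate to the Euclidean norm. -/
def matNorm (A : Mat2) : ℝ := ‖Matrix.toEuclideanCLM (n := Fin 2) (𝕜 := ℝ) A‖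

/-- The class `M(α, β; Ω)` of measurable, invertible matrix-valued functions with
`A ξ · ξ ≥ α |ξ|²` and `A⁻¹ ξ · ξ ≥ β⁻¹ |ξ|²` almost everywhere in `Ω`. -/
structure MatClass (α β : ℝ) (Ω : Set Plane) (A : Plane → Mat2) : Prop where
  measurable : ∀ i j, AEMeasurable (fun x => A x i j) (volume.restrict Ω)
  invertible : ∀ᵐ x ∂(volume.restrict Ω), IsUnit (A x)
  lower : ∀ᵐ x ∂(volume.restrict Ω), ∀ ξ : Plane, α * ‖ξ‖ ^ 2 ≤ inner ℝ (act (A x) ξ) ξ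
  upper : ∀ᵐ x ∂(volume.restrict Ω), ∀ ξ : Plane,
    β⁻¹ * ‖ξ‖ ^ 2 ≤ inner ℝ (act (A x)⁻¹ ξ) ξ

/-- The Hilbert space `L²(Ω) × L²(Ω)²`, in which a Sobolev function is recorded together with
its gradient. -/
abbrev L2Pair (Ω : Set Plane) : Type :=
  WithLp 2 (Lp ℝ 2 (volume.restrict Ω) × Lp Plane 2 (volume.restrict Ω))

/-- The pairs `(φ, ∇φ)` with `φ` a smooth function compactly supported in `Ω`. -/
def testPairs (Ω : Set Plane) : Set (L2Pair Ω) :=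
  {p | ∃ φ : Plane → ℝ, ContDiff ℝ ((⊤ : ℕ∞) : WithTop ℕ∞) φ ∧ HasCompactSupport φ ∧ tsupport φ ⊆ Ω ∧
    p.fst =ᵐ[volume.restrict Ω] φ ∧ p.snd =ᵐ[volume.restrict Ω] gradient φ}

/-- `H¹₀(Ω)`: the closure of the test functions in the `H¹` norm. -/
def H10 (Ω : Set Plane) : Submodule ℝ (L2Pair Ω) :=
  (Submodule.span ℝ (testPairs Ω)).topologicalClosure

/-- The weak gradient of an element of `H¹₀(Ω)`. -/
def grad {Ω : Set Plane} (u : H10 Ω) : Plane → Plane := fun x => (u : L2Pair Ω).snd x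

/-- `H⁻¹(Ω)`: the dual of `H¹₀(Ω)`. -/
abbrev Hneg1 (Ω : Set Plane) : Type := H10 Ω →L[ℝ] ℝ

/-- `u ∈ H¹₀(Ω)` is a weak solution of `div (A ∇u) = f` in `Ω`, `u = 0` on `∂Ω`. -/
def IsSol {Ω : Set Plane} (A : Plane → Mat2) (f : Hneg1 Ω) (u : H10 Ω) : Prop :=
  ∀ v : H10 Ω, ∫ x in Ω, inner ℝ (act (A x) (grad u x)) (grad v x) = - f v

/-- Weak convergence in `H¹₀(Ω)`. -/
def WeakH10 {Ω : Set Plane} (u : ℕ → H10 Ω) (u₀ : H10 Ω) : Prop :=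
  ∀ l : Hneg1 Ω, Tendsto (fun n => l (u n)) atTop (𝓝 (l u₀))

/-- Weak-* convergence in the Radon measures on `Ω` of the measures with (scalar or vector)
densities `F n` to the measure with density `G`. -/
def WeakStar {V : Type*} [NormedAddCommGroup V] [NormedSpace ℝ V]
    (Ω : Set Plane) (F : ℕ → Plane → V) (G : Plane → V) : Prop :=
  (∀ n, LocallyIntegrableOn (F n) Ω) ∧ LocallyIntegrableOn G Ω ∧
    ∀ φ : Plane → ℝ, Continuous φ → HasCompactSupport φ → tsupport φ ⊆ Ω →
      Tendsto (fun n => ∫ x in Ω, φ x • F n x) atTop (𝓝 (∫ x in Ω, φ x • G x))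

/-- `H(M(Ω)²)`-convergence of the matrix-valued functions `A n` to `A₀`. The equivalences
say that `u n` and `u₀` are the unique solutions of the respective Dirichlet problems. -/
def HConverges (Ω : Set Plane) (A : ℕ → Plane → Mat2) (A₀ : Plane → Mat2) : Prop :=
  (∀ n, ∃ α β : ℝ, 0 < α ∧ α ≤ β ∧ MatClass α β Ω (A n)) ∧
  (∃ α β : ℝ, 0 < α ∧ α ≤ β ∧ MatClass α β Ω A₀) ∧
  ∀ f : Hneg1 Ω, ∃ (u : ℕ → H10 Ω) (u₀ : H10 Ω),
    (∀ n v, IsSol (A n) f v ↔ v = u n) ∧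
    (∀ v, IsSol A₀ f v ↔ v = u₀) ∧
    WeakH10 u u₀ ∧
    WeakStar Ω (fun n x => act (A n x) (grad (u n) x)) (fun x => act (A₀ x) (grad u₀ x))

/-- The characteristic function of `ω`. -/
def chi (ω : Set Plane) : Plane → ℝ := ω.indicator 1

/-- The isotropic two-phase conductivity `(1 - χ) γ₁ I + χ γ₂ I` without magnetic field. -/
def sigmaZero (ω : Set Plane) (γ₁ γ₂ : ℝ) : Plane → Mat2 :=
  fun x => ((1 - chi ω x) * γ₁) • (1 : Mat2) + (chi ω x * γ₂) • (1 : Mat2)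

/-- The perturbed conductivity
`(1 - χ) (α₁ I + h β₁ J) + (χ / θ) (α₂ I + h β₂ J)` with `θ = |ω|`. -/
def sigmaField (ω : Set Plane) (α₁ α₂ β₁ β₂ h : ℝ) : Plane → Mat2 :=
  fun x => (1 - chi ω x) • (α₁ • (1 : Mat2) + (h * β₁) • J) +
    (chi ω x / volume.real ω) • (α₂ • (1 : Mat2) + (h * β₂) • J)

/-- The norm of `L^∞(Ω)`. -/
def supNorm (Ω : Set Plane) (a : Plane → ℝ) : ℝ := (eLpNorm a ⊤ (volume.restrict Ω)).toReal

/-- A map from `(0, ∞)²` to matrix-valued functions on `Ω` is locally Lipschitz for the norm of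
`L¹(Ω)^{2 × 2}`. -/
def LocallyLipschitzL1 (Ω : Set Plane) (S : ℝ → ℝ → Plane → Mat2) : Prop :=
  ∀ K : Set (ℝ × ℝ), IsCompact K → K ⊆ Set.Ioi 0 ×ˢ Set.Ioi 0 → ∃ C : ℝ, 0 < C ∧
    ∀ γ ∈ K, ∀ γ' ∈ K,
      ∫⁻ x in Ω, ENNReal.ofReal (matNorm (S γ.1 γ.2 x - S γ'.1 γ'.2 x)) ≤
        ENNReal.ofReal (C * dist γ γ')

/-- `S` is the homogenized map, in the absence of a magnetic field, of the microstructure `ω`: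
if `γ₁,ₙ → γ₁ > 0` and `|ωₙ| γ₂,ₙ → γ₂ > 0`, then the two-phase conductivities with values
`γ₁,ₙ`, `γ₂,ₙ` converge to `S γ₁ γ₂`. -/
def IsHomogenizedMap (Ω : Set Plane) (ω : ℕ → Set Plane) (S : ℝ → ℝ → Plane → Mat2) : Prop :=
  ∀ γ₁ γ₂ : ℝ, 0 < γ₁ → 0 < γ₂ → ∀ g₁ g₂ : ℕ → ℝ, (∀ n, 0 < g₁ n) → (∀ n, 0 < g₂ n) →
    Tendsto g₁ atTop (𝓝 γ₁) → Tendsto (fun n => volume.real (ω n) * g₂ n) atTop (𝓝 γ₂) →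
    HConverges Ω (fun n => sigmaZero (ω n) (g₁ n) (g₂ n)) (S γ₁ γ₂)

end HighContrast

end

/-! The fluxes of these problems are bounded in L¹ but not in L², so the first task is a div-curl
lemma that tolerates this. In the plane a divergence-free field T is a rotated gradient J∇w, and
W^{1,1} embeds into L²: on a square, w deviates from its mean in L² by at most a constant times the
L¹ norm of T, whatever the side. Suppose ∫|T_n|²/c_n is bounded, where the weights c_n, as measures,
are asymptotically at most A dx. By Cauchy–Schwarz the square of the L¹ norm of T_n on a cell of
side s is at most (A+1)s² times the energy of the cell, so summation over a fine grid gains a factor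
s. Hence products of such fields with weakly convergent gradients pass to the limit
(`div_curl_bound`, `IsWeight.tendsto_div_curl`). Here c_n is 1 outside ω_n and 1/θ_n inside, and A =
1 + ‖a‖_∞. The same Cauchy–Schwarz inequality shows that weak-* limits of fluxes are square
integrable.

The second ingredient is a reciprocity relation special to dimension two. A constant multiple of J
is invisible in the equation, because div(J∇u) = 0, so hβ₁J is removed everywhere. There remain the
phases pI and qI + rJ, where p, θq, θr tend to P, Q, R. Compare a flux σ_n of this problem, with
potential u_n, and a flux τ_n of the isotropic problem with conductivities P and Q'/θ, with
potential v_n. With κ = r/(q²+r²), the difference σ_n·∇v_n - τ_n·∇u_n equals κ Jσ_n·τ_n up to a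
negligible error exactly when Q' = Q + R²/Q. Up to a fixed field, Jσ_n is curl-free; moreover κ² =
O(θ²) and ∫|σ_n|² = O(1/θ), so κJσ_n tends to 0 strongly in L² and the div-curl bound removes the
rotation term. In the limit σ·∇v = τ·∇u almost everywhere (`IsPhase.inner_eq`).

The map sending a datum f to the limit of the solutions is coercive, hence onto: every function of
H¹₀ is a limit of solutions (`IsCoeff.exists_limPair_of_limit`). Reciprocity of the isotropic
problem with itself, tested with locally affine limits, produces a symmetric matrix S with σ = S∇u.
Reciprocity for general R then says that the perturbed problem has the same S as the isotropic one
with Q + R²/Q. The matrix bounds and the Lipschitz dependence come from quadratic inequalities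
between products of fluxes and gradients, which the div-curl lemma carries to the limit.

Limits are taken along ultrafilters, so compactness needs no extraction. One subsequence is chosen
for which the limits at rational parameters, for a countable dense set of data, do not depend on the
ultrafilter; density of the data and the Lipschitz estimate extend this to all data and all real
parameters. A sequence with the same limit along every ultrafilter converges. -/

open Filter Topology MeasureTheory

noncomputable section

namespace HighContrast

open scoped Convolution ENNReal
open ContinuousLinearMap (lsmul)

/-! ### Mollification -/

section Mollification

variable {E : Type*} [NormedAddCommGroup E] [NormedSpace ℝ E]

/-- Convolution with a normalized bump function does not increase the `L²` norm. -/
theorem eLpNorm_normed_convolution_le (ρ : ContDiffBump (0 : Plane)) {g : Plane → E}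
    (hg : AEStronglyMeasurable g volume) :
    eLpNorm (ρ.normed volume ⋆[lsmul ℝ ℝ, volume] g) 2 volume ≤ eLpNorm g 2 volume := by
  set r : Plane → ℝ≥0∞ := fun y => ENNReal.ofReal (ρ.normed volume y) with hr
  have hrm : Measurable r := by
    have : Continuous (ρ.normed (volume : Measure Plane)) := ρ.continuous_normed
    exact ENNReal.measurable_ofReal.comp this.measurable
  have hr1 : ∫⁻ y, r y = 1 := by
    rw [← ofReal_integral_eq_lintegral_ofReal ρ.integrable_normed
      (Eventually.of_forall ρ.nonneg_normed), ρ.integral_normed, ENNReal.ofReal_one]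
  have key : ∀ x, ‖(ρ.normed volume ⋆[lsmul ℝ ℝ, volume] g) x‖ₑ ^ (2 : ℝ) ≤
      ∫⁻ y, r y * ‖g (x - y)‖ₑ ^ (2 : ℝ) := by
    intro x
    have hgx : AEStronglyMeasurable (fun y => g (x - y)) volume :=
      hg.comp_quasiMeasurePreserving (quasiMeasurePreserving_sub_left_of_right_invariant volume x)
    have h1 : ‖(ρ.normed volume ⋆[lsmul ℝ ℝ, volume] g) x‖ₑ ≤ ∫⁻ y, r y * ‖g (x - y)‖ₑ := by
      refine (enorm_integral_le_lintegral_enorm _).trans (le_of_eq ?_)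
      refine lintegral_congr fun y => ?_
      simp only [ContinuousLinearMap.lsmul_apply, enorm_smul]
      rw [Real.enorm_of_nonneg (ρ.nonneg_normed y)]
    have h2 : ∫⁻ y, r y * ‖g (x - y)‖ₑ ≤
        (∫⁻ y, r y * ‖g (x - y)‖ₑ ^ (2 : ℝ)) ^ (1 / (2 : ℝ)) := by
      -- Cauchy–Schwarz with `r` split into two square roots; the first factor is (∫ r)^{1/2} = 1.
      have := ENNReal.lintegral_mul_le_Lp_mul_Lq (μ := (volume : Measure Plane))
        (Real.HolderConjugate.two_two)
        (f := fun y => r y ^ (1 / (2 : ℝ)))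
        (g := fun y => r y ^ (1 / (2 : ℝ)) * ‖g (x - y)‖ₑ) (hrm.pow_const _).aemeasurable
        ((hrm.pow_const _).aemeasurable.mul hgx.enorm)
      have e1 : ∀ y, r y ^ (1 / (2 : ℝ)) * r y ^ (1 / (2 : ℝ)) = r y := by
        intro y
        rw [← ENNReal.rpow_add_of_nonneg _ _ (by norm_num) (by norm_num)]; norm_num
      have e2 : ∀ y, (r y ^ (1 / (2 : ℝ))) ^ (2 : ℝ) = r y := by
        intro y
        rw [← ENNReal.rpow_mul]; norm_num
      simp only [Pi.mul_apply, ← mul_assoc, e1, e2, ENNReal.mul_rpow_of_nonneg _ _ zero_le_two,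
        hr1, ENNReal.one_rpow, one_mul] at this
      exact this
    calc _ ≤ ((∫⁻ y, r y * ‖g (x - y)‖ₑ ^ (2 : ℝ)) ^ (1 / (2 : ℝ))) ^ (2 : ℝ) :=
          ENNReal.rpow_le_rpow (h1.trans h2) zero_le_two
      _ = _ := by rw [← ENNReal.rpow_mul]; norm_num
  rw [eLpNorm_eq_lintegral_rpow_enorm_toReal two_ne_zero ENNReal.ofNat_ne_top,
    eLpNorm_eq_lintegral_rpow_enorm_toReal two_ne_zero ENNReal.ofNat_ne_top]
  simp only [ENNReal.toReal_ofNat]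
  refine ENNReal.rpow_le_rpow ?_ (by norm_num)
  calc ∫⁻ x, ‖(ρ.normed volume ⋆[lsmul ℝ ℝ, volume] g) x‖ₑ ^ (2 : ℝ)
      ≤ ∫⁻ x, ∫⁻ y, r y * ‖g (x - y)‖ₑ ^ (2 : ℝ) := lintegral_mono key
    _ = ∫⁻ y, ∫⁻ x, r y * ‖g (x - y)‖ₑ ^ (2 : ℝ) := by
        rw [lintegral_lintegral_swap]
        refine AEMeasurable.mul (hrm.comp measurable_snd).aemeasurable ?_
        refine AEMeasurable.pow_const ?_ _
        exact (hg.comp_quasiMeasurePreserving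
          (quasiMeasurePreserving_sub volume volume)).enorm
    _ = ∫⁻ y, r y * ∫⁻ x, ‖g x‖ₑ ^ (2 : ℝ) := by
        refine lintegral_congr fun y => ?_
        rw [lintegral_const_mul' _ _ ENNReal.ofReal_ne_top,
          lintegral_sub_right_eq_self (fun x => ‖g x‖ₑ ^ (2 : ℝ)) y]
    _ = ∫⁻ x, ‖g x‖ₑ ^ (2 : ℝ) := by
        rw [lintegral_mul_const _ hrm, hr1, one_mul]

/-- Mollifications of an `L²` function converge to it in `L²`. -/
theorem exists_eLpNorm_normed_convolution_sub_le [CompleteSpace E] {g : Plane → E} (hg : MemLp g 2 volume)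
    {ε : ℝ≥0∞} (hε : ε ≠ 0) :
    ∃ δ > 0, ∀ ρ : ContDiffBump (0 : Plane), ρ.rOut < δ →
      eLpNorm (ρ.normed volume ⋆[lsmul ℝ ℝ, volume] g - g) 2 volume ≤ ε := by
  have hε3 : ε / 3 ≠ 0 := by simp [hε]
  obtain ⟨h, hhc, hgh, hh, hhL⟩ :=
    hg.exists_hasCompactSupport_eLpNorm_sub_le ENNReal.ofNat_ne_top hε3
  -- For mollification radii below 1, both h and its mollification live in this compact set, so a
  -- uniform bound c gives the L² bound c|s|^{1/2}. The three thirds of ε pay for this term, for g -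
  -- h, and for its mollification.
  set s : Set Plane := Metric.cthickening 1 (tsupport h) with hs
  have hsc : IsCompact s := hhc.cthickening
  obtain ⟨c, hc0, hc⟩ : ∃ c : ℝ, 0 < c ∧
      ENNReal.ofReal c * volume s ^ (1 / (2 : ℝ≥0∞).toReal) ≤ ε / 3 := by
    have hfin : volume s ^ (1 / (2 : ℝ≥0∞).toReal) ≠ ⊤ :=
      ENNReal.rpow_ne_top_of_nonneg (by simp) hsc.measure_lt_top.ne
    obtain ⟨c, hc0, hc⟩ := ENNReal.exists_nnreal_pos_mul_lt hfin hε3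
    refine ⟨c, ?_, ?_⟩
    · exact_mod_cast hc0
    · rw [ENNReal.ofReal_coe_nnreal]; exact hc.le
  obtain ⟨δ, hδ, hu⟩ := Metric.uniformContinuous_iff.1 (hhc.uniformContinuous_of_continuous hh)
    c hc0
  refine ⟨min δ 1, by positivity, fun ρ hρ => ?_⟩
  have hconv : eLpNorm (ρ.normed volume ⋆[lsmul ℝ ℝ, volume] h - h) 2 volume ≤ ε / 3 := by
    refine (eLpNorm_sub_le_of_dist_bdd volume ENNReal.ofNat_ne_top hsc.measurableSet hc0.le
      (fun x => ρ.dist_normed_convolution_le hh.aestronglyMeasurable fun y hy => ?_)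
      ?_ ?_).trans hc
    · exact (hu ((Metric.mem_ball.1 hy).trans (hρ.trans_le (min_le_left _ _)))).le
    · refine (support_convolution_subset _).trans ?_
      rw [ρ.support_normed_eq]
      rintro _ ⟨y, hy, z, hz, rfl⟩
      refine Metric.mem_cthickening_of_dist_le _ z _ _ (subset_tsupport _ hz) ?_
      have : ‖y‖ < ρ.rOut := by simpa using hy
      simp only [dist_eq_norm, add_sub_cancel_right]
      exact (this.trans (hρ.trans_le (min_le_right _ _))).le
    · exact (subset_tsupport _).trans (Metric.self_subset_cthickening _)
  have hloc : ∀ {f : Plane → E}, MemLp f 2 volume →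
      ConvolutionExists (ρ.normed volume) f (lsmul ℝ ℝ) volume := fun hf =>
    ρ.hasCompactSupport_normed.convolutionExists_left _ ρ.continuous_normed
      (hf.locallyIntegrable one_le_two)
  have hdec : ρ.normed volume ⋆[lsmul ℝ ℝ, volume] g - g =
      (ρ.normed volume ⋆[lsmul ℝ ℝ, volume] (g - h)) +
      ((ρ.normed volume ⋆[lsmul ℝ ℝ, volume] h - h) - (g - h)) := by
    have : ρ.normed volume ⋆[lsmul ℝ ℝ, volume] g =
      (ρ.normed volume ⋆[lsmul ℝ ℝ, volume] (g - h)) +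
        ρ.normed volume ⋆[lsmul ℝ ℝ, volume] h := by
      conv_lhs => rw [← sub_add_cancel g h]
      exact (hloc (hg.sub hhL)).distrib_add (hloc hhL)
    rw [this]; abel
  have hm : ∀ {f : Plane → E}, MemLp f 2 volume → AEStronglyMeasurable
      (ρ.normed volume ⋆[lsmul ℝ ℝ, volume] f) volume := fun hf =>
    (ρ.hasCompactSupport_normed.continuous_convolution_left _ ρ.continuous_normed
      (hf.locallyIntegrable one_le_two)).aestronglyMeasurable
  rw [hdec]
  have hgh' : MemLp (g - h) 2 volume := hg.sub hhL
  calc _ ≤ eLpNorm (ρ.normed volume ⋆[lsmul ℝ ℝ, volume] (g - h)) 2 volume +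
        eLpNorm ((ρ.normed volume ⋆[lsmul ℝ ℝ, volume] h - h) - (g - h)) 2 volume :=
        eLpNorm_add_le (hm hgh') (((hm hhL).sub hhL.1).sub hgh'.1) one_le_two
    _ ≤ ε / 3 + (ε / 3 + ε / 3) := by
        refine add_le_add ((eLpNorm_normed_convolution_le ρ hgh'.1).trans hgh) ?_
        refine (eLpNorm_sub_le ((hm hhL).sub hhL.1) hgh'.1 one_le_two).trans ?_
        exact add_le_add hconv hgh
    _ = ε := by rw [← add_assoc, ENNReal.add_thirds]

end Mollification

/-- Weakly divergence-free fields in an open set `U`. -/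
def DivFree (U : Set Plane) (T : Plane → Plane) : Prop :=
  ∀ ψ : Plane → ℝ, ContDiff ℝ ((⊤ : ℕ∞) : WithTop ℕ∞) ψ → HasCompactSupport ψ → tsupport ψ ⊆ U →
    ∫ x in U, inner ℝ (gradient ψ x) (T x) = 0

/-- Weakly curl-free fields in an open set `U`. -/
def CurlFree (U : Set Plane) (T : Plane → Plane) : Prop :=
  ∀ ψ : Plane → ℝ, ContDiff ℝ ((⊤ : ℕ∞) : WithTop ℕ∞) ψ → HasCompactSupport ψ → tsupport ψ ⊆ U →
    ∫ x in U, inner ℝ (act J (gradient ψ x)) (T x) = 0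

theorem inner_plane (x y : Plane) : inner ℝ x y = x 0 * y 0 + x 1 * y 1 := by
  simp [PiLp.inner_apply, Fin.sum_univ_two, mul_comm]

theorem act_apply (A : Mat2) (x : Plane) (i : Fin 2) :
    act A x i = A i 0 * x 0 + A i 1 * x 1 := by
  simp [act, Matrix.mulVec, dotProduct, Fin.sum_univ_two]

theorem act_J_zero (x : Plane) : act J x 0 = - x 1 := by
  simp [act_apply, J]

theorem act_J_one (x : Plane) : act J x 1 = x 0 := by
  simp [act_apply, J]

theorem norm_sq_plane (x : Plane) : ‖x‖ ^ 2 = x 0 ^ 2 + x 1 ^ 2 := by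
  simp [EuclideanSpace.norm_sq_eq, Fin.sum_univ_two]

theorem abs_apply_le_norm (x : Plane) (i : Fin 2) : |x i| ≤ ‖x‖ := by
  simpa using PiLp.norm_apply_le x i

end HighContrast
end

/-! ### Smooth approximation of divergence-free fields and stream functions. -/

open Filter Topology MeasureTheory

noncomputable section

namespace HighContrast

open scoped Convolution ENNReal
open ContinuousLinearMap (lsmul)

/-- The canonical basis vectors of the plane. -/
abbrev unitVec (i : Fin 2) : Plane := EuclideanSpace.single i (1 : ℝ)

theorem plane_eq (x : Plane) : x = x 0 • unitVec 0 + x 1 • unitVec 1 := by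
  ext i; fin_cases i <;> simp [unitVec]

theorem inner_gradient {ψ : Plane → ℝ} (x v : Plane) :
    inner ℝ (gradient ψ x) v = fderiv ℝ ψ x v := by
  simp [gradient]

/-- The divergence of a linear map of the plane. -/
def traceCLM : (Plane →L[ℝ] Plane) →L[ℝ] ℝ :=
  (EuclideanSpace.proj (𝕜 := ℝ) (0 : Fin 2)) ∘L ContinuousLinearMap.apply ℝ Plane (unitVec 0) +
  (EuclideanSpace.proj (𝕜 := ℝ) (1 : Fin 2)) ∘L ContinuousLinearMap.apply ℝ Plane (unitVec 1)

theorem traceCLM_apply (B : Plane →L[ℝ] Plane) :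
    traceCLM B = B (unitVec 0) 0 + B (unitVec 1) 1 := rfl

/-- A weakly divergence-free square-integrable field is approximated, near a convex compact set,
by smooth divergence-free fields. -/
theorem exists_smooth_divFree_approx {U : Set Plane} (hU : IsOpen U) {T : Plane → Plane}
    (hT : MemLp T 2 (volume.restrict U)) (hdiv : DivFree U T) {K : Set Plane} (hK : IsCompact K)
    (hKc : Convex ℝ K) (hKU : K ⊆ U) {ε : ℝ≥0∞} (hε : ε ≠ 0) :
    ∃ (V : Set Plane) (T' : Plane → Plane), IsOpen V ∧ Convex ℝ V ∧ K ⊆ V ∧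
      ContDiff ℝ ((⊤ : ℕ∞) : WithTop ℕ∞) T' ∧
      eLpNorm (T' - T) 2 (volume.restrict K) ≤ ε ∧ ∀ x ∈ V, traceCLM (fderiv ℝ T' x) = 0 := by
  set g : Plane → Plane := U.indicator T with hgdef
  have hg : MemLp g 2 volume := (memLp_indicator_iff_restrict hU.measurableSet).2 hT
  have hgl : LocallyIntegrable g volume := hg.locallyIntegrable one_le_two
  obtain ⟨δ, hδ, happ⟩ := exists_eLpNorm_normed_convolution_sub_le hg hε
  obtain ⟨r, hr, hrU⟩ := hK.exists_cthickening_subset_open hU hKU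
  -- Being below δ controls the L² error; being at most r/2 keeps the balls of radius R about points
  -- of the r/2-neighbourhood of K inside U.
  set R : ℝ := min δ r / 2 with hR
  have hR0 : 0 < R := by positivity
  let ρ : ContDiffBump (0 : Plane) := ⟨R / 2, R, by positivity, by linarith⟩
  have hρR : ρ.rOut = R := rfl
  have hρC : ContDiff ℝ ((⊤ : ℕ∞) : WithTop ℕ∞) (ρ.normed (volume : Measure Plane)) :=
    ρ.contDiff_normed
  refine ⟨Metric.thickening (r / 2) K, ρ.normed volume ⋆[lsmul ℝ ℝ, volume] g,
    Metric.isOpen_thickening, hKc.thickening _, Metric.self_subset_thickening (by positivity) K,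
    ?_, ?_, ?_⟩
  · exact ρ.hasCompactSupport_normed.contDiff_convolution_left _ hρC hgl
  · have hle : R < δ := by
      have := min_le_left δ r
      simp only [hR]; linarith
    calc _ = eLpNorm (ρ.normed volume ⋆[lsmul ℝ ℝ, volume] g - g) 2 (volume.restrict K) := by
          refine eLpNorm_congr_ae ?_
          filter_upwards [ae_restrict_mem hK.measurableSet] with x hx
          simp [hgdef, Set.indicator_of_mem (hKU hx)]
      _ ≤ _ := eLpNorm_mono_measure _ Measure.restrict_le_self
      _ ≤ ε := happ ρ (by rw [hρR]; exact hle)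
  · intro x hx
    have hd := ρ.hasCompactSupport_normed.hasFDerivAt_convolution_left (lsmul ℝ ℝ)
      (hρC.of_le (by exact_mod_cast le_top)) hgl x
    rw [hd.fderiv]
    have hint : Integrable (fun t => (lsmul ℝ ℝ : ℝ →L[ℝ] Plane →L[ℝ] Plane).precompL Plane
        (fderiv ℝ (ρ.normed (volume : Measure Plane)) t) (g (x - t))) volume := by
      refine HasCompactSupport.convolutionExists_left _ ?_ ?_ hgl x
      · exact ρ.hasCompactSupport_normed.fderiv ℝ
      · exact hρC.continuous_fderiv (by simp)
    rw [convolution_def, ← traceCLM.integral_comp_comm hint]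
    -- The divergence of the mollified field at x is, up to sign, the pairing of T with the gradient
    -- of this function, which is an admissible test function in U.
    set ψ : Plane → ℝ := fun y => ρ.normed (volume : Measure Plane) (x - y) with hψ
    have hψC : ContDiff ℝ ((⊤ : ℕ∞) : WithTop ℕ∞) ψ := hρC.comp (contDiff_const.sub contDiff_id)
    have hψs : tsupport ψ ⊆ Metric.closedBall x R := by
      refine closure_minimal ?_ Metric.isClosed_closedBall
      intro y hy
      have : x - y ∈ Function.support (ρ.normed (volume : Measure Plane)) := hy
      rw [ρ.support_normed_eq] at this
      rw [Metric.mem_closedBall, dist_comm, dist_eq_norm]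
      exact (by simpa using this : ‖x - y‖ < ρ.rOut).le
    have hψc : HasCompactSupport ψ :=
      HasCompactSupport.of_support_subset_isCompact (isCompact_closedBall x R)
        ((subset_tsupport _).trans hψs)
    have hψU : tsupport ψ ⊆ U := by
      refine hψs.trans (subset_trans ?_ hrU)
      intro y hy
      obtain ⟨z, hz, hxz⟩ := Metric.mem_thickening_iff.1 hx
      refine Metric.mem_cthickening_of_dist_le y z _ _ hz ?_
      have h1 : dist y x ≤ R := hy
      have h2 : R ≤ r / 2 := by
        have := min_le_right δ r
        simp only [hR]; linarith
      linarith [dist_triangle y x z]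
    have hgrad : ∀ y, fderiv ℝ ψ y = - fderiv ℝ (ρ.normed (volume : Measure Plane)) (x - y) := by
      intro y
      have h1 : HasFDerivAt (ρ.normed (volume : Measure Plane))
          (fderiv ℝ (ρ.normed (volume : Measure Plane)) (x - y)) (x - y) :=
        (hρC.differentiable (by simp) _).hasFDerivAt
      have h2 : HasFDerivAt (fun y : Plane => x - y) (-(ContinuousLinearMap.id ℝ Plane)) y :=
        (hasFDerivAt_id y).const_sub x
      have := (h1.comp y h2).fderiv
      simpa [Function.comp_def, hψ] using this
    have hz := hdiv ψ hψC hψc hψU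
    have heq : ∀ t, traceCLM ((lsmul ℝ ℝ : ℝ →L[ℝ] Plane →L[ℝ] Plane).precompL Plane
        (fderiv ℝ (ρ.normed (volume : Measure Plane)) t) (g (x - t))) =
        (fun y => fderiv ℝ (ρ.normed (volume : Measure Plane)) (x - y) (g y)) (x - t) := by
      intro t
      simp only [sub_sub_cancel]
      conv_rhs => rw [plane_eq (g (x - t))]
      rw [traceCLM_apply]
      simp [ContinuousLinearMap.precompL_apply, mul_comm]
    simp_rw [heq]
    rw [integral_sub_left_eq_self (fun y =>
      fderiv ℝ (ρ.normed (volume : Measure Plane)) (x - y) (g y)) volume x]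
    rw [← integral_indicator hU.measurableSet] at hz
    have : ∀ y, U.indicator (fun x => inner ℝ (gradient ψ x) (T x)) y =
        - (fderiv ℝ (ρ.normed (volume : Measure Plane)) (x - y) (g y)) := by
      intro y
      by_cases hy : y ∈ U
      · simp [hy, hgdef, hgrad]
      · simp [hy, hgdef]
    simp_rw [this] at hz
    rw [integral_neg] at hz
    linarith

/-- A smooth divergence-free field on an open convex set has a stream function. -/
theorem exists_stream {V : Set Plane} (hV : IsOpen V) (hVc : Convex ℝ V) {T : Plane → Plane}
    (hT : ContDiff ℝ ((⊤ : ℕ∞) : WithTop ℕ∞) T) (hdiv : ∀ x ∈ V, traceCLM (fderiv ℝ T x) = 0) :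
    ∃ w : Plane → ℝ, ∀ x ∈ V, HasFDerivAt w (innerSL ℝ (- act J (T x))) x := by
  -- The one-form x ↦ ⟨-J T(x), ·⟩ is closed exactly where the divergence of T vanishes. Its
  -- primitive w on the convex set satisfies ∇w = -JT, that is T = J∇w.
  set B : Plane →L[ℝ] (Plane →L[ℝ] ℝ) :=
    (innerSL ℝ) ∘L (-(Matrix.toEuclideanCLM (n := Fin 2) (𝕜 := ℝ) J)) with hB
  have hBT : ∀ x, HasFDerivAt (fun x => B (T x)) (B ∘L fderiv ℝ T x) x := fun x =>
    B.hasFDerivAt.comp x (hT.differentiable (by simp) x).hasFDerivAt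
  refine (hVc.exists_forall_hasFDerivAt_of_fderiv_symmetric hV (ω := fun x => B (T x))
    (fun x _ => (hBT x).differentiableAt.differentiableWithinAt) ?_)
  intro a ha x y
  have hBapp : ∀ u v : Plane, B u v = u 1 * v 0 - u 0 * v 1 := by
    intro u v
    have : B u v = inner ℝ (-(act J u)) v := rfl
    rw [this, inner_plane]
    simp only [PiLp.neg_apply, act_J_zero, act_J_one]; ring
  rw [(hBT a).fderiv]
  simp only [ContinuousLinearMap.comp_apply, hBapp]
  have hd := hdiv a ha
  rw [traceCLM_apply] at hd
  have hx : fderiv ℝ T a x = x 0 • fderiv ℝ T a (unitVec 0) + x 1 • fderiv ℝ T a (unitVec 1) := by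
    conv_lhs => rw [plane_eq x]
    simp
  have hy : fderiv ℝ T a y = y 0 • fderiv ℝ T a (unitVec 0) + y 1 • fderiv ℝ T a (unitVec 1) := by
    conv_lhs => rw [plane_eq y]
    simp
  rw [hx, hy]
  simp only [PiLp.add_apply, PiLp.smul_apply, smul_eq_mul]
  linear_combination (x 1 * y 0 - y 1 * x 0) * hd

end HighContrast
end

open Filter Topology MeasureTheory

noncomputable section

namespace HighContrast

/-! ### The Poincaré inequality on squares -/

theorem _root_.MeasureTheory.Integrable.sub_fun {α : Type*} [MeasurableSpace α] {μ : Measure α}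
    {f g : α → ℝ} (hf : Integrable f μ) (hg : Integrable g μ) :
    Integrable (fun x => f x - g x) μ := hf.sub hg

/-- A function on a product whose increments are controlled along both coordinate paths has small
variance. -/
theorem integral_sub_mean_sq_le_of_coordinate_paths {α β : Type*} [MeasurableSpace α]
    [MeasurableSpace β] {μ₁ : Measure α} {μ₂ : Measure β} [IsFiniteMeasure μ₁] [IsFiniteMeasure μ₂]
    {L : ℝ} (hL : 0 < L) (h₁ : μ₁.real Set.univ = L) (h₂ : μ₂.real Set.univ = L)
    {W : α × β → ℝ} (hW : Integrable W (μ₁.prod μ₂))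
    (hW2 : Integrable (fun p => W p ^ 2) (μ₁.prod μ₂)) {F : α → ℝ} {G : β → ℝ}
    (hF : Integrable F μ₁) (hG : Integrable G μ₂)
    (h : ∀ᵐ p ∂(μ₁.prod μ₂), ∀ᵐ q ∂(μ₁.prod μ₂),
      |W p - W q| ≤ F p.1 + G q.2 ∧ |W p - W q| ≤ F q.1 + G p.2) :
    ∫ p, (W p - (L ^ 2)⁻¹ * ∫ q, W q ∂(μ₁.prod μ₂)) ^ 2 ∂(μ₁.prod μ₂) ≤
      (∫ x, F x ∂μ₁ + ∫ y, G y ∂μ₂) ^ 2 / 2 := by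
  set ν := μ₁.prod μ₂ with hν
  set I₁ := ∫ q, W q ∂ν
  set I₂ := ∫ q, W q ^ 2 ∂ν
  set f := ∫ x, F x ∂μ₁
  set g := ∫ y, G y ∂μ₂
  have hν1 : ν.real Set.univ = L ^ 2 := by
    rw [hν, ← Set.univ_prod_univ, measureReal_prod_prod, h₁, h₂]; ring
  have hF' : Integrable (fun p : α × β => F p.1) ν := hF.comp_fst _
  have hG' : Integrable (fun p : α × β => G p.2) ν := hG.comp_snd _
  have hFG : Integrable (fun p : α × β => F p.1 * G p.2) ν := hF.mul_prod hG
  have iF : ∫ p, F p.1 ∂ν = L * f := by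
    rw [hν, integral_fun_fst]; simp [h₂, f]
  have iG : ∫ p, G p.2 ∂ν = L * g := by
    rw [hν, integral_fun_snd]; simp [h₁, g]
  have iFG : ∫ p, F p.1 * G p.2 ∂ν = f * g := integral_prod_mul F G
  -- Gagliardo's device: the two factors of (W p - W q)² are bounded along the two different
  -- coordinate paths, so the product never squares F or G at a single point and only their
  -- integrals enter. The double integral of the left side is 2L² times the variance integral, which
  -- produces the factor 1/2.
  have step : ∀ᵐ p ∂ν, L ^ 2 * W p ^ 2 - 2 * W p * I₁ + I₂ ≤
      L * f * F p.1 + L ^ 2 * (F p.1 * G p.2) + f * g + L * g * G p.2 := by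
    filter_upwards [h] with p hp
    have e1 : ∫ q, (W p - W q) ^ 2 ∂ν = L ^ 2 * W p ^ 2 - 2 * W p * I₁ + I₂ := by
      have : ∀ q, (W p - W q) ^ 2 = W p ^ 2 - 2 * W p * W q + W q ^ 2 := fun q => by ring
      simp_rw [this]
      rw [integral_add ((integrable_const _).sub_fun (hW.const_mul _)) hW2,
        integral_sub (integrable_const _) (hW.const_mul _), integral_const, integral_const_mul,
        hν1, smul_eq_mul]
    have e2 : ∫ q, (F p.1 + G q.2) * (F q.1 + G p.2) ∂ν =
        L * f * F p.1 + L ^ 2 * (F p.1 * G p.2) + f * g + L * g * G p.2 := by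
      have : ∀ q : α × β, (F p.1 + G q.2) * (F q.1 + G p.2) =
        F p.1 * F q.1 + F p.1 * G p.2 + F q.1 * G q.2 + G p.2 * G q.2 := fun q => by ring
      simp_rw [this]
      rw [integral_add (((hF'.const_mul _).fun_add (integrable_const _)).fun_add hFG) (hG'.const_mul _),
        integral_add ((hF'.const_mul _).fun_add (integrable_const _)) hFG,
        integral_add (hF'.const_mul _) (integrable_const _), integral_const, integral_const_mul,
        integral_const_mul, hν1, smul_eq_mul, iF, iG, iFG]
      ring
    rw [← e1, ← e2]
    refine integral_mono_ae ?_ ?_ ?_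
    · have : (fun q => (W p - W q) ^ 2) = fun q => W p ^ 2 - 2 * W p * W q + W q ^ 2 := by
        ext q; ring
      rw [this]
      exact ((integrable_const _).sub_fun (hW.const_mul _)).fun_add hW2
    · have : (fun q : α × β => (F p.1 + G q.2) * (F q.1 + G p.2)) = fun q =>
        F p.1 * F q.1 + F p.1 * G p.2 + F q.1 * G q.2 + G p.2 * G q.2 := by ext q; ring
      rw [this]
      exact ((((hF'.const_mul _).fun_add (integrable_const _)).fun_add hFG).fun_add (hG'.const_mul _))
    · filter_upwards [hp] with q hq
      calc (W p - W q) ^ 2 = |W p - W q| * |W p - W q| := by rw [← sq, sq_abs]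
        _ ≤ _ := mul_le_mul hq.1 hq.2 (abs_nonneg _) ((abs_nonneg _).trans hq.1)
  have hint := integral_mono_ae
    (((hW2.const_mul (L ^ 2)).sub_fun ((hW.const_mul (2 * I₁)))).fun_add (integrable_const I₂))
    ((((hF'.const_mul (L * f)).fun_add (hFG.const_mul (L ^ 2))).fun_add (integrable_const (f * g))).fun_add
      (hG'.const_mul (L * g))) (by
      filter_upwards [step] with p hp
      linarith)
  rw [integral_add ((hW2.const_mul _).sub_fun (hW.const_mul _)) (integrable_const _),
    integral_sub (hW2.const_mul _) (hW.const_mul _),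
    integral_add (((hF'.const_mul _).fun_add (hFG.const_mul _)).fun_add (integrable_const _))
      (hG'.const_mul _),
    integral_add ((hF'.const_mul _).fun_add (hFG.const_mul _)) (integrable_const _),
    integral_add (hF'.const_mul _) (hFG.const_mul _)] at hint
  simp only [integral_const, integral_const_mul, hν1, smul_eq_mul, iF, iG, iFG] at hint
  have e3 : ∫ p, (W p - (L ^ 2)⁻¹ * I₁) ^ 2 ∂ν = I₂ - (L ^ 2)⁻¹ * I₁ ^ 2 := by
    have : ∀ q, (W q - (L ^ 2)⁻¹ * I₁) ^ 2 =
      W q ^ 2 - 2 * (L ^ 2)⁻¹ * I₁ * W q + ((L ^ 2)⁻¹ * I₁) ^ 2 := fun q => by ring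
    simp_rw [this]
    rw [integral_add (hW2.sub_fun (hW.const_mul _)) (integrable_const _),
      integral_sub hW2 (hW.const_mul _), integral_const, integral_const_mul, hν1, smul_eq_mul]
    change I₂ - 2 * (L ^ 2)⁻¹ * I₁ * I₁ + _ = _
    field_simp
    ring
  rw [e3]
  have hL2 : 0 < L ^ 2 := by positivity
  have : L ^ 2 * (I₂ - (L ^ 2)⁻¹ * I₁ ^ 2) ≤ L ^ 2 * ((f + g) ^ 2 / 2) := by
    have : L ^ 2 * (I₂ - (L ^ 2)⁻¹ * I₁ ^ 2) = L ^ 2 * I₂ - I₁ ^ 2 := by field_simp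
    rw [this]
    change L ^ 2 * I₂ - 2 * I₁ * I₁ + L ^ 2 * I₂ ≤ _ at hint
    linarith
  exact le_of_mul_le_mul_left this hL2

/-- The identification of the plane with `ℝ × ℝ`. -/
def planeEquiv : ℝ × ℝ ≃ᵐ Plane :=
  (MeasurableEquiv.finTwoArrow (α := ℝ)).symm.trans (MeasurableEquiv.toLp 2 (Fin 2 → ℝ))

theorem planeEquiv_apply (p : ℝ × ℝ) : planeEquiv p = !₂[p.1, p.2] := rfl

theorem measurePreserving_planeEquiv : MeasurePreserving planeEquiv volume volume :=
  ((volume_preserving_finTwoArrow ℝ).symm).trans (PiLp.volume_preserving_toLp (Fin 2))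

theorem continuous_planeEquiv : Continuous planeEquiv := by
  have : (planeEquiv : ℝ × ℝ → Plane) = fun p => !₂[p.1, p.2] := rfl
  rw [this]
  fun_prop

/-- The half-open square with lower left corner `z` and side `L`. -/
def sq (z : Plane) (L : ℝ) : Set Plane :=
  {x | x 0 ∈ Set.Ico (z 0) (z 0 + L) ∧ x 1 ∈ Set.Ico (z 1) (z 1 + L)}

/-- The closed square with lower left corner `z` and side `L`. -/
def csq (z : Plane) (L : ℝ) : Set Plane :=
  {x | x 0 ∈ Set.Icc (z 0) (z 0 + L) ∧ x 1 ∈ Set.Icc (z 1) (z 1 + L)}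

theorem sq_subset_csq (z : Plane) (L : ℝ) : sq z L ⊆ csq z L :=
  fun _ hx => ⟨Set.Ico_subset_Icc_self hx.1, Set.Ico_subset_Icc_self hx.2⟩

theorem measurableSet_sq (z : Plane) (L : ℝ) : MeasurableSet (sq z L) := by
  have h : ∀ i : Fin 2, Measurable fun x : Plane => x i := fun i => by fun_prop
  exact (h 0 measurableSet_Ico).inter (h 1 measurableSet_Ico)

theorem isClosed_csq (z : Plane) (L : ℝ) : IsClosed (csq z L) := by
  have h : ∀ i : Fin 2, Continuous fun x : Plane => x i := fun i => by fun_prop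
  exact (isClosed_Icc.preimage (h 0)).inter (isClosed_Icc.preimage (h 1))

theorem convex_csq (z : Plane) (L : ℝ) : Convex ℝ (csq z L) := by
  have h : ∀ i : Fin 2, IsLinearMap ℝ fun x : Plane => x i := fun i => ⟨fun _ _ => rfl, fun _ _ => rfl⟩
  exact ((convex_Icc (z 0) (z 0 + L)).is_linear_preimage (h 0)).inter
    ((convex_Icc (z 1) (z 1 + L)).is_linear_preimage (h 1))

theorem isCompact_csq (z : Plane) (L : ℝ) : IsCompact (csq z L) := by
  have : csq z L = planeEquiv '' (Set.Icc (z 0) (z 0 + L) ×ˢ Set.Icc (z 1) (z 1 + L)) := by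
    ext x
    constructor
    · intro hx
      refine ⟨(x 0, x 1), ⟨hx.1, hx.2⟩, ?_⟩
      ext i; fin_cases i <;> rfl
    · rintro ⟨p, hp, rfl⟩
      exact ⟨hp.1, hp.2⟩
  rw [this]
  exact (isCompact_Icc.prod isCompact_Icc).image continuous_planeEquiv

theorem planeEquiv_preimage_sq (z : Plane) (L : ℝ) :
    planeEquiv ⁻¹' sq z L = Set.Ico (z 0) (z 0 + L) ×ˢ Set.Ico (z 1) (z 1 + L) := by
  ext p; rfl

theorem setIntegral_sq (z : Plane) (L : ℝ) (f : Plane → ℝ) :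
    ∫ x in sq z L, f x = ∫ p, f (planeEquiv p) ∂((volume.restrict (Set.Ico (z 0) (z 0 + L))).prod
      (volume.restrict (Set.Ico (z 1) (z 1 + L)))) := by
  rw [Measure.prod_restrict, ← Measure.volume_eq_prod, ← planeEquiv_preimage_sq,
    measurePreserving_planeEquiv.setIntegral_preimage_emb planeEquiv.measurableEmbedding]

theorem volume_sq (z : Plane) {L : ℝ} (hL : 0 ≤ L) : volume.real (sq z L) = L ^ 2 := by
  have := measurePreserving_planeEquiv.measureReal_preimage (measurableSet_sq z L).nullMeasurableSet
  rw [← this, planeEquiv_preimage_sq, Measure.volume_eq_prod, measureReal_prod_prod]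
  simp [hL]
  ring

/-- The Poincaré inequality for stream functions on a square, with the `L¹` norm of the field on
the right-hand side. -/
theorem poincare_sq {z : Plane} {L : ℝ} (hL : 0 < L) {w : Plane → ℝ} {T : Plane → Plane}
    (hT : Continuous T) (hw : ∀ x ∈ csq z L, HasFDerivAt w (innerSL ℝ (- act J (T x))) x) :
    ∫ x in sq z L, (w x - (L ^ 2)⁻¹ * ∫ y in sq z L, w y) ^ 2 ≤ 2 * (∫ x in sq z L, ‖T x‖) ^ 2 := by
  set μ₁ : Measure ℝ := volume.restrict (Set.Ico (z 0) (z 0 + L)) with hμ₁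
  set μ₂ : Measure ℝ := volume.restrict (Set.Ico (z 1) (z 1 + L)) with hμ₂
  have hcont : ContinuousOn (fun p => w (planeEquiv p))
      (Set.Icc (z 0) (z 0 + L) ×ˢ Set.Icc (z 1) (z 1 + L)) := by
    intro p hp
    exact ((hw _ hp).continuousAt.comp continuous_planeEquiv.continuousAt).continuousWithinAt
  have hi : ∀ {f : ℝ × ℝ → ℝ}, ContinuousOn f
      (Set.Icc (z 0) (z 0 + L) ×ˢ Set.Icc (z 1) (z 1 + L)) → Integrable f (μ₁.prod μ₂) := by
    intro f hf
    rw [hμ₁, hμ₂, Measure.prod_restrict, ← Measure.volume_eq_prod]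
    exact (hf.integrableOn_compact (isCompact_Icc.prod isCompact_Icc)).mono_set
      (Set.prod_mono Set.Ico_subset_Icc_self Set.Ico_subset_Icc_self)
  have hTc : ∀ i : Fin 2, Continuous fun p => |T (planeEquiv p) i| := fun i => by
    exact ((EuclideanSpace.proj (𝕜 := ℝ) i).continuous.comp
      (hT.comp continuous_planeEquiv)).abs
  have iT : ∀ i : Fin 2, Integrable (fun p => |T (planeEquiv p) i|) (μ₁.prod μ₂) := fun i =>
    hi (hTc i).continuousOn
  -- Since ∇w = -JT = (T₁, -T₀), the component T₀ governs increments on vertical lines and T₁ those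
  -- on horizontal lines.
  set F : ℝ → ℝ := fun x => ∫ y, |T (planeEquiv (x, y)) 0| ∂μ₂ with hF
  set G : ℝ → ℝ := fun y => ∫ x, |T (planeEquiv (x, y)) 1| ∂μ₁ with hG
  have hvert : ∀ x ∈ Set.Icc (z 0) (z 0 + L), ∀ y ∈ Set.Icc (z 1) (z 1 + L),
      ∀ y' ∈ Set.Icc (z 1) (z 1 + L),
      |w (planeEquiv (x, y)) - w (planeEquiv (x, y'))| ≤ F x := by
    intro x hx y hy y' hy'
    have hder : ∀ t ∈ Set.uIcc y' y, HasDerivAt (fun t => w (planeEquiv (x, t)))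
        (- T (planeEquiv (x, t)) 0) t := by
      intro t ht
      have htI : t ∈ Set.Icc (z 1) (z 1 + L) := Set.uIcc_subset_Icc hy' hy ht
      have h2 : HasDerivAt (fun t : ℝ => planeEquiv (x, t)) (unitVec 1) t := by
        have : (fun t : ℝ => planeEquiv (x, t)) = fun t => x • unitVec 0 + t • unitVec 1 := by
          ext t i; fin_cases i <;> simp [planeEquiv_apply, unitVec]
        rw [this]
        simpa using ((hasDerivAt_id t).smul_const (unitVec 1)).const_add (x • unitVec 0)
      have h3 := (hw (planeEquiv (x, t)) ⟨hx, htI⟩).comp_hasDerivAt t h2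
      refine h3.congr_deriv ?_
      rw [innerSL_apply_apply, inner_plane]
      simp [act_J_zero, act_J_one, unitVec]
    have hcT : Continuous fun t => T (planeEquiv (x, t)) 0 :=
      (EuclideanSpace.proj (𝕜 := ℝ) (0 : Fin 2)).continuous.comp
        ((hT.comp continuous_planeEquiv).comp (continuous_const.prodMk continuous_id))
    rw [← intervalIntegral.integral_eq_sub_of_hasDerivAt hder (hcT.neg.intervalIntegrable _ _)]
    rw [← Real.norm_eq_abs]
    refine (intervalIntegral.norm_integral_le_integral_norm_uIoc).trans ?_
    simp only [norm_neg, Real.norm_eq_abs, hF]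
    rw [hμ₂, integral_Ico_eq_integral_Ioc]
    refine setIntegral_mono_set ?_ (Eventually.of_forall fun _ => abs_nonneg _)
      (LE.le.eventuallyLE ?_)
    · exact hcT.abs.integrableOn_Ioc
    · exact Set.Ioc_subset_Ioc (le_min hy'.1 hy.1) (max_le hy'.2 hy.2)
  have hhor : ∀ y ∈ Set.Icc (z 1) (z 1 + L), ∀ x ∈ Set.Icc (z 0) (z 0 + L),
      ∀ x' ∈ Set.Icc (z 0) (z 0 + L),
      |w (planeEquiv (x, y)) - w (planeEquiv (x', y))| ≤ G y := by
    intro y hy x hx x' hx'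
    have hder : ∀ t ∈ Set.uIcc x' x, HasDerivAt (fun t => w (planeEquiv (t, y)))
        (T (planeEquiv (t, y)) 1) t := by
      intro t ht
      have htI : t ∈ Set.Icc (z 0) (z 0 + L) := Set.uIcc_subset_Icc hx' hx ht
      have h2 : HasDerivAt (fun t : ℝ => planeEquiv (t, y)) (unitVec 0) t := by
        have : (fun t : ℝ => planeEquiv (t, y)) = fun t => y • unitVec 1 + t • unitVec 0 := by
          ext t i; fin_cases i <;> simp [planeEquiv_apply, unitVec]
        rw [this]
        simpa using ((hasDerivAt_id t).smul_const (unitVec 0)).const_add (y • unitVec 1)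
      have h3 := (hw (planeEquiv (t, y)) ⟨htI, hy⟩).comp_hasDerivAt t h2
      refine h3.congr_deriv ?_
      rw [innerSL_apply_apply, inner_plane]
      simp [act_J_zero, act_J_one, unitVec]
    have hcT : Continuous fun t => T (planeEquiv (t, y)) 1 :=
      (EuclideanSpace.proj (𝕜 := ℝ) (1 : Fin 2)).continuous.comp
        ((hT.comp continuous_planeEquiv).comp (continuous_id.prodMk continuous_const))
    rw [← intervalIntegral.integral_eq_sub_of_hasDerivAt hder (hcT.intervalIntegrable _ _)]
    rw [← Real.norm_eq_abs]
    refine (intervalIntegral.norm_integral_le_integral_norm_uIoc).trans ?_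
    simp only [Real.norm_eq_abs, hG]
    rw [hμ₁, integral_Ico_eq_integral_Ioc]
    refine setIntegral_mono_set ?_ (Eventually.of_forall fun _ => abs_nonneg _)
      (LE.le.eventuallyLE ?_)
    · exact hcT.abs.integrableOn_Ioc
    · exact Set.Ioc_subset_Ioc (le_min hx'.1 hx.1) (max_le hx'.2 hx.2)
  have hmem : ∀ᵐ p ∂(μ₁.prod μ₂),
      p ∈ Set.Icc (z 0) (z 0 + L) ×ˢ Set.Icc (z 1) (z 1 + L) := by
    rw [hμ₁, hμ₂, Measure.prod_restrict]
    filter_upwards [ae_restrict_mem (measurableSet_Ico.prod measurableSet_Ico)] with p hp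
    exact Set.prod_mono Set.Ico_subset_Icc_self Set.Ico_subset_Icc_self hp
  have hpath : ∀ p ∈ Set.Icc (z 0) (z 0 + L) ×ˢ Set.Icc (z 1) (z 1 + L),
      ∀ q ∈ Set.Icc (z 0) (z 0 + L) ×ˢ Set.Icc (z 1) (z 1 + L),
      |w (planeEquiv p) - w (planeEquiv q)| ≤ F p.1 + G q.2 := by
    intro p hp q hq
    have a1 := hvert p.1 hp.1 p.2 hp.2 q.2 hq.2
    have a2 := hhor q.2 hq.2 p.1 hp.1 q.1 hq.1
    calc |w (planeEquiv p) - w (planeEquiv q)|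
        ≤ |w (planeEquiv (p.1, p.2)) - w (planeEquiv (p.1, q.2))| +
          |w (planeEquiv (p.1, q.2)) - w (planeEquiv (q.1, q.2))| := abs_sub_le _ _ _
      _ ≤ _ := add_le_add a1 a2
  have hFi : Integrable F μ₁ := (iT 0).integral_prod_left
  have hGi : Integrable G μ₂ := (iT 1).integral_prod_right
  have hmain := integral_sub_mean_sq_le_of_coordinate_paths (μ₁ := μ₁) (μ₂ := μ₂) hL
    (by simp [hμ₁, hL.le]) (by simp [hμ₂, hL.le]) (hi hcont) (hi (hcont.pow 2)) hFi hGi (by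
      filter_upwards [hmem] with p hp
      filter_upwards [hmem] with q hq
      exact ⟨hpath p hp q hq, by rw [abs_sub_comm]; exact hpath q hq p hp⟩)
  rw [setIntegral_sq, setIntegral_sq, setIntegral_sq]
  refine hmain.trans ?_
  have hTn : Integrable (fun p => ‖T (planeEquiv p)‖) (μ₁.prod μ₂) := by
    refine hi (Continuous.continuousOn ?_)
    exact (hT.comp continuous_planeEquiv).norm
  have eF : ∫ x, F x ∂μ₁ ≤ ∫ p, ‖T (planeEquiv p)‖ ∂(μ₁.prod μ₂) := by
    rw [hF, ← integral_prod _ (iT 0)]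
    exact integral_mono (iT 0) hTn fun p => abs_apply_le_norm _ _
  have eG : ∫ y, G y ∂μ₂ ≤ ∫ p, ‖T (planeEquiv p)‖ ∂(μ₁.prod μ₂) := by
    rw [hG, ← integral_prod_symm _ (iT 1)]
    exact integral_mono (iT 1) hTn fun p => abs_apply_le_norm _ _
  have hF0 : 0 ≤ ∫ x, F x ∂μ₁ := integral_nonneg fun x => integral_nonneg fun y => abs_nonneg _
  have hG0 : 0 ≤ ∫ y, G y ∂μ₂ := integral_nonneg fun x => integral_nonneg fun y => abs_nonneg _
  -- Both component integrals are at most ∫‖T‖, and (2∫‖T‖)²/2 = 2(∫‖T‖)².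
  nlinarith [pow_le_pow_left₀ (add_nonneg hF0 hG0) (add_le_add eF eG) 2]

end HighContrast
end

open Filter Topology MeasureTheory

noncomputable section

namespace HighContrast

/-! ### The div-curl bound -/

section CauchySchwarz

variable {α E F : Type*} [MeasurableSpace α] {μ : Measure α} [NormedAddCommGroup E]
  [NormedAddCommGroup F]

theorem integrable_norm_mul_norm {f : α → E} {g : α → F} (hf : MemLp f 2 μ) (hg : MemLp g 2 μ) :
    Integrable (fun x => ‖f x‖ * ‖g x‖) μ :=
  hf.norm.integrable_mul hg.norm

theorem integral_norm_mul_norm_le {f : α → E} {g : α → F} (hf : MemLp f 2 μ) (hg : MemLp g 2 μ) :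
    ∫ x, ‖f x‖ * ‖g x‖ ∂μ ≤ √(∫ x, ‖f x‖ ^ 2 ∂μ) * √(∫ x, ‖g x‖ ^ 2 ∂μ) := by
  have h2 : ENNReal.ofReal 2 = 2 := by simp
  have := integral_mul_norm_le_Lp_mul_Lq (μ := μ) Real.HolderConjugate.two_two
    (f := fun x => ‖f x‖) (g := fun x => ‖g x‖) (by rw [h2]; exact hf.norm)
    (by rw [h2]; exact hg.norm)
  simpa [Real.sqrt_eq_rpow] using this

theorem abs_integral_mul_le {f g : α → ℝ} (hf : MemLp f 2 μ) (hg : MemLp g 2 μ) :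
    |∫ x, f x * g x ∂μ| ≤ √(∫ x, f x ^ 2 ∂μ) * √(∫ x, g x ^ 2 ∂μ) := by
  have := integral_norm_mul_norm_le hf hg
  simp only [Real.norm_eq_abs, sq_abs] at this
  refine (abs_integral_le_integral_abs).trans (le_trans (le_of_eq ?_) this)
  simp [abs_mul]

theorem integral_sq_norm_eq {f : α → E} (hf : MemLp f 2 μ) :
    ∫ x, ‖f x‖ ^ 2 ∂μ = (eLpNorm f 2 μ).toReal ^ 2 := by
  rw [hf.eLpNorm_eq_integral_rpow_norm two_ne_zero ENNReal.ofNat_ne_top]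
  have h0 : 0 ≤ ∫ x, ‖f x‖ ^ 2 ∂μ := integral_nonneg fun x => by positivity
  simp only [ENNReal.toReal_ofNat, Real.rpow_ofNat]
  rw [ENNReal.toReal_ofReal (by positivity), ← Real.rpow_natCast, ← Real.rpow_mul h0]
  norm_num

end CauchySchwarz

theorem integrable_inner {α : Type*} [MeasurableSpace α] {μ : Measure α} {f g : α → Plane}
    (hf : MemLp f 2 μ) (hg : MemLp g 2 μ) : Integrable (fun x => inner ℝ (f x) (g x)) μ :=
  (integrable_norm_mul_norm hf hg).mono' (hf.1.inner hg.1)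
    (Eventually.of_forall fun _ => abs_real_inner_le_norm _ _)

theorem act_J_act_J (x : Plane) : act J (act J x) = - x := by
  ext i; fin_cases i <;> simp [act_apply, J]

theorem norm_act_J (x : Plane) : ‖act J x‖ = ‖x‖ := by
  rw [← sq_eq_sq₀ (norm_nonneg _) (norm_nonneg _), norm_sq_plane, norm_sq_plane, act_J_zero,
    act_J_one]
  ring

theorem memLp_continuous_mul {μ : Measure Plane} {φ : Plane → ℝ} (hφ : Continuous φ)
    (hφc : HasCompactSupport φ) {η : Plane → Plane} (hη : MemLp η 2 μ) :
    MemLp (fun x => φ x • η x) 2 μ := by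
  obtain ⟨C, hC⟩ := hφ.bounded_above_of_compact_support hφc
  refine (hη.const_smul C).mono (hφ.aestronglyMeasurable.smul hη.1) (Eventually.of_forall fun x => ?_)
  simp only [norm_smul, Pi.smul_apply]
  gcongr
  exact (hC x).trans (le_abs_self C)

theorem continuous_gradient {φ : Plane → ℝ} (hφ : ContDiff ℝ ((⊤ : ℕ∞) : WithTop ℕ∞) φ) :
    Continuous (gradient φ) := by
  unfold gradient
  exact (LinearIsometryEquiv.continuous _).comp (hφ.continuous_fderiv (by simp))

theorem gradient_eq_zero_of_notMem {φ : Plane → ℝ} {x : Plane} (hx : x ∉ tsupport φ) :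
    gradient φ x = 0 := by
  have : fderiv ℝ φ x = 0 := by
    by_contra h
    exact hx (support_fderiv_subset ℝ h)
  simp [gradient, this]

theorem hasCompactSupport_gradient {φ : Plane → ℝ} (hφc : HasCompactSupport φ) :
    HasCompactSupport (gradient φ) :=
  HasCompactSupport.intro hφc fun _ hx => gradient_eq_zero_of_notMem hx

theorem memLp_of_continuous_hasCompactSupport {E : Type*} [NormedAddCommGroup E] {μ : Measure Plane}
    [IsFiniteMeasureOnCompacts μ] {f : Plane → E} (hf : Continuous f)
    (hfc : HasCompactSupport f) : MemLp f 2 μ :=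
  hf.memLp_of_hasCompactSupport hfc

theorem setIntegral_eq_of_tsupport {s U : Set Plane} {φ : Plane → ℝ} (hs : tsupport φ ⊆ s)
    (hsU : s ⊆ U) (hsm : MeasurableSet s) (hUm : MeasurableSet U) {f : Plane → ℝ}
    (hf : ∀ x, x ∉ tsupport φ → f x = 0) : ∫ x in U, f x = ∫ x in s, f x := by
  rw [← integral_indicator hUm, ← integral_indicator hsm]
  congr 1
  ext x
  by_cases hx : x ∈ s
  · simp [hx, hsU hx]
  · have := hf x fun h => hx (hs h)
    simp [Set.indicator, this]

/-- Integration by parts against a curl-free field, by means of a stream function. -/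
theorem integral_stream {Ω : Set Plane} (hΩ : IsOpen Ω) {T η : Plane → Plane}
    (hη : MemLp η 2 (volume.restrict Ω)) (hcurl : CurlFree Ω η)
    {V : Set Plane} (hV : IsOpen V) (hT : ContDiff ℝ ((⊤ : ℕ∞) : WithTop ℕ∞) T)
    {w : Plane → ℝ} (hw : ∀ x ∈ V, HasFDerivAt w (innerSL ℝ (- act J (T x))) x)
    {s : Set Plane} (hs : MeasurableSet s) (hsV : s ⊆ V) (hsΩ : s ⊆ Ω)
    {φ : Plane → ℝ} (hφ : ContDiff ℝ ((⊤ : ℕ∞) : WithTop ℕ∞) φ) (hφc : HasCompactSupport φ)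
    (hφs : tsupport φ ⊆ s) :
    ∫ x in s, φ x * inner ℝ (T x) (η x) = - ∫ x in s, w x * inner ℝ (act J (gradient φ x)) (η x) := by
  have hwC : ContDiffOn ℝ ((⊤ : ℕ∞) : WithTop ℕ∞) w V := by
    rw [contDiffOn_infty_iff_fderiv_of_isOpen hV]
    refine ⟨fun x hx => (hw x hx).differentiableAt.differentiableWithinAt, ?_⟩
    have : ContDiff ℝ ((⊤ : ℕ∞) : WithTop ℕ∞) fun x => innerSL ℝ (- act J (T x)) :=
      (innerSL ℝ).contDiff.comp ((ContinuousLinearMap.contDiff _).comp hT).neg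
    exact this.contDiffOn.congr fun x hx => (hw x hx).fderiv
  -- Testing curl-freeness with φw gives the formula, as J∇(φw) = φT + wJ∇φ. The product is smooth
  -- on the whole plane, although w is controlled only on V, because φ is supported in V.
  set ψ : Plane → ℝ := fun x => φ x * w x with hψ
  have hψC : ContDiff ℝ ((⊤ : ℕ∞) : WithTop ℕ∞) ψ := by
    rw [contDiff_iff_contDiffAt]
    intro x
    by_cases hx : x ∈ V
    · exact hφ.contDiffAt.mul ((hwC x hx).contDiffAt (hV.mem_nhds hx))
    · have hx' : x ∉ tsupport φ := fun h => hx (hsV (hφs h))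
      refine (contDiffAt_const (c := (0 : ℝ))).congr_of_eventuallyEq ?_
      filter_upwards [notMem_tsupport_iff_eventuallyEq.1 hx'] with y hy
      simp [hψ, hy]
  have hψs : tsupport ψ ⊆ tsupport φ := closure_mono (fun x hx h => hx (by simp [hψ, h]))
  have hψc : HasCompactSupport ψ := hφc.mono' (subset_closure.trans hψs)
  have hz := hcurl ψ hψC hψc (hψs.trans (hφs.trans hsΩ))
  have hgr : ∀ x ∈ s, act J (gradient ψ x) = φ x • T x + w x • act J (gradient φ x) := by
    intro x hx
    have h1 : gradient ψ x = φ x • (- act J (T x)) + w x • gradient φ x := by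
      refine ext_inner_right ℝ fun v => ?_
      rw [inner_gradient, inner_add_left, real_inner_smul_left, real_inner_smul_left,
        inner_gradient]
      have := (((hφ.differentiable (by simp) x).hasFDerivAt).mul (hw x (hsV hx))).fderiv
      rw [show fderiv ℝ ψ x = _ from this]
      simp
    rw [h1]
    simp only [act, map_add, map_smul, map_neg]
    have := act_J_act_J (T x)
    simp only [act] at this
    rw [this, neg_neg]
  rw [setIntegral_eq_of_tsupport hφs hsΩ hs hΩ.measurableSet (fun x hx => by
    rw [gradient_eq_zero_of_notMem fun h => hx (hψs h)]; simp)] at hz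
  have hηs : MemLp η 2 (volume.restrict s) := hη.mono_measure (Measure.restrict_mono hsΩ le_rfl)
  have i1 : IntegrableOn (fun x => φ x * inner ℝ (T x) (η x)) s := by
    have := integrable_inner (memLp_of_continuous_hasCompactSupport (μ := volume.restrict s)
      (hφ.continuous.smul hT.continuous) hφc.smul_right) hηs
    simpa [real_inner_smul_left, IntegrableOn] using this
  have i2 : IntegrableOn (fun x => w x * inner ℝ (act J (gradient φ x)) (η x)) s := by
    have hcg : Continuous fun x => act J (gradient φ x) :=
      (ContinuousLinearMap.continuous _).comp (continuous_gradient hφ)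
    have hc : Continuous fun x => w x • act J (gradient φ x) := by
      rw [continuous_iff_continuousAt]
      intro x
      by_cases hx : x ∈ V
      · exact (hw x hx).continuousAt.smul hcg.continuousAt
      · have hx' : x ∉ tsupport φ := fun h => hx (hsV (hφs h))
        refine (continuousAt_const (y := (0 : Plane))).congr ?_
        have : (tsupport φ)ᶜ ∈ 𝓝 x := (isClosed_tsupport φ).isOpen_compl.mem_nhds hx'
        filter_upwards [this] with y hy
        rw [gradient_eq_zero_of_notMem hy]; simp
    have hcs : HasCompactSupport fun x => w x • act J (gradient φ x) :=
      HasCompactSupport.intro hφc fun x hx => by rw [gradient_eq_zero_of_notMem hx]; simp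
    have := integrable_inner (memLp_of_continuous_hasCompactSupport (μ := volume.restrict s)
      hc hcs) hηs
    simpa [real_inner_smul_left, IntegrableOn] using this
  have : ∫ x in s, inner ℝ (act J (gradient ψ x)) (η x) =
      ∫ x in s, (φ x * inner ℝ (T x) (η x) + w x * inner ℝ (act J (gradient φ x)) (η x)) := by
    refine setIntegral_congr_fun hs fun x hx => ?_
    simp only [hgr x hx, inner_add_left, real_inner_smul_left]
  rw [this, integral_add i1 i2] at hz
  linarith

/-- The div-curl bound for smooth divergence-free fields. -/
theorem div_curl_bound_of_smooth {Ω : Set Plane} (hΩ : IsOpen Ω) {T η : Plane → Plane}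
    (hη : MemLp η 2 (volume.restrict Ω)) (hcurl : CurlFree Ω η)
    {V : Set Plane} (hV : IsOpen V) (hVc : Convex ℝ V)
    (hT : ContDiff ℝ ((⊤ : ℕ∞) : WithTop ℕ∞) T) (hdiv : ∀ x ∈ V, traceCLM (fderiv ℝ T x) = 0)
    {z : Plane} {L : ℝ} (hL : 0 < L) (hQV : csq z L ⊆ V) (hQ : csq z L ⊆ Ω)
    {φ : Plane → ℝ} (hφ : ContDiff ℝ ((⊤ : ℕ∞) : WithTop ℕ∞) φ) (hφc : HasCompactSupport φ)
    (hφs : tsupport φ ⊆ sq z L) {C : ℝ} (hC : ∀ x, ‖gradient φ x‖ ≤ C)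
    {ι : Type*} [Fintype ι] {y : ι → Plane} {l : ℝ} (hl : 0 < l)
    (hdisj : Pairwise (Function.onFun Disjoint fun i => sq (y i) l))
    (hun : ⋃ i, sq (y i) l = sq z L) :
    |∫ x in sq z L, φ x * inner ℝ (T x) (η x)| ≤
      √(∑ i, 2 * (∫ x in sq (y i) l, ‖T x‖) ^ 2) * (C * √(∫ x in Ω, ‖η x‖ ^ 2)) +
      (l⁻¹ * √(2 * (∫ x in sq z L, ‖T x‖) ^ 2)) *
        ∑ i, |∫ x in sq (y i) l, inner ℝ (act J (gradient φ x)) (η x)| := by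
  have hsm := measurableSet_sq
  have hC0 : 0 ≤ C := (norm_nonneg _).trans (hC 0)
  have hsub : ∀ i, sq (y i) l ⊆ sq z L := fun i => (Set.subset_iUnion (fun i => sq (y i) l) i).trans hun.subset
  have hcsub : ∀ i, csq (y i) l ⊆ csq z L := by
    intro i
    have h1 : y i ∈ sq z L := hsub i ⟨by simp [hl], by simp [hl]⟩
    have key : ∀ t : ℝ, 0 ≤ t → t < l → y i + t • (unitVec 0 + unitVec 1) ∈ sq z L := by
      intro t ht htl
      exact hsub i ⟨by simp [unitVec, ht, htl], by simp [unitVec, ht, htl]⟩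
    -- Only half-open squares are known to be nested; the far corner of the closed cell is
    -- approached along the diagonal.
    have hk : ∀ j : Fin 2, y i j + l ≤ z j + L := by
      intro j
      refine le_of_forall_lt fun c hc => ?_
      set t := max 0 (c - y i j)
      have htl : t < l := max_lt hl (by linarith)
      have hmem := key t (le_max_left _ _) htl
      have h2 : c - y i j ≤ t := le_max_right _ _
      have h3 : y i j + t < z j + L := by
        have e : (y i + t • (unitVec 0 + unitVec 1)) j = y i j + t := by
          fin_cases j <;> simp [unitVec]
        rw [← e]
        fin_cases j
        · exact hmem.1.2
        · exact hmem.2.2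
      linarith
    intro x hx
    exact ⟨⟨h1.1.1.trans hx.1.1, hx.1.2.trans (hk 0)⟩, ⟨h1.2.1.trans hx.2.1, hx.2.2.trans (hk 1)⟩⟩
  obtain ⟨w₀, hw₀⟩ := exists_stream hV hVc hT hdiv
  -- Normalizing the stream function to mean zero on the large square bounds its L² norm there by
  -- the L¹ norm of T.
  set m₀ := (L ^ 2)⁻¹ * ∫ y in sq z L, w₀ y with hm₀
  set w : Plane → ℝ := fun x => w₀ x - m₀ with hwdef
  have hw : ∀ x ∈ V, HasFDerivAt w (innerSL ℝ (- act J (T x))) x := fun x hx =>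
    (hw₀ x hx).sub_const m₀
  have hwQ : ContinuousOn w (csq z L) := fun x hx =>
    (hw x (hQV hx)).continuousAt.continuousWithinAt
  have hfin : IsFiniteMeasure (volume.restrict (csq z L) : Measure Plane) :=
    ⟨by simpa using (isCompact_csq z L).measure_lt_top⟩
  have hw2 : MemLp w 2 (volume.restrict (sq z L)) := by
    have : MemLp w 2 (volume.restrict (csq z L)) := by
      obtain ⟨B, hB⟩ := (isCompact_csq z L).exists_bound_of_continuousOn hwQ
      refine MemLp.of_bound (hwQ.aestronglyMeasurable (isClosed_csq z L).measurableSet) B ?_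
      filter_upwards [ae_restrict_mem (isClosed_csq z L).measurableSet] with x hx using hB x hx
    exact this.mono_measure (Measure.restrict_mono (sq_subset_csq z L) le_rfl)
  have hint := poincare_sq hL hT.continuous fun x hx => hw₀ x (hQV hx)
  set I := ∫ x in sq z L, ‖T x‖ with hI
  set b : Plane → ℝ := fun x => inner ℝ (act J (gradient φ x)) (η x) with hb
  have hbb : ∀ x, |b x| ≤ C * ‖η x‖ := fun x =>
    (abs_real_inner_le_norm _ _).trans (by rw [norm_act_J]; gcongr; exact hC x)
  have hb2Ω : MemLp b 2 (volume.restrict Ω) := by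
    refine (hη.norm.const_mul C).mono ?_ (Eventually.of_forall fun x => ?_)
    · exact (((ContinuousLinearMap.continuous _).comp
        (continuous_gradient hφ)).aestronglyMeasurable).inner hη.1
    · simpa [abs_mul, abs_of_nonneg hC0] using hbb x
  have hb2 : MemLp b 2 (volume.restrict (sq z L)) :=
    hb2Ω.mono_measure (Measure.restrict_mono ((sq_subset_csq z L).trans hQ) le_rfl)
  have hres : ∀ i, volume.restrict (sq (y i) l) ≤ (volume.restrict (sq z L) : Measure Plane) :=
    fun i => Measure.restrict_mono (hsub i) le_rfl
  -- On each cell w is split into its fluctuation, small by the Poincaré inequality of the cell, and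
  -- its mean, bounded through the L² norm of w on the large square. These give the two terms of the
  -- estimate.
  set m : ι → ℝ := fun i => (l ^ 2)⁻¹ * ∫ x in sq (y i) l, w x with hm
  have hA : ∀ i, ∫ x in sq (y i) l, (w x - m i) ^ 2 ≤ 2 * (∫ x in sq (y i) l, ‖T x‖) ^ 2 :=
    fun i => poincare_sq hl hT.continuous fun x hx => hw x (hQV (hcsub i hx))
  have hvol : ∀ i, IsFiniteMeasure (volume.restrict (sq (y i) l) : Measure Plane) := fun i =>
    ⟨by
      rw [Measure.restrict_apply_univ]
      exact (measure_mono ((sq_subset_csq _ _).trans (hcsub i))).trans_lt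
        (isCompact_csq z L).measure_lt_top⟩
  have hmi : ∀ i, |m i| ≤ l⁻¹ * √(2 * I ^ 2) := by
    intro i
    have := hvol i
    have h1 := abs_integral_mul_le (μ := volume.restrict (sq (y i) l)) (f := fun _ => (1 : ℝ))
      (g := w) (memLp_const _) (hw2.mono_measure (hres i))
    have e1 : ∫ x in sq (y i) l, (1 : ℝ) ^ 2 = l ^ 2 := by
      simp [volume_sq _ hl.le]
    rw [e1, Real.sqrt_sq hl.le] at h1
    have h2 : ∫ x in sq (y i) l, w x ^ 2 ≤ 2 * I ^ 2 := by
      refine le_trans ?_ hint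
      exact setIntegral_mono_set hw2.integrable_sq (Eventually.of_forall fun x => by positivity)
        (LE.le.eventuallyLE (hsub i))
    simp only [one_mul] at h1
    simp only [hm, abs_mul, abs_inv, abs_pow, abs_of_pos hl]
    calc (l ^ 2)⁻¹ * |∫ x in sq (y i) l, w x| ≤ (l ^ 2)⁻¹ * (l * √(2 * I ^ 2)) := by
          gcongr
          exact h1.trans (by gcongr)
      _ = l⁻¹ * √(2 * I ^ 2) := by field_simp
  have hwb : Integrable (fun x => w x * b x) (volume.restrict (sq z L)) := hw2.integrable_mul hb2
  have hbi : ∀ i, Integrable b (volume.restrict (sq (y i) l)) := fun i => by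
    have := hvol i
    exact (hb2.mono_measure (hres i)).integrable one_le_two
  have hsplit : ∫ x in sq z L, w x * b x =
      ∑ i, ((∫ x in sq (y i) l, (w x - m i) * b x) + m i * ∫ x in sq (y i) l, b x) := by
    rw [← hun, integral_iUnion_fintype (fun i => hsm _ _) hdisj fun i => hwb.mono_measure (hres i)]
    refine Finset.sum_congr rfl fun i _ => ?_
    rw [← integral_const_mul, ← integral_add]
    · refine integral_congr_ae (Eventually.of_forall fun x => ?_)
      simp only; ring
    · have := (hwb.mono_measure (hres i)).sub ((hbi i).const_mul (m i))
      refine this.congr (Eventually.of_forall fun x => ?_)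
      simp only [Pi.sub_apply]; ring
    · exact (hbi i).const_mul _
  rw [integral_stream hΩ hη hcurl hV hT hw (hsm z L) ((sq_subset_csq z L).trans hQV)
    ((sq_subset_csq z L).trans hQ) hφ hφc hφs, abs_neg]
  change |∫ x in sq z L, w x * b x| ≤ _
  rw [hsplit, Finset.sum_add_distrib]
  refine (abs_add_le _ _).trans (add_le_add ?_ ?_)
  · have hbsum : ∑ i, ∫ x in sq (y i) l, b x ^ 2 ≤ C ^ 2 * ∫ x in Ω, ‖η x‖ ^ 2 := by
      rw [← integral_iUnion_fintype (fun i => hsm _ _) hdisj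
        fun i => (hb2.integrable_sq).mono_measure (hres i), hun, ← integral_const_mul]
      calc ∫ x in sq z L, b x ^ 2 ≤ ∫ x in Ω, b x ^ 2 :=
            setIntegral_mono_set hb2Ω.integrable_sq (Eventually.of_forall fun x => by positivity)
              (LE.le.eventuallyLE ((sq_subset_csq z L).trans hQ))
        _ ≤ ∫ x in Ω, C ^ 2 * ‖η x‖ ^ 2 := by
            refine integral_mono hb2Ω.integrable_sq
              ((hη.norm.integrable_sq).const_mul _) fun x => ?_
            simp only
            rw [← sq_abs (b x), ← mul_pow]
            exact pow_le_pow_left₀ (abs_nonneg _) (hbb x) 2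
    calc |∑ i, ∫ x in sq (y i) l, (w x - m i) * b x|
        ≤ ∑ i, √(∫ x in sq (y i) l, (w x - m i) ^ 2) * √(∫ x in sq (y i) l, b x ^ 2) := by
          refine (Finset.abs_sum_le_sum_abs _ _).trans (Finset.sum_le_sum fun i _ => ?_)
          have := hvol i
          exact abs_integral_mul_le ((hw2.mono_measure (hres i)).sub (memLp_const _))
            (hb2.mono_measure (hres i))
      _ ≤ √(∑ i, ∫ x in sq (y i) l, (w x - m i) ^ 2) * √(∑ i, ∫ x in sq (y i) l, b x ^ 2) :=
          Real.sum_sqrt_mul_sqrt_le _ (fun i => integral_nonneg fun x => by positivity)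
            (fun i => integral_nonneg fun x => by positivity)
      _ ≤ _ := by
          refine mul_le_mul (Real.sqrt_le_sqrt (Finset.sum_le_sum fun i _ => hA i)) ?_
            (Real.sqrt_nonneg _) (Real.sqrt_nonneg _)
          refine (Real.sqrt_le_sqrt hbsum).trans (le_of_eq ?_)
          rw [Real.sqrt_mul (by positivity), Real.sqrt_sq hC0]
  · rw [Finset.mul_sum]
    refine (Finset.abs_sum_le_sum_abs _ _).trans (Finset.sum_le_sum fun i _ => ?_)
    rw [abs_mul]
    gcongr
    exact hmi i

/-- The div-curl bound: a product of a divergence-free and a curl-free field is controlled by local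
`L¹` norms of the former. -/
theorem div_curl_bound {Ω : Set Plane} (hΩ : IsOpen Ω) {T η : Plane → Plane}
    (hT : MemLp T 2 (volume.restrict Ω)) (hdiv : DivFree Ω T)
    (hη : MemLp η 2 (volume.restrict Ω)) (hcurl : CurlFree Ω η)
    {z : Plane} {L : ℝ} (hL : 0 < L) (hQ : csq z L ⊆ Ω)
    {φ : Plane → ℝ} (hφ : ContDiff ℝ ((⊤ : ℕ∞) : WithTop ℕ∞) φ) (hφc : HasCompactSupport φ)
    (hφs : tsupport φ ⊆ sq z L) {C : ℝ} (hC : ∀ x, ‖gradient φ x‖ ≤ C)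
    {ι : Type*} [Fintype ι] {y : ι → Plane} {l : ℝ} (hl : 0 < l)
    (hdisj : Pairwise (Function.onFun Disjoint fun i => sq (y i) l))
    (hun : ⋃ i, sq (y i) l = sq z L) :
    |∫ x in Ω, φ x * inner ℝ (T x) (η x)| ≤
      √(∑ i, 2 * (∫ x in sq (y i) l, ‖T x‖) ^ 2) * (C * √(∫ x in Ω, ‖η x‖ ^ 2)) +
      (l⁻¹ * √(2 * (∫ x in sq z L, ‖T x‖) ^ 2)) *
        ∑ i, |∫ x in sq (y i) l, inner ℝ (act J (gradient φ x)) (η x)| := by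
  have hsq : sq z L ⊆ Ω := (sq_subset_csq z L).trans hQ
  rw [setIntegral_eq_of_tsupport hφs hsq (measurableSet_sq z L) hΩ.measurableSet (fun x hx => by
    rw [image_eq_zero_of_notMem_tsupport hx, zero_mul])]
  -- Both sides of the estimate are continuous in T for the L² norm on the closed square, so smooth
  -- divergence-free approximations there suffice.
  choose V T' hV hVc hKV hTC hTe hTd using fun k : ℕ =>
    exists_smooth_divFree_approx hΩ hT hdiv (isCompact_csq z L) (convex_csq z L) hQ
      (ε := (k + 1 : ENNReal)⁻¹) (by simp)
  have hfin : IsFiniteMeasure (volume.restrict (csq z L) : Measure Plane) :=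
    ⟨by simpa using (isCompact_csq z L).measure_lt_top⟩
  have hTQ : MemLp T 2 (volume.restrict (csq z L)) := hT.mono_measure (Measure.restrict_mono hQ le_rfl)
  have hT'Q : ∀ k, MemLp (T' k) 2 (volume.restrict (csq z L)) := fun k => by
    obtain ⟨B, hB⟩ := (isCompact_csq z L).exists_bound_of_continuousOn (hTC k).continuous.continuousOn
    refine MemLp.of_bound (hTC k).continuous.aestronglyMeasurable B ?_
    filter_upwards [ae_restrict_mem (isClosed_csq z L).measurableSet] with x hx using hB x hx
  set d : ℕ → ℝ := fun k => √(∫ x in csq z L, ‖(T' k - T) x‖ ^ 2) with hd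
  have hd0 : Tendsto d atTop (𝓝 0) := by
    have hle : ∀ k, d k ≤ 1 / ((k : ℝ) + 1) := by
      intro k
      simp only [hd]
      rw [integral_sq_norm_eq ((hT'Q k).sub hTQ), Real.sqrt_sq ENNReal.toReal_nonneg]
      have := ENNReal.toReal_mono (by simp) (hTe k)
      refine this.trans (le_of_eq ?_)
      rw [ENNReal.toReal_inv, one_div]
      congr 1
    exact squeeze_zero (fun k => Real.sqrt_nonneg _) hle tendsto_one_div_add_atTop_nhds_zero_nat
  have hnorm : ∀ A : Set Plane, MeasurableSet A → A ⊆ csq z L →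
      Tendsto (fun k => ∫ x in A, ‖T' k x‖) atTop (𝓝 (∫ x in A, ‖T x‖)) := by
    intro A hA hAQ
    have hle : volume.restrict A ≤ (volume.restrict (csq z L) : Measure Plane) :=
      Measure.restrict_mono hAQ le_rfl
    rw [tendsto_iff_dist_tendsto_zero]
    set c := √(∫ x in csq z L, ‖(1 : ℝ)‖ ^ 2)
    refine squeeze_zero (fun _ => dist_nonneg) (fun k => ?_)
      (by simpa using hd0.mul_const c : Tendsto (fun k => d k * c) atTop (𝓝 0))
    have i1 := ((hT'Q k).integrable one_le_two).norm.mono_measure hle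
    have i2 := (hTQ.integrable one_le_two).norm.mono_measure hle
    rw [Real.dist_eq, ← integral_sub i1 i2]
    calc |∫ x in A, (‖T' k x‖ - ‖T x‖)| ≤ ∫ x in A, ‖(T' k - T) x‖ := by
          refine abs_integral_le_integral_abs.trans (integral_mono (i1.sub i2).abs
            ((((hT'Q k).sub hTQ).integrable one_le_two).norm.mono_measure hle) fun x => ?_)
          exact abs_norm_sub_norm_le _ _
      _ ≤ ∫ x in csq z L, ‖(T' k - T) x‖ :=
          setIntegral_mono_set (((hT'Q k).sub hTQ).integrable one_le_two).norm
            (Eventually.of_forall fun x => norm_nonneg _) (LE.le.eventuallyLE hAQ)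
      _ ≤ d k * c := by
          have := integral_norm_mul_norm_le ((hT'Q k).sub hTQ)
            (memLp_const (1 : ℝ) (μ := volume.restrict (csq z L)) (p := 2))
          simpa [d, c] using this
  have hlhs : Tendsto (fun k => |∫ x in sq z L, φ x * inner ℝ (T' k x) (η x)|) atTop
      (𝓝 |∫ x in sq z L, φ x * inner ℝ (T x) (η x)|) := by
    refine Tendsto.abs ?_
    rw [tendsto_iff_dist_tendsto_zero]
    have hηQ : MemLp (fun x => φ x • η x) 2 (volume.restrict (csq z L)) :=
      memLp_continuous_mul hφ.continuous hφc (hη.mono_measure (Measure.restrict_mono hQ le_rfl))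
    set c := √(∫ x in csq z L, ‖φ x • η x‖ ^ 2)
    refine squeeze_zero (fun _ => dist_nonneg) (fun k => ?_)
      (by simpa using hd0.mul_const c : Tendsto (fun k => d k * c) atTop (𝓝 0))
    have hle : volume.restrict (sq z L) ≤ (volume.restrict (csq z L) : Measure Plane) :=
      Measure.restrict_mono (sq_subset_csq z L) le_rfl
    have i1 := (integrable_inner (hT'Q k) hηQ).mono_measure hle
    have i2 := (integrable_inner hTQ hηQ).mono_measure hle
    simp_rw [← real_inner_smul_right]
    rw [Real.dist_eq, ← integral_sub i1 i2]
    calc |∫ x in sq z L, (inner ℝ (T' k x) (φ x • η x) - inner ℝ (T x) (φ x • η x))|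
        ≤ ∫ x in sq z L, ‖(T' k - T) x‖ * ‖φ x • η x‖ := by
          refine abs_integral_le_integral_abs.trans (integral_mono (i1.sub i2).abs
            ((integrable_norm_mul_norm ((hT'Q k).sub hTQ) hηQ).mono_measure hle) fun x => ?_)
          simp only [← inner_sub_left]
          exact abs_real_inner_le_norm _ _
      _ ≤ ∫ x in csq z L, ‖(T' k - T) x‖ * ‖φ x • η x‖ :=
          setIntegral_mono_set (integrable_norm_mul_norm ((hT'Q k).sub hTQ) hηQ)
            (Eventually.of_forall fun x => by positivity) (LE.le.eventuallyLE (sq_subset_csq z L))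
      _ ≤ d k * c := integral_norm_mul_norm_le ((hT'Q k).sub hTQ) hηQ
  have hsub : ∀ i, sq (y i) l ⊆ sq z L := fun i => (Set.subset_iUnion (fun i => sq (y i) l) i).trans hun.subset
  refine le_of_tendsto_of_tendsto' hlhs ?_ fun k =>
    div_curl_bound_of_smooth hΩ hη hcurl (hV k) (hVc k) (hTC k) (hTd k) hL (hKV k) hQ hφ hφc hφs hC
      hl hdisj hun
  refine Tendsto.add (Tendsto.mul_const _ ?_) (Tendsto.mul_const _ (Tendsto.const_mul _ ?_))
  · refine (Real.continuous_sqrt.tendsto _).comp (tendsto_finsetSum _ fun i _ => ?_)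
    exact ((hnorm _ (measurableSet_sq _ _) ((hsub i).trans (sq_subset_csq z L))).pow 2).const_mul 2
  · refine (Real.continuous_sqrt.tendsto _).comp ?_
    exact ((hnorm _ (measurableSet_sq _ _) (sq_subset_csq z L)).pow 2).const_mul 2

end HighContrast
end

open Filter Topology MeasureTheory

noncomputable section

namespace HighContrast

/-! ### Compactness of divergence-free fields with bounded weighted energy -/

theorem volume_csq (z : Plane) {L : ℝ} (hL : 0 ≤ L) : volume.real (csq z L) = L ^ 2 := by
  have := measurePreserving_planeEquiv.measureReal_preimage
    (isClosed_csq z L).measurableSet.nullMeasurableSet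
  have h : planeEquiv ⁻¹' csq z L = Set.Icc (z 0) (z 0 + L) ×ˢ Set.Icc (z 1) (z 1 + L) := by
    ext p; rfl
  rw [← this, h, Measure.volume_eq_prod, measureReal_prod_prod]
  simp [hL]
  ring

theorem exists_grid_index {a x l : ℝ} (hl : 0 < l) {N : ℕ} (hx : x ∈ Set.Ico a (a + N * l)) :
    ∃ i : Fin N, x ∈ Set.Ico (a + i * l) (a + i * l + l) := by
  have h0 : 0 ≤ (x - a) / l := div_nonneg (by linarith [hx.1]) hl.le
  have h1 : (x - a) / l < N := by rw [div_lt_iff₀ hl]; linarith [hx.2]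
  refine ⟨⟨⌊(x - a) / l⌋₊, (Nat.floor_lt h0).2 h1⟩, ?_, ?_⟩
  · have := Nat.floor_le h0
    rw [le_div_iff₀ hl] at this
    simp only; linarith
  · have := Nat.lt_floor_add_one ((x - a) / l)
    rw [div_lt_iff₀ hl] at this
    simp only; linarith

theorem grid_index_unique {a x l : ℝ} (hl : 0 < l) {i j : ℕ}
    (hi : x ∈ Set.Ico (a + i * l) (a + i * l + l)) (hj : x ∈ Set.Ico (a + j * l) (a + j * l + l)) :
    i = j := by
  have key : ∀ i j : ℕ, x ∈ Set.Ico (a + i * l) (a + i * l + l) →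
      x ∈ Set.Ico (a + j * l) (a + j * l + l) → i ≤ j := by
    intro i j hi hj
    have h : (i : ℝ) * l < (j + 1 : ℝ) * l := by linarith [hi.1, hj.2]
    have := lt_of_mul_lt_mul_right h hl.le
    exact Nat.lt_succ_iff.1 (by exact_mod_cast this)
  exact le_antisymm (key i j hi hj) (key j i hj hi)

/-- The corners of the cells of a grid. -/
def gridCorner (z : Plane) (l : ℝ) (N : ℕ) (i : Fin N × Fin N) : Plane :=
  !₂[z 0 + i.1 * l, z 1 + i.2 * l]

theorem iUnion_grid (z : Plane) {l : ℝ} (hl : 0 < l) (N : ℕ) :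
    ⋃ i, sq (gridCorner z l N i) l = sq z (N * l) := by
  ext x
  simp only [Set.mem_iUnion]
  constructor
  · rintro ⟨⟨i, j⟩, hi, hj⟩
    have e : ∀ i : Fin N, (i : ℝ) * l + l ≤ N * l := by
      intro i
      have : ((i : ℕ) : ℝ) + 1 ≤ N := by exact_mod_cast i.2
      nlinarith
    have p : ∀ i : Fin N, 0 ≤ (i : ℝ) * l := fun i => by positivity
    simp only [gridCorner, Set.mem_Ico] at hi hj
    simp at hi hj
    exact ⟨⟨by linarith [p i], by linarith [e i]⟩, ⟨by linarith [p j], by linarith [e j]⟩⟩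
  · intro hx
    obtain ⟨i, hi⟩ := exists_grid_index hl hx.1
    obtain ⟨j, hj⟩ := exists_grid_index hl hx.2
    exact ⟨(i, j), by simpa [gridCorner] using hi, by simpa [gridCorner] using hj⟩

theorem pairwise_disjoint_grid (z : Plane) {l : ℝ} (hl : 0 < l) (N : ℕ) :
    Pairwise (Function.onFun Disjoint fun i => sq (gridCorner z l N i) l) := by
  rintro ⟨i, j⟩ ⟨i', j'⟩ hne
  refine Set.disjoint_left.2 fun x hx hx' => hne ?_
  have h1 : (i : ℕ) = i' := grid_index_unique hl (a := z 0) (x := x 0)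
    (by simpa [gridCorner] using hx.1) (by simpa [gridCorner] using hx'.1)
  have h2 : (j : ℕ) = j' := grid_index_unique hl (a := z 1) (x := x 1)
    (by simpa [gridCorner] using hx.2) (by simpa [gridCorner] using hx'.2)
  exact Prod.ext (Fin.ext h1) (Fin.ext h2)

/-- Weights which are asymptotically bounded by `A` in the sense of measures. -/
structure IsWeight (Ω : Set Plane) (c : ℕ → Plane → ℝ) (A : ℝ) : Prop where
  nonneg : 0 ≤ A
  measurable : ∀ n, Measurable (c n)
  one_le : ∀ n x, 1 ≤ c n x
  bdd : ∀ n, ∃ B, ∀ x, c n x ≤ B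
  limsup : ∀ φ : Plane → ℝ, Continuous φ → HasCompactSupport φ → tsupport φ ⊆ Ω → (∀ x, 0 ≤ φ x) →
    ∀ ε > 0, ∀ᶠ n in atTop, ∫ x in Ω, c n x * φ x ≤ A * (∫ x in Ω, φ x) + ε

/-- Smooth functions supported in a square contained in `Ω`. -/
structure IsLocalTest (Ω : Set Plane) (φ : Plane → ℝ) : Prop where
  contDiff : ContDiff ℝ ((⊤ : ℕ∞) : WithTop ℕ∞) φ
  hasCompactSupport : HasCompactSupport φ
  exists_sq : ∃ z L, 0 < L ∧ csq z L ⊆ Ω ∧ tsupport φ ⊆ sq z L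

theorem IsLocalTest.tsupport_subset {Ω : Set Plane} {φ : Plane → ℝ} (h : IsLocalTest Ω φ) :
    tsupport φ ⊆ Ω := by
  obtain ⟨z, L, _, h1, h2⟩ := h.exists_sq
  exact h2.trans ((sq_subset_csq z L).trans h1)

theorem exists_gradient_bound {φ : Plane → ℝ} (hφ : ContDiff ℝ ((⊤ : ℕ∞) : WithTop ℕ∞) φ)
    (hφc : HasCompactSupport φ) : ∃ C, ∀ x, ‖gradient φ x‖ ≤ C :=
  (continuous_gradient hφ).bounded_above_of_compact_support (hasCompactSupport_gradient hφc)

section Weight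

variable {Ω : Set Plane} {c : ℕ → Plane → ℝ} {A : ℝ}

theorem IsWeight.pos (hc : IsWeight Ω c A) (n : ℕ) (x : Plane) : 0 < c n x :=
  zero_lt_one.trans_le (hc.one_le n x)

theorem IsWeight.integrableOn (hc : IsWeight Ω c A) {K : Set Plane} (hK : volume K ≠ ⊤) (n : ℕ) :
    IntegrableOn (c n) K := by
  obtain ⟨B, hB⟩ := hc.bdd n
  refine Measure.integrableOn_of_bounded (M := B) hK (hc.measurable n).aestronglyMeasurable
    (Eventually.of_forall fun x => ?_)
  rw [Real.norm_of_nonneg (hc.pos n x).le]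
  exact hB x

/-- By outer regularity the indicator of K lies below a continuous cutoff of almost the same
integral, to which the asymptotic bound on the weights applies. -/
theorem IsWeight.eventually_setIntegral_le (hc : IsWeight Ω c A) (hΩ : IsOpen Ω) {K : Set Plane}
    (hK : IsCompact K) (hKΩ : K ⊆ Ω) {ε : ℝ} (hε : 0 < ε) :
    ∀ᶠ n in atTop, ∫ x in K, c n x ≤ A * volume.real K + ε := by
  have hA := hc.nonneg
  set δ := ε / (2 * (A + 1)) with hδ
  have hδ0 : 0 < δ := by positivity
  obtain ⟨U, hKU, hU, hUlt⟩ := hK.exists_isOpen_lt_add (μ := (volume : Measure Plane))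
    (ε := ENNReal.ofReal δ) (by simpa using hδ0)
  obtain ⟨φ, hφ1, hφc, hφs, hφI⟩ := exists_continuousMap_one_of_isCompact_subset_isOpen hK (hU.inter hΩ)
    (Set.subset_inter hKU hKΩ)
  have hφΩ : tsupport φ ⊆ Ω := hφs.trans Set.inter_subset_right
  have hφi : Integrable φ := φ.continuous.integrable_of_hasCompactSupport hφc
  have hφint : ∫ x in Ω, φ x ≤ volume.real K + δ := by
    have hUfin : volume U ≠ ⊤ := (hUlt.trans (by
      simp [hK.measure_lt_top])).ne
    calc ∫ x in Ω, φ x ≤ ∫ x in U, (1 : ℝ) := by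
          rw [setIntegral_eq_of_tsupport (φ := φ) hφs Set.inter_subset_right
            (hU.inter hΩ).measurableSet hΩ.measurableSet
            (fun x hx => image_eq_zero_of_notMem_tsupport hx)]
          refine (setIntegral_mono_set (t := U) hφi.integrableOn
            (Eventually.of_forall fun x => (hφI x).1)
            (LE.le.eventuallyLE Set.inter_subset_left)).trans ?_
          exact setIntegral_mono hφi.integrableOn (integrableOn_const hUfin)
            fun x => (hφI x).2
      _ = volume.real U := by simp
      _ ≤ volume.real K + δ := by
          have := ENNReal.toReal_mono (by simp [hK.measure_lt_top.ne]) hUlt.le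
          rw [ENNReal.toReal_add hK.measure_lt_top.ne (by simp),
            ENNReal.toReal_ofReal hδ0.le] at this
          exact this
  filter_upwards [hc.limsup φ φ.continuous hφc hφΩ (fun x => (hφI x).1) (ε / 2) (by positivity)]
    with n hn
  have hci : Integrable (fun x => c n x * φ x) := by
    obtain ⟨B, hB⟩ := hc.bdd n
    refine hφi.bdd_mul (c := B) (hc.measurable n).aestronglyMeasurable
      (Eventually.of_forall fun x => ?_)
    rw [Real.norm_of_nonneg (hc.pos n x).le]
    exact hB x
  calc ∫ x in K, c n x = ∫ x in K, c n x * φ x :=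
        setIntegral_congr_fun hK.measurableSet fun x hx => by simp [hφ1 hx]
    _ ≤ ∫ x in Ω, c n x * φ x := setIntegral_mono_set hci.integrableOn
        (Eventually.of_forall fun x => mul_nonneg (hc.pos n x).le (hφI x).1)
        (LE.le.eventuallyLE hKΩ)
    _ ≤ A * (∫ x in Ω, φ x) + ε / 2 := hn
    _ ≤ A * (volume.real K + δ) + ε / 2 := by gcongr
    _ ≤ A * volume.real K + ε := by
        have : A * δ ≤ ε / 2 := by
          rw [hδ, mul_div_assoc', div_le_div_iff₀ (by positivity) (by positivity)]
          nlinarith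
        linarith

/-- The `L¹` norm on a set is controlled by the weighted energy. -/
theorem IsWeight.sq_setIntegral_norm_le (hc : IsWeight Ω c A) {S : Set Plane} (hS : volume S ≠ ⊤)
    {T : Plane → Plane} (hT : MemLp T 2 (volume.restrict S)) (n : ℕ) :
    (∫ x in S, ‖T x‖) ^ 2 ≤ (∫ x in S, c n x) * ∫ x in S, ‖T x‖ ^ 2 / c n x := by
  have hsq : Measurable fun x => √(c n x) := (hc.measurable n).sqrt
  have h1 : MemLp (fun x => √(c n x)) 2 (volume.restrict S) := by
    rw [memLp_two_iff_integrable_sq hsq.aestronglyMeasurable]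
    refine (hc.integrableOn hS n).congr (Eventually.of_forall fun x => ?_)
    simp [Real.sq_sqrt (hc.pos n x).le]
  have h2 : MemLp (fun x => ‖T x‖ / √(c n x)) 2 (volume.restrict S) := by
    refine hT.norm.mono (hT.1.norm.div₀ hsq.aestronglyMeasurable) (Eventually.of_forall fun x => ?_)
    have : 1 ≤ √(c n x) := Real.one_le_sqrt.2 (hc.one_le n x)
    simp only [norm_div, norm_norm]
    rw [Real.norm_of_nonneg (by positivity : 0 ≤ √(c n x))]
    exact div_le_self (norm_nonneg _) this
  have := abs_integral_mul_le h1 h2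
  have e1 : ∀ x, √(c n x) * (‖T x‖ / √(c n x)) = ‖T x‖ := fun x => by
    have : 0 < √(c n x) := Real.sqrt_pos.2 (hc.pos n x)
    field_simp
  have e2 : ∀ x, √(c n x) ^ 2 = c n x := fun x => Real.sq_sqrt (hc.pos n x).le
  simp only [e1, e2, div_pow] at this
  have h0 : 0 ≤ ∫ x in S, ‖T x‖ := integral_nonneg fun x => norm_nonneg _
  have hA : 0 ≤ ∫ x in S, c n x := integral_nonneg fun x => (hc.pos n x).le
  have hB : 0 ≤ ∫ x in S, ‖T x‖ ^ 2 / c n x :=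
    integral_nonneg fun x => div_nonneg (by positivity) (hc.pos n x).le
  rw [abs_of_nonneg h0] at this
  calc _ ≤ _ := pow_le_pow_left₀ h0 this 2
    _ = _ := by rw [mul_pow, Real.sq_sqrt hA, Real.sq_sqrt hB]

theorem IsWeight.integrable_energy (hc : IsWeight Ω c A) {μ : Measure Plane} {T : Plane → Plane}
    (hT : MemLp T 2 μ) (n : ℕ) : Integrable (fun x => ‖T x‖ ^ 2 / c n x) μ := by
  refine hT.norm.integrable_sq.mono' ?_ (Eventually.of_forall fun x => ?_)
  · exact ((hT.1.norm.pow 2).div₀ (hc.measurable n).aestronglyMeasurable)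
  · rw [Real.norm_of_nonneg (div_nonneg (by positivity) (hc.pos n x).le)]
    exact div_le_self (by positivity) (hc.one_le n x)

variable {T : ℕ → Plane → Plane} {E : ℝ}

/-- Local `L¹` bound for fields with bounded weighted energy. -/
theorem IsWeight.eventually_norm_csq_le (hc : IsWeight Ω c A) (hΩ : IsOpen Ω)
    (hT : ∀ n, MemLp (T n) 2 (volume.restrict Ω)) (hE : ∀ n, ∫ x in Ω, ‖T n x‖ ^ 2 / c n x ≤ E)
    {z : Plane} {L : ℝ} (hQ : csq z L ⊆ Ω) :
    ∃ M, ∀ᶠ n in atTop, (∫ x in sq z L, ‖T n x‖) ^ 2 ≤ M := by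
  refine ⟨(A * volume.real (csq z L) + 1) * E, ?_⟩
  filter_upwards [hc.eventually_setIntegral_le hΩ (isCompact_csq z L) hQ zero_lt_one] with n hn
  have hsub : sq z L ⊆ Ω := (sq_subset_csq z L).trans hQ
  have hfin : volume (sq z L) ≠ ⊤ :=
    ((measure_mono (sq_subset_csq z L)).trans_lt (isCompact_csq z L).measure_lt_top).ne
  refine (hc.sq_setIntegral_norm_le hfin
    ((hT n).mono_measure (Measure.restrict_mono hsub le_rfl)) n).trans ?_
  have h1 : ∫ x in sq z L, c n x ≤ A * volume.real (csq z L) + 1 :=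
    le_trans (setIntegral_mono_set (hc.integrableOn (isCompact_csq z L).measure_lt_top.ne n)
      (Eventually.of_forall fun x => (hc.pos n x).le)
      (LE.le.eventuallyLE (sq_subset_csq z L))) hn
  have h2 : ∫ x in sq z L, ‖T n x‖ ^ 2 / c n x ≤ E :=
    le_trans (setIntegral_mono_set (hc.integrable_energy (hT n) n)
      (Eventually.of_forall fun x => div_nonneg (by positivity) (hc.pos n x).le)
      (LE.le.eventuallyLE hsub)) (hE n)
  refine mul_le_mul h1 h2 (integral_nonneg fun x => div_nonneg (by positivity) (hc.pos n x).le) ?_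
  exact (integral_nonneg fun x => (hc.pos n x).le).trans h1

/-- Uniform continuity, with respect to the curl-free factor, of the product of a curl-free field
and divergence-free fields with bounded weighted energy. -/
theorem IsWeight.exists_div_curl_bound (hc : IsWeight Ω c A) (hΩ : IsOpen Ω)
    (hT : ∀ n, MemLp (T n) 2 (volume.restrict Ω)) (hdiv : ∀ n, DivFree Ω (T n))
    (hE : ∀ n, ∫ x in Ω, ‖T n x‖ ^ 2 / c n x ≤ E) {φ : Plane → ℝ} (hφ : IsLocalTest Ω φ) :
    ∃ M, 0 ≤ M ∧ ∀ᶠ n in atTop, ∀ η : Plane → Plane, MemLp η 2 (volume.restrict Ω) →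
      CurlFree Ω η → |∫ x in Ω, φ x * inner ℝ (T n x) (η x)| ≤ M * √(∫ x in Ω, ‖η x‖ ^ 2) := by
  obtain ⟨z, L, hL, hQ, hφs⟩ := hφ.exists_sq
  obtain ⟨C, hC⟩ := exists_gradient_bound hφ.contDiff hφ.hasCompactSupport
  have hC0 : 0 ≤ C := (norm_nonneg _).trans (hC 0)
  obtain ⟨M, hM⟩ := hc.eventually_norm_csq_le hΩ hT hE hQ
  refine ⟨√(2 * M) * C, by positivity, ?_⟩
  filter_upwards [hM] with n hn η hη hcurl
  -- With a single cell the mean term is the integral of J∇φ·η over the whole support of φ, which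
  -- vanishes because η is curl-free.
  have key := div_curl_bound (ι := Unit) (y := fun _ => z) hΩ (hT n) (hdiv n) hη hcurl hL hQ
    hφ.contDiff hφ.hasCompactSupport hφs hC hL
    (fun i j h => absurd (Subsingleton.elim i j) h) (Set.iUnion_const _)
  have hz : ∫ x in sq z L, inner ℝ (act J (gradient φ x)) (η x) = 0 := by
    rw [← hcurl φ hφ.contDiff hφ.hasCompactSupport hφ.tsupport_subset]
    exact (setIntegral_eq_of_tsupport hφs ((sq_subset_csq z L).trans hQ) (measurableSet_sq z L)
      hΩ.measurableSet (fun x hx => by rw [gradient_eq_zero_of_notMem hx]; simp)).symm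
  simp only [Finset.univ_unique, Finset.sum_singleton, hz, abs_zero, mul_zero, add_zero] at key
  refine key.trans ?_
  rw [mul_assoc]
  gcongr

/-- The div-curl lemma for curl-free fields converging weakly to zero. -/
theorem IsWeight.tendsto_div_curl_zero (hc : IsWeight Ω c A) (hΩ : IsOpen Ω)
    (hT : ∀ n, MemLp (T n) 2 (volume.restrict Ω)) (hdiv : ∀ n, DivFree Ω (T n))
    (hE : ∀ n, ∫ x in Ω, ‖T n x‖ ^ 2 / c n x ≤ E) {φ : Plane → ℝ} (hφ : IsLocalTest Ω φ)
    {η : ℕ → Plane → Plane} (hη : ∀ n, MemLp (η n) 2 (volume.restrict Ω))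
    (hcurl : ∀ n, CurlFree Ω (η n)) {H : ℝ} (hH : ∀ n, ∫ x in Ω, ‖η n x‖ ^ 2 ≤ H)
    {l : Filter ℕ} (hl : l ≤ atTop)
    (hw : ∀ Φ : Plane → Plane, MemLp Φ 2 (volume.restrict Ω) →
      Tendsto (fun n => ∫ x in Ω, inner ℝ (Φ x) (η n x)) l (𝓝 0)) :
    Tendsto (fun n => ∫ x in Ω, φ x * inner ℝ (T n x) (η n x)) l (𝓝 0) := by
  obtain ⟨z, L, hL, hQ, hφs⟩ := hφ.exists_sq
  obtain ⟨C, hC⟩ := exists_gradient_bound hφ.contDiff hφ.hasCompactSupport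
  have hC0 : 0 ≤ C := (norm_nonneg _).trans (hC 0)
  have hA := hc.nonneg
  have hE0 : 0 ≤ E := (integral_nonneg fun x =>
    div_nonneg (by positivity) (hc.pos 0 x).le).trans (hE 0)
  have hH0 : 0 ≤ H := (integral_nonneg fun x => by positivity).trans (hH 0)
  obtain ⟨M, hM⟩ := hc.eventually_norm_csq_le hΩ hT hE hQ
  rw [Metric.tendsto_nhds]
  intro ε hε
  -- A cell of side s carries weight at most (A + 1)s² for large n, so the fluctuation term of
  -- `div_curl_bound` is at most sB, and N makes this less than ε/2. Once the grid is fixed, the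
  -- mean term is controlled by finitely many pairings of `η n` with fixed fields, and these tend to
  -- zero.
  set B := √(2 * (A + 1) * E) * (C * √H) with hB
  obtain ⟨N, hN⟩ := exists_nat_gt (2 * L * B / ε)
  have hB0 : 0 ≤ B := by positivity
  have hNpos : (0 : ℝ) < N := lt_of_le_of_lt (by positivity) hN
  set s := L / N with hs
  have hs0 : 0 < s := by positivity
  have hNs : N * s = L := by rw [hs]; field_simp
  have hsB : s * B < ε / 2 := by
    rw [hs, div_mul_eq_mul_div, div_lt_iff₀ hNpos]
    rw [div_lt_iff₀ hε] at hN
    linarith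
  set y := gridCorner z s N with hy
  have hun : ⋃ i, sq (y i) s = sq z L := by rw [← hNs]; exact iUnion_grid z hs0 N
  have hdisj := pairwise_disjoint_grid z hs0 N
  have hsub : ∀ i, sq (y i) s ⊆ sq z L := fun i =>
    (Set.subset_iUnion (fun i => sq (y i) s) i).trans hun.subset
  have hsq : sq z L ⊆ Ω := (sq_subset_csq z L).trans hQ
  have hcsub : ∀ i, csq (y i) s ⊆ csq z L := by
    intro i x hx
    have e : ∀ i : Fin N, (i : ℝ) * s + s ≤ L := by
      intro i
      have : ((i : ℕ) : ℝ) + 1 ≤ N := by exact_mod_cast i.2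
      rw [← hNs]
      nlinarith
    have p : ∀ i : Fin N, 0 ≤ (i : ℝ) * s := fun i => by positivity
    obtain ⟨⟨h1, h2⟩, h3, h4⟩ := hx
    simp [hy, gridCorner] at h1 h2 h3 h4
    exact ⟨⟨by linarith [p i.1], by linarith [e i.1]⟩, ⟨by linarith [p i.2], by linarith [e i.2]⟩⟩
  have hcells : ∀ᶠ n in atTop, ∀ i, ∫ x in csq (y i) s, c n x ≤ A * s ^ 2 + s ^ 2 := by
    rw [eventually_all]
    intro i
    have := hc.eventually_setIntegral_le hΩ (isCompact_csq (y i) s) ((hcsub i).trans hQ)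
      (by positivity : 0 < s ^ 2)
    rwa [volume_csq _ hs0.le] at this
  have hweak : Tendsto (fun n => (s⁻¹ * √(2 * M)) *
      ∑ i, |∫ x in sq (y i) s, inner ℝ (act J (gradient φ x)) (η n x)|) l (𝓝 0) := by
    have : Tendsto (fun n => (s⁻¹ * √(2 * M)) *
      ∑ i, |∫ x in sq (y i) s, inner ℝ (act J (gradient φ x)) (η n x)|) l
        (𝓝 ((s⁻¹ * √(2 * M)) * ∑ i : Fin N × Fin N, |(0 : ℝ)|)) := by
      refine Tendsto.const_mul _ (tendsto_finsetSum _ fun i _ => Tendsto.abs ?_)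
      have hΦ : MemLp ((sq (y i) s).indicator fun x => act J (gradient φ x)) 2
          (volume.restrict Ω) := by
        refine MemLp.indicator (measurableSet_sq _ _) ?_
        refine memLp_of_continuous_hasCompactSupport
          ((ContinuousLinearMap.continuous _).comp (continuous_gradient hφ.contDiff)) ?_
        exact HasCompactSupport.intro hφ.hasCompactSupport fun x hx => by
          simp [gradient_eq_zero_of_notMem hx]
      refine (hw _ hΦ).congr fun n => ?_
      rw [← integral_indicator (measurableSet_sq (y i) s), ← integral_indicator hΩ.measurableSet]
      congr 1
      ext x
      by_cases hx : x ∈ sq (y i) s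
      · simp [hx, hsq (hsub i hx)]
      · simp [hx, Set.indicator]
    simpa using this
  filter_upwards [hl hcells, hl hM, Metric.tendsto_nhds.1 hweak (ε / 2) (by positivity)]
    with n h1 h2 h3
  have key := div_curl_bound hΩ (hT n) (hdiv n) (hη n) (hcurl n) hL hQ hφ.contDiff
    hφ.hasCompactSupport hφs hC hs0 hdisj hun
  have t1 : ∑ i, 2 * (∫ x in sq (y i) s, ‖T n x‖) ^ 2 ≤ s ^ 2 * (2 * (A + 1) * E) := by
    have hint := hc.integrable_energy (hT n) n
    have hi : ∀ i, (∫ x in sq (y i) s, ‖T n x‖) ^ 2 ≤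
        (A * s ^ 2 + s ^ 2) * ∫ x in sq (y i) s, ‖T n x‖ ^ 2 / c n x := by
      intro i
      have hfin : volume (csq (y i) s) ≠ ⊤ := (isCompact_csq (y i) s).measure_lt_top.ne
      refine (hc.sq_setIntegral_norm_le
        ((measure_mono (sq_subset_csq (y i) s)).trans_lt hfin.lt_top).ne
        ((hT n).mono_measure (Measure.restrict_mono ((hsub i).trans hsq) le_rfl)) n).trans ?_
      refine mul_le_mul_of_nonneg_right ?_
        (integral_nonneg fun x => div_nonneg (by positivity) (hc.pos n x).le)
      exact (setIntegral_mono_set (hc.integrableOn hfin n)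
        (Eventually.of_forall fun x => (hc.pos n x).le)
        (LE.le.eventuallyLE (sq_subset_csq (y i) s))).trans (h1 i)
    calc ∑ i, 2 * (∫ x in sq (y i) s, ‖T n x‖) ^ 2
        ≤ ∑ i, 2 * ((A * s ^ 2 + s ^ 2) * ∫ x in sq (y i) s, ‖T n x‖ ^ 2 / c n x) :=
          Finset.sum_le_sum fun i _ => by linarith [hi i]
      _ = 2 * (A * s ^ 2 + s ^ 2) * ∫ x in sq z L, ‖T n x‖ ^ 2 / c n x := by
          rw [← hun, integral_iUnion_fintype (fun i => measurableSet_sq _ _) hdisj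
            fun i => hint.mono_measure (Measure.restrict_mono ((hsub i).trans hsq) le_rfl),
            Finset.mul_sum]
          exact Finset.sum_congr rfl fun i _ => by ring
      _ ≤ 2 * (A * s ^ 2 + s ^ 2) * E := by
          gcongr
          exact (setIntegral_mono_set hint
            (Eventually.of_forall fun x => div_nonneg (by positivity) (hc.pos n x).le)
            (LE.le.eventuallyLE hsq)).trans (hE n)
      _ = _ := by ring
  have t2 : √(∑ i, 2 * (∫ x in sq (y i) s, ‖T n x‖) ^ 2) ≤ s * √(2 * (A + 1) * E) := by
    refine (Real.sqrt_le_sqrt t1).trans (le_of_eq ?_)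
    rw [Real.sqrt_mul (by positivity), Real.sqrt_sq hs0.le]
  rw [Real.dist_eq, sub_zero] at h3 ⊢
  have h3' := (le_abs_self _).trans_lt h3
  calc _ ≤ _ := key
    _ ≤ (s * √(2 * (A + 1) * E)) * (C * √H) + (s⁻¹ * √(2 * M)) *
      ∑ i, |∫ x in sq (y i) s, inner ℝ (act J (gradient φ x)) (η n x)| := by
        gcongr
        exact hH n
    _ < ε := by
        have : (s * √(2 * (A + 1) * E)) * (C * √H) = s * B := by rw [hB]; ring
        rw [this]
        linarith

end Weight

end HighContrast
end

open Filter Topology MeasureTheory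

noncomputable section

namespace HighContrast

/-! ### The space `H¹₀` -/

/-- Square-integrable vector fields on `Ω`. -/
abbrev L2V (Ω : Set Plane) : Type := Lp Plane 2 (volume.restrict Ω)

/-- The weak gradient as a continuous linear map. -/
def gradL (Ω : Set Plane) : H10 Ω →L[ℝ] L2V Ω :=
  (WithLp.sndL 2 ℝ (Lp ℝ 2 (volume.restrict Ω)) (L2V Ω)) ∘L (H10 Ω).subtypeL

theorem grad_eq {Ω : Set Plane} (u : H10 Ω) : grad u = gradL Ω u := rfl

instance {Ω : Set Plane} : CompleteSpace (H10 Ω) :=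
  (Submodule.isClosed_topologicalClosure _).completeSpace_coe

/-- Smooth functions with compact support in `Ω`. -/
structure IsTest (Ω : Set Plane) (φ : Plane → ℝ) : Prop where
  contDiff : ContDiff ℝ ((⊤ : ℕ∞) : WithTop ℕ∞) φ
  hasCompactSupport : HasCompactSupport φ
  tsupport_subset : tsupport φ ⊆ Ω

section Test

variable {Ω : Set Plane} {φ : Plane → ℝ}

theorem IsTest.memLp (h : IsTest Ω φ) : MemLp φ 2 (volume.restrict Ω) :=
  memLp_of_continuous_hasCompactSupport h.contDiff.continuous h.hasCompactSupport

theorem IsTest.memLp_gradient (h : IsTest Ω φ) : MemLp (gradient φ) 2 (volume.restrict Ω) :=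
  memLp_of_continuous_hasCompactSupport (continuous_gradient h.contDiff)
    (hasCompactSupport_gradient h.hasCompactSupport)

/-- A test function as an element of `H¹₀`. -/
def testElem (h : IsTest Ω φ) : H10 Ω :=
  ⟨WithLp.toLp 2 (h.memLp.toLp φ, h.memLp_gradient.toLp (gradient φ)),
    Submodule.le_topologicalClosure _ (Submodule.subset_span
      ⟨φ, h.contDiff, h.hasCompactSupport, h.tsupport_subset, h.memLp.coeFn_toLp,
        h.memLp_gradient.coeFn_toLp⟩)⟩

theorem gradL_testElem (h : IsTest Ω φ) : gradL Ω (testElem h) = h.memLp_gradient.toLp (gradient φ) :=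
  rfl

theorem coeFn_gradL_testElem (h : IsTest Ω φ) :
    gradL Ω (testElem h) =ᵐ[volume.restrict Ω] gradient φ :=
  h.memLp_gradient.coeFn_toLp

theorem gradient_add {f g : Plane → ℝ} {x : Plane} (hf : DifferentiableAt ℝ f x)
    (hg : DifferentiableAt ℝ g x) : gradient (f + g) x = gradient f x + gradient g x := by
  simp [gradient, fderiv_add hf hg]

theorem gradient_const_smul {f : Plane → ℝ} {x : Plane} (c : ℝ) (hf : DifferentiableAt ℝ f x) :
    gradient (c • f) x = c • gradient f x := by
  simp [gradient, fderiv_const_smul hf c]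

/-- The test pairs already form a subspace, so the span in the definition of `H10` adds nothing and
elements of the closure are approximated by single test functions. -/
theorem dense_testElem (u : H10 Ω) {ε : ℝ} (hε : 0 < ε) :
    ∃ (φ : Plane → ℝ) (h : IsTest Ω φ), ‖u - testElem h‖ < ε := by
  let W : Submodule ℝ (L2Pair Ω) :=
    { carrier := testPairs Ω
      zero_mem' := by
        refine ⟨0, contDiff_const, HasCompactSupport.zero, by simp, ?_, ?_⟩
        · exact Lp.coeFn_zero ..
        · have : gradient (0 : Plane → ℝ) = 0 := by
            ext1 x; simp [gradient]
          rw [this]; exact Lp.coeFn_zero ..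
      add_mem' := by
        rintro p q ⟨φ, h1, h2, h3, h4, h5⟩ ⟨ψ, k1, k2, k3, k4, k5⟩
        refine ⟨φ + ψ, h1.add k1, h2.add k2, ?_, ?_, ?_⟩
        · exact (tsupport_add φ ψ).trans (Set.union_subset h3 k3)
        · filter_upwards [Lp.coeFn_add p.fst q.fst, h4, k4] with x e1 e2 e3
          rw [Pi.add_apply, ← e2, ← e3]
          exact e1
        · filter_upwards [Lp.coeFn_add p.snd q.snd, h5, k5] with x e1 e2 e3
          rw [gradient_add (h1.differentiable (by simp) x) (k1.differentiable (by simp) x),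
            ← e2, ← e3]
          exact e1
      smul_mem' := by
        rintro c p ⟨φ, h1, h2, h3, h4, h5⟩
        refine ⟨c • φ, h1.const_smul c, ?_, ?_, ?_, ?_⟩
        · exact h2.mono (f' := c • φ) fun x hx h => hx (by simp [h])
        · exact (closure_mono (s := Function.support (c • φ)) (t := Function.support φ)
            fun x hx h => hx (by simp [h])).trans h3
        · filter_upwards [Lp.coeFn_smul c p.fst, h4] with x e1 e2
          rw [Pi.smul_apply, ← e2]
          exact e1
        · filter_upwards [Lp.coeFn_smul c p.snd, h5] with x e1 e2
          rw [gradient_const_smul c (h1.differentiable (by simp) x), ← e2]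
          exact e1 }
  have hspan : (Submodule.span ℝ (testPairs Ω) : Set (L2Pair Ω)) = testPairs Ω := by
    refine Set.Subset.antisymm ?_ Submodule.subset_span
    exact (Submodule.span_le (p := W)).2 subset_rfl
  have hu : (u : L2Pair Ω) ∈ closure (testPairs Ω) := by
    have := u.2
    change (u : L2Pair Ω) ∈ (Submodule.span ℝ (testPairs Ω)).topologicalClosure at this
    rw [← SetLike.mem_coe, Submodule.topologicalClosure_coe, hspan] at this
    exact this
  obtain ⟨p, ⟨φ, h1, h2, h3, h4, h5⟩, hp⟩ := Metric.mem_closure_iff.1 hu ε hε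
  refine ⟨φ, ⟨h1, h2, h3⟩, ?_⟩
  have hpe : p = (testElem ⟨h1, h2, h3⟩ : H10 Ω) := by
    have e1 : p.fst = (IsTest.memLp ⟨h1, h2, h3⟩).toLp φ :=
      Lp.ext (h4.trans (MemLp.coeFn_toLp _).symm)
    have e2 : p.snd = (IsTest.memLp_gradient ⟨h1, h2, h3⟩).toLp (gradient φ) :=
      Lp.ext (h5.trans (MemLp.coeFn_toLp _).symm)
    exact WithLp.ofLp_injective 2 (Prod.ext e1 e2)
  rw [hpe, dist_eq_norm] at hp
  exact_mod_cast hp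

theorem isClosed_H10_induction {P : H10 Ω → Prop} (hP : IsClosed {u | P u})
    (h : ∀ (φ : Plane → ℝ) (hφ : IsTest Ω φ), P (testElem hφ)) (u : H10 Ω) : P u := by
  have : u ∈ closure {u | P u} := by
    refine Metric.mem_closure_iff.2 fun ε hε => ?_
    obtain ⟨φ, hφ, hu⟩ := dense_testElem u hε
    exact ⟨testElem hφ, h φ hφ, by rwa [dist_eq_norm]⟩
  rwa [hP.closure_eq] at this

end Test

theorem L2V_inner_eq {Ω : Set Plane} (f g : L2V Ω) :
    inner ℝ f g = ∫ x in Ω, inner ℝ (f x) (g x) := L2.inner_def f g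

theorem L2V_norm_sq_eq {Ω : Set Plane} (f : L2V Ω) : ‖f‖ ^ 2 = ∫ x in Ω, ‖f x‖ ^ 2 := by
  rw [← real_inner_self_eq_norm_sq, L2V_inner_eq]
  simp

theorem inner_toLp_left {Ω : Set Plane} {Φ : Plane → Plane} (hΦ : MemLp Φ 2 (volume.restrict Ω))
    (g : L2V Ω) : inner ℝ (hΦ.toLp Φ) g = ∫ x in Ω, inner ℝ (Φ x) (g x) := by
  rw [L2V_inner_eq]
  refine integral_congr_ae ?_
  filter_upwards [hΦ.coeFn_toLp] with x hx
  rw [hx]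

/-- The Poincaré inequality on `H¹₀` of a bounded set. -/
theorem exists_poincare {Ω : Set Plane} (hΩb : Bornology.IsBounded Ω) :
    ∃ C : ℝ, 0 < C ∧ ∀ u : H10 Ω, ‖u‖ ≤ C * ‖gradL Ω u‖ := by
  have hfin : volume Ω ≠ ⊤ := hΩb.measure_lt_top.ne
  -- In dimension two the Gagliardo–Nirenberg–Sobolev inequality bounds the L² norm of φ by the L¹
  -- norm of ∇φ; Cauchy–Schwarz on the bounded set Ω then brings in the L² norm of ∇φ.
  set K : NNReal := eLpNormLESNormFDerivOneConst (volume : Measure Plane) (2 : NNReal)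
  set B : ENNReal := K * volume Ω ^ (1 / (2 : ℝ)) with hB
  have hBfin : B ≠ ⊤ := ENNReal.mul_ne_top ENNReal.coe_ne_top
    (ENNReal.rpow_ne_top_of_nonneg (by norm_num) hfin)
  refine ⟨√(B.toReal ^ 2 + 1), by positivity, fun u => ?_⟩
  refine isClosed_H10_induction (P := fun u => ‖u‖ ≤ √(B.toReal ^ 2 + 1) * ‖gradL Ω u‖)
    (isClosed_le continuous_norm (by fun_prop)) (fun φ hφ => ?_) u
  have hpair : ‖testElem hφ‖ ^ 2 = ‖hφ.memLp.toLp φ‖ ^ 2 + ‖gradL Ω (testElem hφ)‖ ^ 2 := by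
    rw [← Submodule.norm_coe, WithLp.prod_norm_sq_eq_of_L2]
    rfl
  have hnn : ∀ x, ‖fderiv ℝ φ x‖ = ‖gradient φ x‖ := fun x => by simp [gradient]
  have hle : eLpNorm φ 2 (volume.restrict Ω) ≤ B * eLpNorm (gradient φ) 2 (volume.restrict Ω) := by
    have h1 := eLpNorm_le_eLpNorm_fderiv_one (volume : Measure Plane) (u := φ) (p := 2)
      (hφ.contDiff.of_le (by exact_mod_cast le_top)) hφ.hasCompactSupport
      (by
        have : Module.finrank ℝ Plane = 2 := by simp
        rw [this]
        exact_mod_cast NNReal.HolderConjugate.two_two)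
    have h2 : eLpNorm (fderiv ℝ φ) 1 volume = eLpNorm (gradient φ) 1 (volume.restrict Ω) := by
      rw [← eLpNorm_norm, ← eLpNorm_norm (gradient φ)]
      simp_rw [hnn]
      rw [eLpNorm_restrict_eq_of_support_subset]
      intro x hx
      by_contra h
      exact hx (by simp [gradient_eq_zero_of_notMem fun h' => h (hφ.tsupport_subset h')])
    have h3 : eLpNorm (gradient φ) 1 (volume.restrict Ω) ≤
        eLpNorm (gradient φ) 2 (volume.restrict Ω) * volume Ω ^ (1 / (2 : ℝ)) := by
      have := eLpNorm_le_eLpNorm_mul_rpow_measure_univ (μ := volume.restrict Ω)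
        (p := 1) (q := 2) one_le_two hφ.memLp_gradient.1
      simp only [Measure.restrict_apply_univ, ENNReal.toReal_one, ENNReal.toReal_ofNat] at this
      convert this using 3
      norm_num
    calc eLpNorm φ 2 (volume.restrict Ω) ≤ eLpNorm φ 2 volume :=
          eLpNorm_mono_measure _ Measure.restrict_le_self
      _ ≤ K * eLpNorm (fderiv ℝ φ) 1 volume := by exact_mod_cast h1
      _ ≤ _ := by rw [h2, hB, mul_assoc, mul_comm (volume Ω ^ _)]; gcongr
  have hle' : ‖hφ.memLp.toLp φ‖ ≤ B.toReal * ‖gradL Ω (testElem hφ)‖ := by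
    rw [gradL_testElem, Lp.norm_toLp, Lp.norm_toLp, ← ENNReal.toReal_mul]
    exact ENNReal.toReal_mono (ENNReal.mul_ne_top hBfin hφ.memLp_gradient.eLpNorm_ne_top) hle
  rw [← sq_le_sq₀ (norm_nonneg _) (by positivity), mul_pow, Real.sq_sqrt (by positivity), hpair]
  nlinarith [pow_le_pow_left₀ (norm_nonneg _) hle' 2]

/-- Orthogonality of rotated gradients and gradients of smooth functions. -/
theorem integral_rot_gradient_inner_gradient {ψ φ : Plane → ℝ}
    (hψ : ContDiff ℝ ((⊤ : ℕ∞) : WithTop ℕ∞) ψ)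
    (hφ : ContDiff ℝ ((⊤ : ℕ∞) : WithTop ℕ∞) φ) (hφc : HasCompactSupport φ) :
    ∫ x, inner ℝ (act J (gradient ψ x)) (gradient φ x) = 0 := by
  have hg : ∀ (f : Plane → ℝ) x i, gradient f x i = fderiv ℝ f x (unitVec i) := by
    intro f x i
    rw [← inner_gradient, inner_plane]
    fin_cases i <;> simp [unitVec]
  have hd : ∀ {f : Plane → ℝ}, ContDiff ℝ ((⊤ : ℕ∞) : WithTop ℕ∞) f → ∀ v,
      ContDiff ℝ ((⊤ : ℕ∞) : WithTop ℕ∞) fun x => fderiv ℝ f x v := fun hf v =>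
    (hf.fderiv_right (m := ((⊤ : ℕ∞) : WithTop ℕ∞)) (by simp)).clm_apply contDiff_const
  have hdc : ∀ {f : Plane → ℝ}, HasCompactSupport f → ∀ v,
      HasCompactSupport fun x => fderiv ℝ f x v := fun hf v => hf.fderiv_apply ℝ v
  have hi : ∀ {f g : Plane → ℝ}, Continuous f → Continuous g → HasCompactSupport g →
      Integrable fun x => f x * g x := fun hf hg hgc =>
    (hf.mul hg).integrable_of_hasCompactSupport hgc.mul_left
  have hparts : ∀ i j : Fin 2, ∫ x, fderiv ℝ ψ x (unitVec i) * fderiv ℝ φ x (unitVec j) =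
      - ∫ x, ψ x * fderiv ℝ (fun y => fderiv ℝ φ y (unitVec j)) x (unitVec i) := by
    intro i j
    rw [integral_mul_fderiv_eq_neg_fderiv_mul_of_integrable (f := ψ)
      (g := fun y => fderiv ℝ φ y (unitVec j)), neg_neg]
    · exact hi (hd hψ _).continuous (hd hφ _).continuous (hdc hφc _)
    · exact hi hψ.continuous (hd (hd hφ _) _).continuous (hdc (hdc hφc _) _)
    · exact hi hψ.continuous (hd hφ _).continuous (hdc hφc _)
    · exact fun x _ => hψ.differentiable (by simp) x
    · exact fun x _ => (hd hφ _).differentiable (by simp) x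
  have hsymm : ∀ x, fderiv ℝ (fun y => fderiv ℝ φ y (unitVec 1)) x (unitVec 0) =
      fderiv ℝ (fun y => fderiv ℝ φ y (unitVec 0)) x (unitVec 1) := by
    intro x
    have hdiff : DifferentiableAt ℝ (fderiv ℝ φ) x :=
      (hφ.fderiv_right (m := ((⊤ : ℕ∞) : WithTop ℕ∞)) (by simp)).differentiable (by simp) x
    have e : ∀ v w, fderiv ℝ (fun y => fderiv ℝ φ y v) x w = fderiv ℝ (fderiv ℝ φ) x w v := by
      intro v w
      rw [fderiv_clm_apply hdiff (differentiableAt_const v)]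
      simp
    rw [e, e]
    exact (hφ.contDiffAt.isSymmSndFDerivAt (by
      simpa using (WithTop.coe_le_coe.2 (le_top : (2 : ℕ∞) ≤ ⊤)))) _ _
  simp_rw [inner_plane, act_J_zero, act_J_one, hg]
  have i1 := hi (hd hψ (unitVec 1)).continuous (hd hφ (unitVec 0)).continuous (hdc hφc _)
  have i2 := hi (hd hψ (unitVec 0)).continuous (hd hφ (unitVec 1)).continuous (hdc hφc _)
  have i1' : Integrable fun x => -(fderiv ℝ ψ x (unitVec 1) * fderiv ℝ φ x (unitVec 0)) := i1.neg
  simp_rw [neg_mul]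
  rw [integral_add i1' i2, integral_neg, hparts, hparts]
  simp_rw [hsymm]
  ring

theorem memLp_act_J {Ω : Set Plane} {η : Plane → Plane} (hη : MemLp η 2 (volume.restrict Ω)) :
    MemLp (fun x => act J (η x)) 2 (volume.restrict Ω) :=
  ContinuousLinearMap.comp_memLp' _ hη

/-- Gradients of functions in `H¹₀` are curl-free. -/
theorem curlFree_gradL {Ω : Set Plane} (u : H10 Ω) : CurlFree Ω (gradL Ω u) := by
  intro ψ hψ hψc hψs
  have hψt : IsTest Ω ψ := ⟨hψ, hψc, hψs⟩
  have hm := memLp_act_J hψt.memLp_gradient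
  rw [← inner_toLp_left hm]
  refine isClosed_H10_induction (P := fun u => inner ℝ (hm.toLp (fun x => act J (gradient ψ x))) (gradL Ω u) = 0)
    (isClosed_eq (continuous_const.inner (gradL Ω).continuous) continuous_const) (fun φ hφ => ?_) u
  rw [inner_toLp_left hm]
  rw [← integral_rot_gradient_inner_gradient hψ hφ.contDiff hφ.hasCompactSupport,
    ← setIntegral_eq_integral_of_forall_compl_eq_zero (s := Ω) (f := fun x =>
      inner ℝ (act J (gradient ψ x)) (gradient φ x))]
  · refine integral_congr_ae ?_
    filter_upwards [coeFn_gradL_testElem hφ] with x hx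
    rw [hx]
  · intro x hx
    rw [gradient_eq_zero_of_notMem fun h => hx (hψs h)]
    simp

end HighContrast
end

open Filter Topology MeasureTheory

noncomputable section

namespace HighContrast

open scoped Convolution

/-! ### Localization -/

/-- Functions supported in a small ball are local test functions. -/
theorem isLocalTest_of_closedBall {Ω : Set Plane} {x : Plane} {r : ℝ} (hr : 0 < r)
    (hΩ : Metric.closedBall x (4 * r) ⊆ Ω) {φ : Plane → ℝ}
    (hφ : ContDiff ℝ ((⊤ : ℕ∞) : WithTop ℕ∞) φ) (hφs : tsupport φ ⊆ Metric.closedBall x r) :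
    IsLocalTest Ω φ := by
  -- The square centred at x with half-side 2r contains the ball of radius r, and its half-diagonal
  -- 2√2 r is less than 4r.
  refine ⟨hφ, HasCompactSupport.of_support_subset_isCompact (isCompact_closedBall x r)
    ((subset_tsupport _).trans hφs), !₂[x 0 - 2 * r, x 1 - 2 * r], 4 * r, by positivity, ?_, ?_⟩
  · intro y hy
    refine hΩ ?_
    obtain ⟨⟨h1, h2⟩, h3, h4⟩ := hy
    simp at h1 h2 h3 h4
    rw [Metric.mem_closedBall, dist_eq_norm, ← sq_le_sq₀ (norm_nonneg _) (by positivity),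
      norm_sq_plane]
    simp only [PiLp.sub_apply]
    nlinarith
  · intro y hy
    have h := hφs hy
    rw [Metric.mem_closedBall, dist_eq_norm] at h
    have h0 := abs_le.1 ((abs_apply_le_norm (y - x) 0).trans h)
    have h1 := abs_le.1 ((abs_apply_le_norm (y - x) 1).trans h)
    simp only [PiLp.sub_apply] at h0 h1
    refine ⟨⟨?_, ?_⟩, ⟨?_, ?_⟩⟩ <;> simp <;> linarith

/-- A function with nonnegative integrals against all nonnegative local test functions is
nonnegative. -/
theorem ae_nonneg_of_localTest {Ω : Set Plane} (hΩ : IsOpen Ω) {g : Plane → ℝ}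
    (hg : IntegrableOn g Ω)
    (h : ∀ φ : Plane → ℝ, IsLocalTest Ω φ → (∀ x, 0 ≤ φ x) → 0 ≤ ∫ x in Ω, φ x * g x) :
    ∀ᵐ x ∂(volume.restrict Ω), 0 ≤ g x := by
  set g' : Plane → ℝ := Ω.indicator g with hg'
  have hloc : LocallyIntegrable g' volume :=
    ((integrable_indicator_iff hΩ.measurableSet).2 hg).locallyIntegrable
  -- The ratio of the radii is fixed at 2, as almost everywhere convergence of mollifications
  -- requires it to stay bounded.
  let ρ : ℕ → ContDiffBump (0 : Plane) := fun k =>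
    ⟨(1 / ((k : ℝ) + 1)) / 2, 1 / ((k : ℝ) + 1), by positivity,
      half_lt_self (by positivity)⟩
  have hρ : Tendsto (fun k => (ρ k).rOut) atTop (𝓝 0) := tendsto_one_div_add_atTop_nhds_zero_nat
  have hae := ContDiffBump.ae_convolution_tendsto_right_of_locallyIntegrable (K := 2) hρ
    (Eventually.of_forall fun k => by
      change 1 / ((k : ℝ) + 1) ≤ 2 * ((1 / ((k : ℝ) + 1)) / 2)
      linarith) hloc
  rw [ae_restrict_iff' hΩ.measurableSet]
  filter_upwards [hae] with x hx hxΩ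
  obtain ⟨R, hR, hRΩ⟩ := Metric.isOpen_iff.1 hΩ x hxΩ
  have hlim : Tendsto (fun k => ((ρ k).normed volume ⋆[ContinuousLinearMap.lsmul ℝ ℝ, volume] g') x)
      atTop (𝓝 (g x)) := by simpa [hg', hxΩ] using hx
  refine ge_of_tendsto hlim ?_
  -- A ball of four times the mollification radius must still fit in the ball of radius R.
  have hev : ∀ᶠ k in atTop, (ρ k).rOut < R / 5 :=
    (tendsto_order.1 hρ).2 _ (by positivity)
  filter_upwards [hev] with k hk
  set φ : Plane → ℝ := fun y => (ρ k).normed volume (x - y) with hφ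
  have hφC : ContDiff ℝ ((⊤ : ℕ∞) : WithTop ℕ∞) φ :=
    (ρ k).contDiff_normed.comp (contDiff_const.sub contDiff_id)
  have hφs : tsupport φ ⊆ Metric.closedBall x (ρ k).rOut := by
    refine closure_minimal ?_ Metric.isClosed_closedBall
    intro y hy
    have : x - y ∈ Function.support ((ρ k).normed (volume : Measure Plane)) := hy
    rw [(ρ k).support_normed_eq] at this
    rw [Metric.mem_closedBall, dist_comm, dist_eq_norm]
    exact (by simpa using this : ‖x - y‖ < (ρ k).rOut).le
  have hφt : IsLocalTest Ω φ := isLocalTest_of_closedBall (ρ k).rOut_pos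
    ((Metric.closedBall_subset_ball (by linarith)).trans hRΩ) hφC hφs
  have := h φ hφt fun y => (ρ k).nonneg_normed _
  rw [← integral_indicator hΩ.measurableSet] at this
  rw [convolution_eq_swap]
  refine this.trans (le_of_eq ?_)
  congr 1
  ext y
  by_cases hy : y ∈ Ω <;> simp [hg', hy, hφ]

theorem ae_eq_zero_of_localTest {Ω : Set Plane} (hΩ : IsOpen Ω) {g : Plane → ℝ}
    (hg : IntegrableOn g Ω)
    (h : ∀ φ : Plane → ℝ, IsLocalTest Ω φ → ∫ x in Ω, φ x * g x = 0) :
    ∀ᵐ x ∂(volume.restrict Ω), g x = 0 := by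
  filter_upwards [ae_nonneg_of_localTest hΩ hg fun φ hφ _ => (h φ hφ).ge,
    ae_nonneg_of_localTest hΩ hg.neg fun φ hφ _ => by
      simp only [Pi.neg_apply, mul_neg, integral_neg, h φ hφ, neg_zero, le_refl]] with x h1 h2
  simp only [Pi.neg_apply] at h2
  linarith

/-! ### Test fields -/

/-- Continuous vector fields with compact support in `Ω`. -/
structure IsTestField (Ω : Set Plane) (Φ : Plane → Plane) : Prop where
  continuous : Continuous Φ
  hasCompactSupport : HasCompactSupport Φ
  tsupport_subset : tsupport Φ ⊆ Ω

theorem IsTestField.memLp {Ω : Set Plane} {Φ : Plane → Plane} (h : IsTestField Ω Φ) :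
    MemLp Φ 2 (volume.restrict Ω) :=
  memLp_of_continuous_hasCompactSupport h.continuous h.hasCompactSupport

theorem isTestField_smul {Ω : Set Plane} {φ : Plane → ℝ} (hφ : Continuous φ)
    (hφc : HasCompactSupport φ) (hφs : tsupport φ ⊆ Ω) {Φ : Plane → Plane} (hΦ : Continuous Φ) :
    IsTestField Ω fun x => φ x • Φ x :=
  ⟨hφ.smul hΦ, hφc.smul_right, (closure_mono (Function.support_smul_subset_left φ Φ)).trans hφs⟩

theorem IsTest.isTestField_gradient {Ω : Set Plane} {φ : Plane → ℝ} (h : IsTest Ω φ) :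
    IsTestField Ω (gradient φ) :=
  ⟨continuous_gradient h.contDiff, hasCompactSupport_gradient h.hasCompactSupport,
    (closure_minimal (s := Function.support (gradient φ)) (t := tsupport φ)
      (fun x hx => by_contra fun h' => hx (gradient_eq_zero_of_notMem h'))
      (isClosed_tsupport φ)).trans h.tsupport_subset⟩

/-- The space of test fields. -/
def testFields (Ω : Set Plane) : Submodule ℝ (Plane → Plane) where
  carrier := {Φ | IsTestField Ω Φ}
  zero_mem' := ⟨continuous_const, HasCompactSupport.zero, by simp⟩
  add_mem' := fun {Φ Ψ} h k => ⟨h.continuous.add k.continuous,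
    h.hasCompactSupport.add k.hasCompactSupport,
    (tsupport_add Φ Ψ).trans (Set.union_subset h.tsupport_subset k.tsupport_subset)⟩
  smul_mem' := fun c Φ h => ⟨h.continuous.const_smul c,
    h.hasCompactSupport.mono (f' := c • Φ) fun x hx h' => hx (by simp [h']),
    (closure_mono (s := Function.support (c • Φ)) (t := Function.support Φ)
      fun x hx h' => hx (by simp [h'])).trans h.tsupport_subset⟩

/-- Test fields as square-integrable fields. -/
def testFieldsToL2 (Ω : Set Plane) : testFields Ω →ₗ[ℝ] L2V Ω where
  toFun Φ := (IsTestField.memLp Φ.2).toLp Φ.1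
  map_add' _ _ := rfl
  map_smul' _ _ := rfl

/-- An L² field orthogonal to the range has components that annihilate all smooth compactly
supported functions, hence vanishes. -/
theorem denseRange_testFieldsToL2 {Ω : Set Plane} (hΩ : IsOpen Ω) :
    DenseRange (testFieldsToL2 Ω) := by
  have key : (LinearMap.range (testFieldsToL2 Ω)).topologicalClosure = ⊤ := by
    rw [Submodule.topologicalClosure_eq_top_iff, Submodule.eq_bot_iff]
    intro h hh
    rw [Submodule.mem_orthogonal] at hh
    have hcomp : ∀ i : Fin 2, ∀ᵐ x ∂(volume.restrict Ω), h x i = 0 := by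
      intro i
      rw [ae_restrict_iff' hΩ.measurableSet]
      have hL : MemLp (fun x => h x i) 2 (volume.restrict Ω) :=
        ContinuousLinearMap.comp_memLp' (EuclideanSpace.proj (𝕜 := ℝ) i) (Lp.memLp h)
      have hloc : LocallyIntegrableOn (fun x => h x i) Ω volume :=
        locallyIntegrableOn_of_locallyIntegrable_restrict (hL.locallyIntegrable one_le_two)
      refine hΩ.ae_eq_zero_of_integral_contDiff_smul_eq_zero hloc fun g hg hgc hgs => ?_
      have hT : IsTestField Ω fun x => g x • unitVec i :=
        isTestField_smul hg.continuous hgc hgs continuous_const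
      have h0 := hh (testFieldsToL2 Ω ⟨_, hT⟩) ⟨_, rfl⟩
      have h1 : ∫ x in Ω, inner ℝ (g x • unitVec i) (h x) = 0 := by
        rw [← inner_toLp_left hT.memLp]; exact h0
      rw [← h1, ← setIntegral_eq_integral_of_forall_compl_eq_zero (s := Ω)
        (f := fun x => g x • h x i)]
      · refine integral_congr_ae (Eventually.of_forall fun x => ?_)
        simp only [real_inner_smul_left, smul_eq_mul, inner_plane]
        fin_cases i <;> simp [unitVec]
      · intro x hx
        rw [image_eq_zero_of_notMem_tsupport fun h' => hx (hgs h'), zero_smul]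
    refine Lp.ext ?_
    filter_upwards [hcomp 0, hcomp 1, Lp.coeFn_zero Plane 2 (volume.restrict Ω)] with x h0 h1 h2
    rw [h2]
    ext i; fin_cases i
    · simpa using h0
    · simpa using h1
  have h := Submodule.dense_iff_topologicalClosure_eq_top.2 key
  rwa [LinearMap.coe_range] at h

theorem inner_testFieldsToL2 {Ω : Set Plane} (Φ : testFields Ω) (g : L2V Ω) :
    inner ℝ (testFieldsToL2 Ω Φ) g = ∫ x in Ω, inner ℝ (Φ.1 x) (g x) :=
  inner_toLp_left (IsTestField.memLp Φ.2) g

/-! ### Limits along ultrafilters -/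

theorem exists_tendsto_of_bounded (U : Ultrafilter ℕ) {x : ℕ → ℝ} {B : ℝ}
    (h : ∀ᶠ n in (U : Filter ℕ), |x n| ≤ B) : ∃ L, Tendsto x U (𝓝 L) := by
  obtain ⟨L, -, hL⟩ := (isCompact_Icc (a := -B) (b := B)).ultrafilter_le_nhds (U.map x) (by
    rw [le_principal_iff, Ultrafilter.coe_map, mem_map]
    filter_upwards [h] with n hn using abs_le.1 hn)
  exact ⟨L, hL⟩

/-- Weak compactness of bounded sequences in a Hilbert space, along an ultrafilter. -/
theorem exists_weak_limit {H : Type*} [NormedAddCommGroup H] [InnerProductSpace ℝ H]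
    [CompleteSpace H] (U : Ultrafilter ℕ) {u : ℕ → H} {B : ℝ} (h : ∀ n, ‖u n‖ ≤ B) :
    ∃ u₀ : H, ∀ l : H →L[ℝ] ℝ, Tendsto (fun n => l (u n)) U (𝓝 (l u₀)) := by
  set x : ℕ → WeakDual ℝ H := fun n =>
    StrongDual.toWeakDual (InnerProductSpace.toDual ℝ H (u n)) with hx
  obtain ⟨y, -, hy⟩ := (WeakDual.isCompact_closedBall (𝕜 := ℝ) (E := H) 0 B).ultrafilter_le_nhds
    (U.map x) (by
      rw [le_principal_iff, Ultrafilter.coe_map, mem_map]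
      refine Eventually.of_forall fun n => ?_
      simpa [hx] using h n)
  refine ⟨(InnerProductSpace.toDual ℝ H).symm (WeakDual.toStrongDual y), fun l => ?_⟩
  set p := (InnerProductSpace.toDual ℝ H).symm l
  have hl : ∀ v, l v = inner ℝ v p := fun v => by
    rw [real_inner_comm, InnerProductSpace.toDual_symm_apply]
  have ht : Tendsto x U (𝓝 y) := hy
  have h1 : Tendsto (fun n => x n p) U (𝓝 (y p)) :=
    ((WeakDual.eval_continuous p).tendsto y).comp ht
  rw [hl, InnerProductSpace.toDual_symm_apply]
  refine h1.congr fun n => ?_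
  rw [hl]
  rfl

/-- Weak-* convergence along a filter of fields to a square-integrable field. -/
def FluxTendsto {Ω : Set Plane} (l : Filter ℕ) (σ : ℕ → Plane → Plane) (σ₀ : L2V Ω) : Prop :=
  ∀ Φ : Plane → Plane, IsTestField Ω Φ →
    Tendsto (fun n => ∫ x in Ω, inner ℝ (Φ x) (σ n x)) l (𝓝 (∫ x in Ω, inner ℝ (Φ x) (σ₀ x)))

section Flux

variable {Ω : Set Plane} {c : ℕ → Plane → ℝ} {A : ℝ}

/-- Cauchy–Schwarz with √c attached to the test field and 1/√c to σ. A bound on the weighted energy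
thus acts as a bound of measures, without any uniform L² bound on σ. -/
theorem IsWeight.sq_integral_inner_le (hc : IsWeight Ω c A) {Φ : Plane → Plane}
    (hΦ : IsTestField Ω Φ) {σ : Plane → Plane} (hσ : MemLp σ 2 (volume.restrict Ω)) (n : ℕ) :
    (∫ x in Ω, inner ℝ (Φ x) (σ x)) ^ 2 ≤
      (∫ x in Ω, c n x * ‖Φ x‖ ^ 2) * ∫ x in Ω, ‖σ x‖ ^ 2 / c n x := by
  have hsq : Measurable fun x => √(c n x) := (hc.measurable n).sqrt
  obtain ⟨B, hB⟩ := hc.bdd n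
  have h1 : MemLp (fun x => √(c n x) * ‖Φ x‖) 2 (volume.restrict Ω) := by
    refine (hΦ.memLp.norm.const_mul (√B)).mono
      (hsq.aestronglyMeasurable.mul hΦ.continuous.norm.aestronglyMeasurable)
      (Eventually.of_forall fun x => ?_)
    simp only [norm_mul, norm_norm, Real.norm_of_nonneg (Real.sqrt_nonneg _)]
    gcongr
    exact hB x
  have h2 : MemLp (fun x => ‖σ x‖ / √(c n x)) 2 (volume.restrict Ω) := by
    refine hσ.norm.mono (hσ.1.norm.div₀ hsq.aestronglyMeasurable) (Eventually.of_forall fun x => ?_)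
    have : 1 ≤ √(c n x) := Real.one_le_sqrt.2 (hc.one_le n x)
    simp only [norm_div, norm_norm]
    rw [Real.norm_of_nonneg (by positivity : 0 ≤ √(c n x))]
    exact div_le_self (norm_nonneg _) this
  have h3 := abs_integral_mul_le h1 h2
  have e1 : ∀ x, √(c n x) * ‖Φ x‖ * (‖σ x‖ / √(c n x)) = ‖Φ x‖ * ‖σ x‖ := fun x => by
    have : 0 < √(c n x) := Real.sqrt_pos.2 (hc.pos n x)
    field_simp
  have e2 : ∀ x, √(c n x) ^ 2 = c n x := fun x => Real.sq_sqrt (hc.pos n x).le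
  simp only [e1, e2, div_pow, mul_pow] at h3
  have hA : 0 ≤ ∫ x in Ω, c n x * ‖Φ x‖ ^ 2 :=
    integral_nonneg fun x => mul_nonneg (hc.pos n x).le (by positivity)
  have hB : 0 ≤ ∫ x in Ω, ‖σ x‖ ^ 2 / c n x :=
    integral_nonneg fun x => div_nonneg (by positivity) (hc.pos n x).le
  have h4 : |∫ x in Ω, inner ℝ (Φ x) (σ x)| ≤ |∫ x in Ω, ‖Φ x‖ * ‖σ x‖| := by
    refine le_trans ?_ (le_abs_self _)
    refine abs_integral_le_integral_abs.trans (integral_mono (integrable_inner hΦ.memLp hσ).abs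
      (integrable_norm_mul_norm hΦ.memLp hσ) fun x => abs_real_inner_le_norm _ _)
  rw [← sq_abs]
  calc _ ≤ _ := pow_le_pow_left₀ (abs_nonneg _) (h4.trans h3) 2
    _ = _ := by rw [mul_pow, Real.sq_sqrt hA, Real.sq_sqrt hB]

theorem IsTestField.norm_sq {Φ : Plane → Plane} (hΦ : IsTestField Ω Φ) :
    Continuous (fun x => ‖Φ x‖ ^ 2) ∧ HasCompactSupport (fun x => ‖Φ x‖ ^ 2) ∧
      tsupport (fun x => ‖Φ x‖ ^ 2) ⊆ Ω := by
  have hs : Function.support (fun x => ‖Φ x‖ ^ 2) ⊆ Function.support Φ :=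
    fun x hx h => hx (by simp [h])
  exact ⟨hΦ.continuous.norm.pow 2, hΦ.hasCompactSupport.mono hs,
    (closure_mono hs).trans hΦ.tsupport_subset⟩

/-- Asymptotic bound for the pairing of a test field with fields of bounded weighted energy. -/
theorem IsWeight.sq_limit_le (hc : IsWeight Ω c A) {l : Filter ℕ} [l.NeBot] (hl : l ≤ atTop)
    {Φ : Plane → Plane} (hΦ : IsTestField Ω Φ) {σ : ℕ → Plane → Plane}
    (hσ : ∀ n, MemLp (σ n) 2 (volume.restrict Ω)) {e : ℕ → ℝ} {E : ℝ}
    (he : ∀ n, ∫ x in Ω, ‖σ n x‖ ^ 2 / c n x ≤ e n) (heE : Tendsto e l (𝓝 E)) {L : ℝ}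
    (hL : Tendsto (fun n => ∫ x in Ω, inner ℝ (Φ x) (σ n x)) l (𝓝 L)) :
    L ^ 2 ≤ A * (∫ x in Ω, ‖Φ x‖ ^ 2) * E := by
  obtain ⟨k1, k2, k3⟩ := hΦ.norm_sq
  have he0 : ∀ n, 0 ≤ e n := fun n => (integral_nonneg fun x =>
    div_nonneg (by positivity) (hc.pos n x).le).trans (he n)
  set P := A * ∫ x in Ω, ‖Φ x‖ ^ 2 with hP
  have key : ∀ ε > 0, L ^ 2 ≤ (P + ε) * E := by
    intro ε hε
    refine le_of_tendsto_of_tendsto (hL.pow 2) (heE.const_mul (P + ε)) ?_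
    filter_upwards [hl (hc.limsup _ k1 k2 k3 (fun x => by positivity) ε hε)] with n hn
    refine (hc.sq_integral_inner_le hΦ (hσ n) n).trans ?_
    have h0 : 0 ≤ ∫ x in Ω, c n x * ‖Φ x‖ ^ 2 :=
      integral_nonneg fun x => mul_nonneg (hc.pos n x).le (by positivity)
    exact mul_le_mul hn (he n) (integral_nonneg fun x =>
      div_nonneg (by positivity) (hc.pos n x).le) (h0.trans hn)
  have ht : Tendsto (fun ε : ℝ => (P + ε) * E) (𝓝[>] 0) (𝓝 ((P + 0) * E)) :=
    (((continuous_const.add continuous_id).mul continuous_const).tendsto 0).mono_left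
      nhdsWithin_le_nhds
  rw [add_zero] at ht
  refine ge_of_tendsto ht ?_
  filter_upwards [self_mem_nhdsWithin] with ε hε using key ε hε

theorem IsWeight.eventually_integral_inner_le (hc : IsWeight Ω c A)
    {Φ : Plane → Plane} (hΦ : IsTestField Ω Φ) {σ : ℕ → Plane → Plane}
    (hσ : ∀ n, MemLp (σ n) 2 (volume.restrict Ω)) {E : ℝ}
    (he : ∀ n, ∫ x in Ω, ‖σ n x‖ ^ 2 / c n x ≤ E) :
    ∃ B, ∀ᶠ n in atTop, |∫ x in Ω, inner ℝ (Φ x) (σ n x)| ≤ B := by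
  obtain ⟨k1, k2, k3⟩ := hΦ.norm_sq
  refine ⟨√((A * (∫ x in Ω, ‖Φ x‖ ^ 2) + 1) * E), ?_⟩
  filter_upwards [hc.limsup _ k1 k2 k3 (fun x => by positivity) 1 zero_lt_one] with n hn
  refine Real.abs_le_sqrt ((hc.sq_integral_inner_le hΦ (hσ n) n).trans ?_)
  have h0 : 0 ≤ ∫ x in Ω, c n x * ‖Φ x‖ ^ 2 :=
    integral_nonneg fun x => mul_nonneg (hc.pos n x).le (by positivity)
  exact mul_le_mul hn (he n) (integral_nonneg fun x =>
    div_nonneg (by positivity) (hc.pos n x).le) (h0.trans hn)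

theorem norm_sq_testFieldsToL2 (Φ : testFields Ω) :
    ‖testFieldsToL2 Ω Φ‖ ^ 2 = ∫ x in Ω, ‖Φ.1 x‖ ^ 2 := by
  rw [L2V_norm_sq_eq]
  refine integral_congr_ae ?_
  filter_upwards [(IsTestField.memLp Φ.2).coeFn_toLp] with x hx
  have hx' : (testFieldsToL2 Ω Φ : Plane → Plane) x = Φ.1 x := hx
  rw [hx']

/-- Weak-* compactness of fields with bounded weighted energy, with square-integrable limit. -/
theorem IsWeight.exists_fluxTendsto (hc : IsWeight Ω c A) (hΩ : IsOpen Ω) (U : Ultrafilter ℕ)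
    (hU : (U : Filter ℕ) ≤ atTop) {σ : ℕ → Plane → Plane}
    (hσ : ∀ n, MemLp (σ n) 2 (volume.restrict Ω)) {E : ℝ}
    (hE : ∀ n, ∫ x in Ω, ‖σ n x‖ ^ 2 / c n x ≤ E) :
    ∃ σ₀ : L2V Ω, FluxTendsto U σ σ₀ := by
  have hex : ∀ Φ : testFields Ω, ∃ L, Tendsto (fun n => ∫ x in Ω, inner ℝ (Φ.1 x) (σ n x)) U (𝓝 L) := by
    intro Φ
    obtain ⟨B, hB⟩ := hc.eventually_integral_inner_le Φ.2 hσ hE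
    exact exists_tendsto_of_bounded U (hU hB)
  choose L hL using hex
  -- The limit functional is linear, and `IsWeight.sq_limit_le` bounds it by √(AE) times the L² norm
  -- of the test field. It therefore extends to L², where the Riesz representation yields the limit
  -- flux: no singular part survives.
  let F : testFields Ω →ₗ[ℝ] ℝ :=
    { toFun := L
      map_add' := by
        intro Φ Ψ
        refine tendsto_nhds_unique (hL (Φ + Ψ)) (((hL Φ).add (hL Ψ)).congr fun n => ?_)
        rw [← integral_add (integrable_inner (IsTestField.memLp Φ.2) (hσ n))
          (integrable_inner (IsTestField.memLp Ψ.2) (hσ n))]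
        refine integral_congr_ae (Eventually.of_forall fun x => ?_)
        simp [inner_add_left]
      map_smul' := by
        intro r Φ
        refine tendsto_nhds_unique (hL (r • Φ)) (((hL Φ).const_mul r).congr fun n => ?_)
        rw [← integral_const_mul]
        refine integral_congr_ae (Eventually.of_forall fun x => ?_)
        simp [real_inner_smul_left] }
  have hE0 : 0 ≤ E := (integral_nonneg fun x =>
    div_nonneg (by positivity) (hc.pos 0 x).le).trans (hE 0)
  have hF : ∀ Φ, ‖F Φ‖ ≤ √(A * E) * ‖testFieldsToL2 Ω Φ‖ := by
    intro Φ
    have := hc.sq_limit_le hU Φ.2 hσ hE tendsto_const_nhds (hL Φ)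
    rw [← norm_sq_testFieldsToL2] at this
    rw [← sq_le_sq₀ (norm_nonneg _) (by positivity), mul_pow,
      Real.sq_sqrt (mul_nonneg hc.nonneg hE0), Real.norm_eq_abs, sq_abs]
    change L Φ ^ 2 ≤ _
    linarith
  have hd := denseRange_testFieldsToL2 hΩ
  set G := F.extendOfNorm (testFieldsToL2 Ω)
  refine ⟨(InnerProductSpace.toDual ℝ (L2V Ω)).symm G, fun Φ hΦ => ?_⟩
  have h1 : F ⟨Φ, hΦ⟩ = ∫ x in Ω, inner ℝ (Φ x)
      (((InnerProductSpace.toDual ℝ (L2V Ω)).symm G : L2V Ω) x) := by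
    rw [← LinearMap.extendOfNorm_eq hd ⟨_, hF⟩ ⟨Φ, hΦ⟩,
      ← inner_testFieldsToL2 ⟨Φ, hΦ⟩, real_inner_comm, InnerProductSpace.toDual_symm_apply]
  rw [← h1]
  exact hL ⟨Φ, hΦ⟩

/-- The limit of fields of bounded weighted energy is controlled by the energy. -/
theorem IsWeight.norm_sq_le_of_fluxTendsto (hc : IsWeight Ω c A) (hΩ : IsOpen Ω) {l : Filter ℕ}
    [l.NeBot] (hl : l ≤ atTop) {σ : ℕ → Plane → Plane}
    (hσ : ∀ n, MemLp (σ n) 2 (volume.restrict Ω)) {e : ℕ → ℝ} {E : ℝ}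
    (he : ∀ n, ∫ x in Ω, ‖σ n x‖ ^ 2 / c n x ≤ e n) (heE : Tendsto e l (𝓝 E)) {σ₀ : L2V Ω}
    (h : FluxTendsto l σ σ₀) : ‖σ₀‖ ^ 2 ≤ A * E := by
  have key : ∀ g : L2V Ω, (inner ℝ g σ₀) ^ 2 ≤ A * E * ‖g‖ ^ 2 := by
    intro g
    refine (denseRange_testFieldsToL2 hΩ).induction_on
      (p := fun g => (inner ℝ g σ₀) ^ 2 ≤ A * E * ‖g‖ ^ 2) g
      (isClosed_le ((continuous_id.inner continuous_const).pow 2)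
        (continuous_const.mul (continuous_norm.pow 2))) fun Φ => ?_
    rw [inner_testFieldsToL2, norm_sq_testFieldsToL2]
    have := hc.sq_limit_le hl Φ.2 hσ he heE (h Φ.1 Φ.2)
    linarith
  have h1 := key σ₀
  rw [real_inner_self_eq_norm_sq] at h1
  by_cases h0 : ‖σ₀‖ ^ 2 = 0
  · rw [h0]
    have hE0 : 0 ≤ E := ge_of_tendsto heE (Eventually.of_forall fun n =>
      (integral_nonneg fun x => div_nonneg (by positivity) (hc.pos n x).le).trans (he n))
    exact mul_nonneg hc.nonneg hE0
  · have hpos : 0 < ‖σ₀‖ ^ 2 := lt_of_le_of_ne (by positivity) (Ne.symm h0)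
    nlinarith

end Flux

end HighContrast
end

open Filter Topology MeasureTheory

noncomputable section

namespace HighContrast

/-! ### Matrix classes and the Dirichlet problem -/

theorem act_smul (A : Mat2) (t : ℝ) (ξ : Plane) : act A (t • ξ) = t • act A ξ := map_smul _ _ _

theorem act_add (A : Mat2) (ξ ζ : Plane) : act A (ξ + ζ) = act A ξ + act A ζ := map_add _ _ _

theorem act_sub (A : Mat2) (ξ ζ : Plane) : act A (ξ - ζ) = act A ξ - act A ζ := map_sub _ _ _

theorem act_add_mat (A B : Mat2) (ξ : Plane) : act (A + B) ξ = act A ξ + act B ξ := by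
  simp [act]

theorem act_sub_mat (A B : Mat2) (ξ : Plane) : act (A - B) ξ = act A ξ - act B ξ := by
  simp [act]

theorem act_smul_mat (t : ℝ) (A : Mat2) (ξ : Plane) : act (t • A) ξ = t • act A ξ := by
  simp [act]

theorem act_one (ξ : Plane) : act 1 ξ = ξ := by simp [act]

theorem act_mul (A B : Mat2) (ξ : Plane) : act (A * B) ξ = act A (act B ξ) := by
  simp [act]

theorem continuous_act (A : Mat2) : Continuous (act A) := ContinuousLinearMap.continuous _

theorem inner_act_J_self (ξ : Plane) : inner ℝ (act J ξ) ξ = 0 := by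
  rw [inner_plane, act_J_zero, act_J_one]; ring

theorem inner_act_J_act_J (ξ ζ : Plane) : inner ℝ (act J ξ) (act J ζ) = inner ℝ ξ ζ := by
  simp only [inner_plane, act_J_zero, act_J_one]; ring

theorem inner_act_J_left (ξ ζ : Plane) : inner ℝ (act J ξ) ζ = - inner ℝ ξ (act J ζ) := by
  simp only [inner_plane, act_J_zero, act_J_one]; ring

theorem isUnit_of_coercive {A : Mat2} {α : ℝ} (hα : 0 < α)
    (h : ∀ ξ : Plane, α * ‖ξ‖ ^ 2 ≤ inner ℝ (act A ξ) ξ) : IsUnit A := by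
  rw [← Matrix.mulVec_injective_iff_isUnit]
  intro v w hvw
  have h0 : act A (WithLp.toLp 2 (v - w)) = 0 := by
    simp [act, hvw]
  have h1 := h (WithLp.toLp 2 (v - w))
  rw [h0, inner_zero_left] at h1
  have h2 : ‖(WithLp.toLp 2 (v - w) : Plane)‖ = 0 := by
    have := norm_nonneg (WithLp.toLp 2 (v - w) : Plane)
    by_contra h3
    have : 0 < ‖(WithLp.toLp 2 (v - w) : Plane)‖ := lt_of_le_of_ne this (Ne.symm h3)
    have : 0 < α * ‖(WithLp.toLp 2 (v - w) : Plane)‖ ^ 2 := by positivity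
    linarith
  exact WithLp.toLp_injective 2 (sub_eq_zero.1 (by simpa using h2))

/-- The bound on the inverse need only be checked at image vectors `act (A x) ξ`, which exhaust the
plane because coercivity makes the matrix invertible. -/
theorem matClass_of {Ω : Set Plane} {A : Plane → Mat2} {α β : ℝ} (hα : 0 < α)
    (hm : ∀ i j, AEMeasurable (fun x => A x i j) (volume.restrict Ω))
    (hl : ∀ᵐ x ∂(volume.restrict Ω), ∀ ξ : Plane, α * ‖ξ‖ ^ 2 ≤ inner ℝ (act (A x) ξ) ξ)
    (hu : ∀ᵐ x ∂(volume.restrict Ω), ∀ ξ : Plane,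
      β⁻¹ * ‖act (A x) ξ‖ ^ 2 ≤ inner ℝ (act (A x) ξ) ξ) : MatClass α β Ω A := by
  refine ⟨hm, hl.mono fun x hx => isUnit_of_coercive hα hx, hl, ?_⟩
  filter_upwards [hl, hu] with x h1 h2 ξ
  have hU := isUnit_of_coercive hα h1
  have h3 : act (A x) (act (A x)⁻¹ ξ) = ξ := by
    rw [← act_mul, Matrix.mul_nonsing_inv _ ((Matrix.isUnit_iff_isUnit_det _).1 hU), act_one]
  have h4 := h2 (act (A x)⁻¹ ξ)
  rwa [h3, real_inner_comm] at h4

/-- The constant comes from |Aξ|² ≤ Λ²|ξ|² ≤ (Λ²/α) Aξ·ξ. -/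
theorem matClass_of_bound {Ω : Set Plane} {A : Plane → Mat2} {α Λ : ℝ} (hα : 0 < α) (hΛ : 0 < Λ)
    (hm : ∀ i j, AEMeasurable (fun x => A x i j) (volume.restrict Ω))
    (hl : ∀ᵐ x ∂(volume.restrict Ω), ∀ ξ : Plane, α * ‖ξ‖ ^ 2 ≤ inner ℝ (act (A x) ξ) ξ)
    (hu : ∀ᵐ x ∂(volume.restrict Ω), ∀ ξ : Plane, ‖act (A x) ξ‖ ≤ Λ * ‖ξ‖) :
    MatClass α (Λ ^ 2 / α) Ω A := by
  refine matClass_of hα hm hl ?_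
  filter_upwards [hl, hu] with x h1 h2 ξ
  refine le_trans ?_ (h1 ξ)
  have h3 : ‖act (A x) ξ‖ ^ 2 ≤ Λ ^ 2 * ‖ξ‖ ^ 2 := by
    rw [← mul_pow]; exact pow_le_pow_left₀ (norm_nonneg _) (h2 ξ) 2
  calc (Λ ^ 2 / α)⁻¹ * ‖act (A x) ξ‖ ^ 2 ≤ (Λ ^ 2 / α)⁻¹ * (Λ ^ 2 * ‖ξ‖ ^ 2) := by gcongr
    _ = α * ‖ξ‖ ^ 2 := by field_simp

theorem MatClass.exists_le {Ω : Set Plane} {A : Plane → Mat2} {α β : ℝ} (hα : 0 < α) (hβ : 0 < β)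
    (h : MatClass α β Ω A) : ∃ α β : ℝ, 0 < α ∧ α ≤ β ∧ MatClass α β Ω A :=
  ⟨α, max α β, hα, le_max_left _ _, h.measurable, h.invertible, h.lower, h.upper.mono
    fun _ hx ξ => (mul_le_mul_of_nonneg_right (inv_anti₀ hβ (le_max_right _ _))
      (by positivity)).trans (hx ξ)⟩

theorem MatClass.mono_upper {Ω : Set Plane} {A : Plane → Mat2} {α β β' : ℝ} (hβ : 0 < β)
    (h : MatClass α β Ω A) (hle : β ≤ β') : MatClass α β' Ω A :=
  ⟨h.measurable, h.invertible, h.lower, h.upper.mono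
    fun _ hx ξ => (mul_le_mul_of_nonneg_right (inv_anti₀ hβ hle)
      (by positivity)).trans (hx ξ)⟩

/-- The bound on the inverse at Aξ reads β⁻¹|Aξ|² ≤ ξ·Aξ ≤ |ξ||Aξ|. -/
theorem MatClass.norm_act_le {Ω : Set Plane} {A : Plane → Mat2} {α β : ℝ} (hβ : 0 < β)
    (h : MatClass α β Ω A) : ∀ᵐ x ∂(volume.restrict Ω), ∀ ξ : Plane, ‖act (A x) ξ‖ ≤ β * ‖ξ‖ := by
  filter_upwards [h.invertible, h.upper] with x hU h1 ξ
  have h2 := h1 (act (A x) ξ)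
  rw [← act_mul, Matrix.nonsing_inv_mul _ ((Matrix.isUnit_iff_isUnit_det _).1 hU), act_one] at h2
  have h3 := real_inner_le_norm ξ (act (A x) ξ)
  by_cases h0 : ‖act (A x) ξ‖ = 0
  · rw [h0]; positivity
  have hp : 0 < ‖act (A x) ξ‖ := lt_of_le_of_ne (norm_nonneg _) (Ne.symm h0)
  have h4 : β⁻¹ * ‖act (A x) ξ‖ * ‖act (A x) ξ‖ ≤ ‖ξ‖ * ‖act (A x) ξ‖ := by
    calc _ = β⁻¹ * ‖act (A x) ξ‖ ^ 2 := by ring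
      _ ≤ _ := h2.trans h3
  have h5 := le_of_mul_le_mul_right h4 hp
  rwa [inv_mul_le_iff₀ hβ] at h5

theorem aestronglyMeasurable_act {μ : Measure Plane} {A : Plane → Mat2}
    (hA : ∀ i j, AEMeasurable (fun x => A x i j) μ) {η : Plane → Plane}
    (hη : AEStronglyMeasurable η μ) : AEStronglyMeasurable (fun x => act (A x) (η x)) μ := by
  refine AEMeasurable.aestronglyMeasurable ?_
  have hi : ∀ i, AEMeasurable (fun x => η x i) μ := fun i =>
    ((EuclideanSpace.proj (𝕜 := ℝ) i).continuous.measurable).comp_aemeasurable hη.aemeasurable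
  have h : AEMeasurable (fun x => (fun i => A x i 0 * η x 0 + A x i 1 * η x 1 : Fin 2 → ℝ)) μ :=
    aemeasurable_pi_lambda _ fun i => ((hA i 0).mul (hi 0)).add ((hA i 1).mul (hi 1))
  refine ((PiLp.continuous_toLp 2 (fun _ : Fin 2 => ℝ)).measurable.comp_aemeasurable h).congr
    (Eventually.of_forall fun x => ?_)
  ext i
  simp [act_apply]

theorem MatClass.memLp_act {Ω : Set Plane} {A : Plane → Mat2} {α β : ℝ} (hβ : 0 < β)
    (h : MatClass α β Ω A) {η : Plane → Plane} (hη : MemLp η 2 (volume.restrict Ω)) :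
    MemLp (fun x => act (A x) (η x)) 2 (volume.restrict Ω) :=
  hη.of_le_mul (aestronglyMeasurable_act h.measurable hη.1)
    ((h.norm_act_le hβ).mono fun x hx => hx (η x))

/-- Multiplication by a bounded matrix field, as an operator on square-integrable fields. -/
theorem MatClass.exists_operator {Ω : Set Plane} {A : Plane → Mat2} {α β : ℝ} (hβ : 0 < β)
    (h : MatClass α β Ω A) :
    ∃ T : L2V Ω →L[ℝ] L2V Ω, ∀ η : L2V Ω,
      T η =ᵐ[volume.restrict Ω] fun x => act (A x) (η x) := by
  have hm : ∀ η : L2V Ω, MemLp (fun x => act (A x) (η x)) 2 (volume.restrict Ω) :=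
    fun η => h.memLp_act hβ (Lp.memLp η)
  let T₀ : L2V Ω →ₗ[ℝ] L2V Ω :=
    { toFun := fun η => (hm η).toLp _
      map_add' := fun η ζ => by
        refine Lp.ext ?_
        filter_upwards [(hm (η + ζ)).coeFn_toLp, (hm η).coeFn_toLp, (hm ζ).coeFn_toLp,
          Lp.coeFn_add η ζ, Lp.coeFn_add ((hm η).toLp _) ((hm ζ).toLp _)] with x h1 h2 h3 h4 h5
        rw [h1, h5, h4, Pi.add_apply, Pi.add_apply, h2, h3, act_add]
      map_smul' := fun t η => by
        refine Lp.ext ?_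
        filter_upwards [(hm (t • η)).coeFn_toLp, (hm η).coeFn_toLp,
          Lp.coeFn_smul t η, Lp.coeFn_smul t ((hm η).toLp _)] with x h1 h2 h3 h4
        simp only [RingHom.id_apply]
        rw [h1, h4, h3, Pi.smul_apply, Pi.smul_apply, h2, act_smul] }
  refine ⟨T₀.mkContinuous β fun η => ?_, fun η => (hm η).coeFn_toLp⟩
  refine Lp.norm_le_mul_norm_of_ae_le_mul ?_
  filter_upwards [(hm η).coeFn_toLp, h.norm_act_le hβ] with x h1 h2
  have h1' : (T₀ η : Plane → Plane) x = act (A x) (η x) := h1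
  rw [h1']
  exact h2 _

/-- The Lax–Milgram theorem, stated for an operator instead of a bilinear form. -/
theorem bijective_of_coercive {H : Type*} [NormedAddCommGroup H] [InnerProductSpace ℝ H]
    [CompleteSpace H] (K : H →L[ℝ] H) {C : ℝ} (hC : 0 < C)
    (h : ∀ u, C * ‖u‖ ^ 2 ≤ inner ℝ (K u) u) : Function.Bijective K := by
  have hB : IsCoercive ((innerSL ℝ).comp K : H →L[ℝ] H →L[ℝ] ℝ) :=
    ⟨C, hC, fun u => by
      have := h u
      simpa [pow_two, mul_assoc] using this⟩
  have e : ∀ u, hB.continuousLinearEquivOfBilin u = K u := fun u =>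
    ext_inner_right ℝ fun w => by
      rw [hB.continuousLinearEquivOfBilin_apply]; rfl
  have : (K : H → H) = hB.continuousLinearEquivOfBilin := funext fun u => (e u).symm
  rw [this]
  exact hB.continuousLinearEquivOfBilin.bijective

theorem exists_operator_inner {H E : Type*} [NormedAddCommGroup H] [InnerProductSpace ℝ H]
    [CompleteSpace H] [NormedAddCommGroup E] [InnerProductSpace ℝ E] [CompleteSpace E]
    (G : H →L[ℝ] E) (T : E →L[ℝ] E) :
    ∃ K : H →L[ℝ] H, ∀ u v, inner ℝ (K u) v = inner ℝ (T (G u)) (G v) :=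
  ⟨(ContinuousLinearMap.adjoint G).comp (T.comp G), fun u v => by
    simp only [ContinuousLinearMap.comp_apply, ContinuousLinearMap.adjoint_inner_left]⟩

theorem exists_inner_eq {H : Type*} [NormedAddCommGroup H] [InnerProductSpace ℝ H]
    [CompleteSpace H] (f : H →L[ℝ] ℝ) : ∃ w : H, ∀ v, inner ℝ w v = f v :=
  ⟨(InnerProductSpace.toDual ℝ H).symm f, fun _ => InnerProductSpace.toDual_symm_apply⟩

section Dirichlet

variable {Ω : Set Plane} {A : Plane → Mat2} {α β : ℝ}

theorem isSol_iff {T : L2V Ω →L[ℝ] L2V Ω}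
    (hT : ∀ η : L2V Ω, T η =ᵐ[volume.restrict Ω] fun x => act (A x) (η x)) {f : Hneg1 Ω}
    {u : H10 Ω} : IsSol A f u ↔ ∀ v, inner ℝ (T (gradL Ω u)) (gradL Ω v) = - f v := by
  unfold IsSol
  refine forall_congr' fun v => ?_
  rw [L2V_inner_eq]
  have : ∫ x in Ω, inner ℝ (act (A x) (grad u x)) (grad v x) =
      ∫ x in Ω, inner ℝ (T (gradL Ω u) x) (gradL Ω v x) := by
    refine integral_congr_ae ?_
    filter_upwards [hT (gradL Ω u)] with x hx
    rw [hx]; rfl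
  rw [this]

theorem MatClass.le_inner_operator (h : MatClass α β Ω A) {T : L2V Ω →L[ℝ] L2V Ω}
    (hT : ∀ η : L2V Ω, T η =ᵐ[volume.restrict Ω] fun x => act (A x) (η x)) (η : L2V Ω) :
    α * ‖η‖ ^ 2 ≤ inner ℝ (T η) η := by
  rw [L2V_norm_sq_eq, L2V_inner_eq, ← integral_const_mul]
  refine integral_mono_ae ((Lp.memLp η).norm.integrable_sq.const_mul α)
    (integrable_inner (Lp.memLp _) (Lp.memLp _)) ?_
  filter_upwards [hT η, h.lower] with x h1 h2
  rw [h1]; exact h2 _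

theorem MatClass.exists_sol (h : MatClass α β Ω A) (hΩb : Bornology.IsBounded Ω) (hα : 0 < α)
    (hβ : 0 < β) (f : Hneg1 Ω) : ∃ u : H10 Ω, ∀ v, IsSol A f v ↔ v = u := by
  obtain ⟨T, hT⟩ := h.exists_operator hβ
  obtain ⟨C, hC, hP⟩ := exists_poincare hΩb
  obtain ⟨K, hKi⟩ := exists_operator_inner (gradL Ω) T
  have hbij : Function.Bijective K := by
    refine bijective_of_coercive K (C := α / C ^ 2) (by positivity) fun u => ?_
    rw [hKi]
    refine le_trans ?_ (h.le_inner_operator hT _)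
    have : ‖u‖ ^ 2 ≤ C ^ 2 * ‖gradL Ω u‖ ^ 2 := by
      rw [← mul_pow]; exact pow_le_pow_left₀ (norm_nonneg _) (hP u) 2
    calc α / C ^ 2 * ‖u‖ ^ 2 ≤ α / C ^ 2 * (C ^ 2 * ‖gradL Ω u‖ ^ 2) := by gcongr
      _ = _ := by field_simp
  obtain ⟨w₀, hf⟩ := exists_inner_eq (-f)
  obtain ⟨u, hu⟩ := hbij.2 w₀
  refine ⟨u, fun v => ?_⟩
  rw [isSol_iff hT]
  constructor
  · intro hv
    refine hbij.1 (ext_inner_right ℝ fun w => ?_)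
    rw [hKi, hv w, hu, hf]; rfl
  · rintro rfl w
    rw [← hKi, hu, hf]; rfl

end Dirichlet

end HighContrast
end

open Filter Topology MeasureTheory

noncomputable section

namespace HighContrast

/-! ### Compensated compactness -/

/-- Eventually equibounded functionals are equicontinuous, so convergence at points arbitrarily near
v forces convergence at v. -/
theorem tendsto_of_dense_of_bound {H : Type*} [NormedAddCommGroup H] [NormedSpace ℝ H]
    {l : Filter ℕ} {L : ℕ → H →L[ℝ] ℝ} {L₀ : H →L[ℝ] ℝ} {M : ℝ}
    (hM : ∀ᶠ n in l, ∀ v, |L n v| ≤ M * ‖v‖) {v : H}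
    (h : ∀ ε > 0, ∃ w, ‖v - w‖ < ε ∧ Tendsto (fun n => L n w) l (𝓝 (L₀ w))) :
    Tendsto (fun n => L n v) l (𝓝 (L₀ v)) := by
  rw [Metric.tendsto_nhds]
  intro ε hε
  set K := |M| + ‖L₀‖ + 1 with hK
  have hK0 : 0 < K := by positivity
  obtain ⟨w, hw, hwt⟩ := h (ε / (2 * K)) (by positivity)
  rw [Metric.tendsto_nhds] at hwt
  filter_upwards [hM, hwt (ε / 2) (by positivity)] with n h1 h2
  rw [Real.dist_eq] at h2 ⊢
  have h3 : |L n (v - w)| ≤ |M| * ‖v - w‖ :=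
    (h1 _).trans (mul_le_mul_of_nonneg_right (le_abs_self M) (norm_nonneg _))
  have h4 : |L₀ (v - w)| ≤ ‖L₀‖ * ‖v - w‖ := L₀.le_opNorm _
  have h5 : (|M| + ‖L₀‖) * ‖v - w‖ ≤ ε / 2 := by
    calc (|M| + ‖L₀‖) * ‖v - w‖ ≤ K * (ε / (2 * K)) := by
          gcongr
          linarith
      _ = ε / 2 := by field_simp
  have e : L n v - L₀ v = L n (v - w) + (L n w - L₀ w) - L₀ (v - w) := by
    simp only [map_sub]; ring
  rw [e]
  calc _ ≤ |L n (v - w) + (L n w - L₀ w)| + |L₀ (v - w)| := abs_sub _ _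
    _ ≤ |L n (v - w)| + |L n w - L₀ w| + |L₀ (v - w)| := by gcongr; exact abs_add_le _ _
    _ < ε := by linarith

theorem setIntegral_mul_inner {Ω : Set Plane} {φ : Plane → ℝ} (hφ : Continuous φ)
    (hφc : HasCompactSupport φ) {F : Plane → Plane} (hF : MemLp F 2 (volume.restrict Ω))
    (g : L2V Ω) :
    ∫ x in Ω, φ x * inner ℝ (F x) (g x) = inner ℝ ((memLp_continuous_mul hφ hφc hF).toLp _) g := by
  rw [inner_toLp_left]
  simp only [real_inner_smul_left]

/-- Weak convergence in `H¹₀` along a filter. -/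
def WeakTendsto {Ω : Set Plane} (l : Filter ℕ) (u : ℕ → H10 Ω) (u₀ : H10 Ω) : Prop :=
  ∀ g : Hneg1 Ω, Tendsto (fun n => g (u n)) l (𝓝 (g u₀))

theorem norm_gradL_le {Ω : Set Plane} (u : H10 Ω) : ‖gradL Ω u‖ ≤ ‖u‖ := by
  have h : ‖u‖ ^ 2 = ‖(u : L2Pair Ω).fst‖ ^ 2 + ‖gradL Ω u‖ ^ 2 :=
    WithLp.prod_norm_sq_eq_of_L2 (u : L2Pair Ω)
  exact pow_le_pow_iff_left₀ (norm_nonneg _) (norm_nonneg _) two_ne_zero |>.1 (by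
    rw [h]; exact le_add_of_nonneg_left (by positivity))

/-- The functional `v ↦ ∫ y · ∇v`. -/
def gradPair {Ω : Set Plane} (y : L2V Ω) : Hneg1 Ω := (innerSL ℝ y).comp (gradL Ω)

theorem gradPair_apply {Ω : Set Plane} (y : L2V Ω) (v : H10 Ω) :
    gradPair y v = inner ℝ y (gradL Ω v) := rfl

theorem WeakTendsto.inner_gradL {Ω : Set Plane} {l : Filter ℕ} {u : ℕ → H10 Ω} {u₀ : H10 Ω}
    (h : WeakTendsto l u u₀) (y : L2V Ω) :
    Tendsto (fun n => inner ℝ y (gradL Ω (u n))) l (𝓝 (inner ℝ y (gradL Ω u₀))) :=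
  h (gradPair y)

/-- The fluxes share one divergence without being divergence-free, so the div-curl estimates are
applied to `σ n - σ 0`. This controls the weighted energy of such a difference; for the fixed field
τ the unweighted norm suffices because c ≥ 1. -/
theorem energy_sub_le {Ω : Set Plane} {c : ℕ → Plane → ℝ} {A : ℝ} (hc : IsWeight Ω c A)
    {σ τ : Plane → Plane} (hσ : MemLp σ 2 (volume.restrict Ω)) (hτ : MemLp τ 2 (volume.restrict Ω))
    (n : ℕ) : ∫ x in Ω, ‖σ x - τ x‖ ^ 2 / c n x ≤
      2 * (∫ x in Ω, ‖σ x‖ ^ 2 / c n x) + 2 * ∫ x in Ω, ‖τ x‖ ^ 2 := by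
  rw [← integral_const_mul, ← integral_const_mul, ← integral_add
    ((hc.integrable_energy hσ n).const_mul 2) (hτ.norm.integrable_sq.const_mul 2)]
  refine integral_mono (hc.integrable_energy (hσ.sub hτ) n)
    (((hc.integrable_energy hσ n).const_mul 2).add (hτ.norm.integrable_sq.const_mul 2)) fun x => ?_
  have h1 : ‖σ x - τ x‖ ^ 2 ≤ 2 * ‖σ x‖ ^ 2 + 2 * ‖τ x‖ ^ 2 := by
    have := norm_sub_le (σ x) (τ x)
    nlinarith [norm_nonneg (σ x - τ x), norm_nonneg (σ x), norm_nonneg (τ x),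
      sq_nonneg (‖σ x‖ - ‖τ x‖)]
  have hp := hc.pos n x
  calc ‖σ x - τ x‖ ^ 2 / c n x ≤ (2 * ‖σ x‖ ^ 2 + 2 * ‖τ x‖ ^ 2) / c n x := by gcongr
    _ = 2 * (‖σ x‖ ^ 2 / c n x) + 2 * (‖τ x‖ ^ 2 / c n x) := by ring
    _ ≤ _ := by
      gcongr
      exact div_le_self (by positivity) (hc.one_le n x)

theorem divFree_sub {Ω : Set Plane} {f : Hneg1 Ω} {σ τ : Plane → Plane}
    (hσ : MemLp σ 2 (volume.restrict Ω)) (hτ : MemLp τ 2 (volume.restrict Ω))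
    (h : ∀ v, ∫ x in Ω, inner ℝ (σ x) (gradL Ω v x) = - f v)
    (h' : ∀ v, ∫ x in Ω, inner ℝ (τ x) (gradL Ω v x) = - f v) :
    DivFree Ω (fun x => σ x - τ x) := by
  intro ψ hψ hψc hψs
  have ht : IsTest Ω ψ := ⟨hψ, hψc, hψs⟩
  have e : ∀ ρ : Plane → Plane, ∫ x in Ω, inner ℝ (ρ x) (gradL Ω (testElem ht) x) =
      ∫ x in Ω, inner ℝ (gradient ψ x) (ρ x) := fun ρ => by
    refine integral_congr_ae ?_
    filter_upwards [coeFn_gradL_testElem ht] with x hx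
    rw [hx, real_inner_comm]
  have h1 := h (testElem ht)
  have h2 := h' (testElem ht)
  rw [e] at h1 h2
  simp only [inner_sub_right]
  rw [integral_sub (integrable_inner ht.memLp_gradient hσ) (integrable_inner ht.memLp_gradient hτ)]
  linarith

section

variable {Ω : Set Plane} {c : ℕ → Plane → ℝ} {A E : ℝ} {f : Hneg1 Ω} {σ : ℕ → Plane → Plane}
  {σ₀ : L2V Ω} {l : Filter ℕ} {φ : Plane → ℝ}

theorem setIntegral_mul_inner_sub_testElem (hφ : Continuous φ) (hφc : HasCompactSupport φ)
    {F G : Plane → Plane} (hF : MemLp F 2 (volume.restrict Ω)) (hG : MemLp G 2 (volume.restrict Ω))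
    {ψ : Plane → ℝ} (hψ : IsTest Ω ψ) :
    ∫ x in Ω, φ x * inner ℝ (F x - G x) (gradL Ω (testElem hψ) x) =
      (∫ x in Ω, inner ℝ (φ x • gradient ψ x) (F x)) -
        ∫ x in Ω, inner ℝ (φ x • gradient ψ x) (G x) := by
  have hm := memLp_continuous_mul hφ hφc hψ.memLp_gradient
  rw [← integral_sub (integrable_inner hm hF) (integrable_inner hm hG)]
  refine integral_congr_ae ?_
  filter_upwards [coeFn_gradL_testElem hψ] with x hx
  rw [hx, ← inner_sub_right, real_inner_smul_left, real_inner_comm]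

/-- The gradient of v need not be continuous, so weak-* convergence of the fluxes does not apply to
it directly. It does apply to gradients of test functions, and the uniform div-curl bound makes the
functionals of v equicontinuous for the H¹ norm. -/
theorem IsWeight.tendsto_flux_gradL (hc : IsWeight Ω c A) (hΩ : IsOpen Ω)
    (hσ : ∀ n, MemLp (σ n) 2 (volume.restrict Ω))
    (hdiv : ∀ n v, ∫ x in Ω, inner ℝ (σ n x) (gradL Ω v x) = - f v)
    (hE : ∀ n, ∫ x in Ω, ‖σ n x‖ ^ 2 / c n x ≤ E) (hl : l ≤ atTop) (hflux : FluxTendsto l σ σ₀)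
    (hφ : IsLocalTest Ω φ) (v : H10 Ω) :
    Tendsto (fun n => ∫ x in Ω, φ x * inner ℝ (σ n x - σ 0 x) (gradL Ω v x)) l
      (𝓝 (∫ x in Ω, φ x * inner ℝ (σ₀ x - σ 0 x) (gradL Ω v x))) := by
  have hφ' := hφ.contDiff.continuous
  have hφc := hφ.hasCompactSupport
  have hT : ∀ n, MemLp (fun x => σ n x - σ 0 x) 2 (volume.restrict Ω) :=
    fun n => (hσ n).sub (hσ 0)
  have hT₀ : MemLp (fun x => σ₀ x - σ 0 x) 2 (volume.restrict Ω) := (Lp.memLp σ₀).sub (hσ 0)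
  obtain ⟨M, hM0, hM⟩ := hc.exists_div_curl_bound (E := 2 * E + 2 * ∫ x in Ω, ‖σ 0 x‖ ^ 2) hΩ hT
    (fun n => divFree_sub (hσ n) (hσ 0) (hdiv n) (hdiv 0))
    (fun n => (energy_sub_le hc (hσ n) (hσ 0) n).trans (by linarith [hE n])) hφ
  obtain ⟨L, e⟩ : ∃ L : ℕ → Hneg1 Ω, ∀ n w,
      L n w = ∫ x in Ω, φ x * inner ℝ (σ n x - σ 0 x) (gradL Ω w x) :=
    ⟨fun n => gradPair ((memLp_continuous_mul hφ' hφc (hT n)).toLp _), fun n w =>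
      (setIntegral_mul_inner hφ' hφc (hT n) (gradL Ω w)).symm⟩
  obtain ⟨L₀, e₀⟩ : ∃ L₀ : Hneg1 Ω, ∀ w,
      L₀ w = ∫ x in Ω, φ x * inner ℝ (σ₀ x - σ 0 x) (gradL Ω w x) :=
    ⟨gradPair ((memLp_continuous_mul hφ' hφc hT₀).toLp _), fun w =>
      (setIntegral_mul_inner hφ' hφc hT₀ (gradL Ω w)).symm⟩
  simp only [← e, ← e₀]
  refine tendsto_of_dense_of_bound (M := M) ?_ fun ε hε => ?_
  · filter_upwards [hl hM] with n hn w
    rw [e]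
    refine (hn _ (Lp.memLp (gradL Ω w)) (curlFree_gradL w)).trans ?_
    rw [← L2V_norm_sq_eq, Real.sqrt_sq (norm_nonneg _)]
    exact mul_le_mul_of_nonneg_left (norm_gradL_le w) hM0
  · obtain ⟨ψ, hψ, hv⟩ := dense_testElem v hε
    refine ⟨testElem hψ, hv, ?_⟩
    have h₀ := (e₀ _).trans (setIntegral_mul_inner_sub_testElem hφ' hφc (Lp.memLp σ₀) (hσ 0) hψ)
    have h := fun n =>
      (e n _).trans (setIntegral_mul_inner_sub_testElem hφ' hφc (hσ n) (hσ 0) hψ)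
    refine Tendsto.congr (fun n => (h n).symm) ?_
    rw [h₀]
    exact (hflux _ (isTestField_smul hφ' hφc hφ.tsupport_subset
      (continuous_gradient hψ.contDiff))).sub_const _

/-- The div-curl lemma for fluxes with a fixed divergence. -/
theorem IsWeight.tendsto_div_curl (hc : IsWeight Ω c A) (hΩ : IsOpen Ω)
    (hσ : ∀ n, MemLp (σ n) 2 (volume.restrict Ω))
    (hdiv : ∀ n v, ∫ x in Ω, inner ℝ (σ n x) (gradL Ω v x) = - f v)
    (hE : ∀ n, ∫ x in Ω, ‖σ n x‖ ^ 2 / c n x ≤ E) (hl : l ≤ atTop) (hflux : FluxTendsto l σ σ₀)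
    (hφ : IsLocalTest Ω φ) {v : ℕ → H10 Ω} {v₀ : H10 Ω} {B : ℝ} (hB : ∀ n, ‖v n‖ ≤ B)
    (hv : WeakTendsto l v v₀) :
    Tendsto (fun n => ∫ x in Ω, φ x * inner ℝ (σ n x) (gradL Ω (v n) x)) l
      (𝓝 (∫ x in Ω, φ x * inner ℝ (σ₀ x) (gradL Ω v₀ x))) := by
  have hφ' := hφ.contDiff.continuous
  have hφc := hφ.hasCompactSupport
  have hT : ∀ n, MemLp (fun x => σ n x - σ 0 x) 2 (volume.restrict Ω) :=
    fun n => (hσ n).sub (hσ 0)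
  have hT₀ : MemLp (fun x => σ₀ x - σ 0 x) 2 (volume.restrict Ω) := (Lp.memLp σ₀).sub (hσ 0)
  -- The product is split as (σ_n - σ_0)·∇(v_n - v₀) + (σ_n - σ_0)·∇v₀ + σ_0·∇v_n. The first term
  -- falls under the div-curl lemma with zero limit, the second under convergence of fluxes, the
  -- third under weak convergence alone.
  have t1 : Tendsto (fun n => ∫ x in Ω, φ x * inner ℝ (σ n x - σ 0 x) (gradL Ω (v n - v₀) x)) l
      (𝓝 0) := by
    refine hc.tendsto_div_curl_zero (E := 2 * E + 2 * ∫ x in Ω, ‖σ 0 x‖ ^ 2)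
      (H := (B + ‖v₀‖) ^ 2) hΩ hT
      (fun n => divFree_sub (hσ n) (hσ 0) (hdiv n) (hdiv 0))
      (fun n => (energy_sub_le hc (hσ n) (hσ 0) n).trans (by linarith [hE n])) hφ
      (fun n => Lp.memLp _) (fun n => curlFree_gradL _) (fun n => ?_) hl fun Φ hΦ => ?_
    · rw [← L2V_norm_sq_eq]
      refine pow_le_pow_left₀ (norm_nonneg _) ((norm_gradL_le _).trans ?_) 2
      exact (norm_sub_le _ _).trans (by linarith [hB n])
    · simp only [← inner_toLp_left hΦ, map_sub, inner_sub_right]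
      simpa using (hv.inner_gradL (hΦ.toLp Φ)).sub_const (inner ℝ (hΦ.toLp Φ) (gradL Ω v₀))
  have t2 := hc.tendsto_flux_gradL hΩ hσ hdiv hE hl hflux hφ v₀
  have t3 : Tendsto (fun n => ∫ x in Ω, φ x * inner ℝ (σ 0 x) (gradL Ω (v n) x)) l
      (𝓝 (∫ x in Ω, φ x * inner ℝ (σ 0 x) (gradL Ω v₀ x))) := by
    simp only [setIntegral_mul_inner hφ' hφc (hσ 0)]
    exact hv.inner_gradL _
  have hint : ∀ {F : Plane → Plane} (_ : MemLp F 2 (volume.restrict Ω)) (g : L2V Ω),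
      Integrable (fun x => φ x * inner ℝ (F x) (g x)) (volume.restrict Ω) := fun {F} hF g => by
    refine (integrable_inner (memLp_continuous_mul hφ' hφc hF) (Lp.memLp g)).congr
      (Eventually.of_forall fun x => real_inner_smul_left _ _ _)
  convert (t1.add t2).add t3 using 2 with n
  · simp only [setIntegral_mul_inner hφ' hφc (hT n)]
    rw [← inner_add_right, map_sub, sub_add_cancel, ← setIntegral_mul_inner hφ' hφc (hT n),
      ← integral_add (hint (hT n) _) (hint (hσ 0) _)]
    refine integral_congr_ae (Eventually.of_forall fun x => ?_)
    simp only [inner_sub_left]; ring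
  · rw [zero_add, ← integral_add (hint hT₀ _) (hint (hσ 0) _)]
    refine congrArg _ (funext fun x => ?_)
    simp only [inner_sub_left]; ring

end

end HighContrast
end

open Filter Topology MeasureTheory

noncomputable section

namespace HighContrast

/-! ### Sequences of Dirichlet problems with weighted coefficients -/

/-- Coefficients that are comparable to the weights `c n`. -/
structure IsCoeff (c : ℕ → Plane → ℝ) (m M : ℝ) (a : ℕ → Plane → Mat2) : Prop where
  pos : 0 < m
  pos' : 0 < M
  measurable : ∀ n i j, Measurable fun x => a n x i j
  lower : ∀ n x ξ, m * c n x * ‖ξ‖ ^ 2 ≤ inner ℝ (act (a n x) ξ) ξ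
  upper : ∀ n x ξ, ‖act (a n x) ξ‖ ≤ M * c n x * ‖ξ‖

/-- The flux `A ∇u`. -/
def flux {Ω : Set Plane} (A : Plane → Mat2) (u : H10 Ω) : Plane → Plane :=
  fun x => act (A x) (gradL Ω u x)

section Energy

variable {Ω : Set Plane} {c : ℕ → Plane → ℝ} {A m M : ℝ} {a : ℕ → Plane → Mat2} {f : Hneg1 Ω}
  {u : H10 Ω} {n : ℕ}

theorem IsCoeff.matClass (ha : IsCoeff c m M a) (hc : IsWeight Ω c A) (n : ℕ) :
    ∃ β, 0 < β ∧ MatClass m β Ω (a n) := by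
  obtain ⟨B, hB⟩ := hc.bdd n
  have hB0 : 0 < B := (hc.pos n 0).trans_le (hB 0)
  have := ha.pos
  have := ha.pos'
  refine ⟨(M * B) ^ 2 / m, by positivity, matClass_of_bound ha.pos (by positivity)
    (fun i j => (ha.measurable n i j).aemeasurable) (Eventually.of_forall fun x ξ => ?_)
    (Eventually.of_forall fun x ξ => ?_)⟩
  · refine le_trans ?_ (ha.lower n x ξ)
    gcongr
    exact le_mul_of_one_le_right ha.pos.le (hc.one_le n x)
  · refine (ha.upper n x ξ).trans ?_
    gcongr
    exact hB x

theorem IsCoeff.memLp_flux (ha : IsCoeff c m M a) (hc : IsWeight Ω c A) (n : ℕ) (u : H10 Ω) :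
    MemLp (flux (a n) u) 2 (volume.restrict Ω) := by
  obtain ⟨β, hβ, h⟩ := ha.matClass hc n
  exact h.memLp_act hβ (Lp.memLp _)

theorem IsCoeff.exists_sol (ha : IsCoeff c m M a) (hc : IsWeight Ω c A)
    (hΩb : Bornology.IsBounded Ω) (n : ℕ) (f : Hneg1 Ω) :
    ∃ u : H10 Ω, ∀ v, IsSol (a n) f v ↔ v = u := by
  obtain ⟨β, hβ, h⟩ := ha.matClass hc n
  exact h.exists_sol hΩb ha.pos hβ f

theorem IsWeight.integrable_mul_sq (hc : IsWeight Ω c A) (n : ℕ) {g : Plane → Plane}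
    (hg : MemLp g 2 (volume.restrict Ω)) :
    Integrable (fun x => c n x * ‖g x‖ ^ 2) (volume.restrict Ω) := by
  obtain ⟨B, hB⟩ := hc.bdd n
  refine (hg.norm.integrable_sq.const_mul B).mono'
    ((hc.measurable n).aestronglyMeasurable.mul (hg.1.norm.pow 2))
    (Eventually.of_forall fun x => ?_)
  rw [Real.norm_of_nonneg (mul_nonneg (hc.pos n x).le (by positivity))]
  gcongr
  exact hB x

theorem IsCoeff.weighted_energy_le (ha : IsCoeff c m M a) (hc : IsWeight Ω c A)
    (hu : IsSol (a n) f u) : ∫ x in Ω, c n x * ‖gradL Ω u x‖ ^ 2 ≤ m⁻¹ * (- f u) := by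
  have hm := ha.pos
  have h1 : ∫ x in Ω, inner ℝ (flux (a n) u x) (gradL Ω u x) = - f u := hu u
  rw [← h1, ← integral_const_mul]
  refine integral_mono (hc.integrable_mul_sq n (Lp.memLp _))
    ((integrable_inner (ha.memLp_flux hc n u) (Lp.memLp _)).const_mul _) fun x => ?_
  have := ha.lower n x (gradL Ω u x)
  rw [le_inv_mul_iff₀ hm, ← mul_assoc]
  exact this

theorem IsCoeff.flux_energy_le (ha : IsCoeff c m M a) (hc : IsWeight Ω c A)
    (hu : IsSol (a n) f u) : ∫ x in Ω, ‖flux (a n) u x‖ ^ 2 / c n x ≤ M ^ 2 * m⁻¹ * (- f u) := by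
  rw [mul_assoc]
  refine le_trans ?_ (mul_le_mul_of_nonneg_left (ha.weighted_energy_le hc hu) (by positivity))
  rw [← integral_const_mul]
  refine integral_mono (hc.integrable_energy (ha.memLp_flux hc n u) n)
    ((hc.integrable_mul_sq n (Lp.memLp _)).const_mul _) fun x => ?_
  have hp := hc.pos n x
  simp only
  rw [div_le_iff₀ hp]
  calc ‖flux (a n) u x‖ ^ 2 ≤ (M * c n x * ‖gradL Ω u x‖) ^ 2 :=
        pow_le_pow_left₀ (norm_nonneg _) (ha.upper n x _) 2
    _ = _ := by ring

theorem IsCoeff.neg_apply_nonneg (ha : IsCoeff c m M a) (hc : IsWeight Ω c A)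
    (hu : IsSol (a n) f u) : 0 ≤ - f u := by
  have h := ha.weighted_energy_le hc hu
  have h0 : 0 ≤ ∫ x in Ω, c n x * ‖gradL Ω u x‖ ^ 2 :=
    integral_nonneg fun x => mul_nonneg (hc.pos n x).le (by positivity)
  have := h0.trans h
  exact nonneg_of_mul_nonneg_right this (inv_pos.2 ha.pos)

theorem IsCoeff.sq_norm_gradL_le (ha : IsCoeff c m M a) (hc : IsWeight Ω c A)
    (hu : IsSol (a n) f u) : ‖gradL Ω u‖ ^ 2 ≤ m⁻¹ * (- f u) := by
  rw [L2V_norm_sq_eq]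
  refine le_trans (integral_mono (Lp.memLp _).norm.integrable_sq
    (hc.integrable_mul_sq n (Lp.memLp _)) fun x => ?_) (ha.weighted_energy_le hc hu)
  exact le_mul_of_one_le_left (by positivity) (hc.one_le n x)

theorem IsCoeff.exists_norm_le (ha : IsCoeff c m M a) (hc : IsWeight Ω c A)
    (hΩb : Bornology.IsBounded Ω) :
    ∃ C, 0 < C ∧ ∀ n (f : Hneg1 Ω) (u : H10 Ω), IsSol (a n) f u → ‖u‖ ≤ C * ‖f‖ := by
  obtain ⟨C, hC, hP⟩ := exists_poincare hΩb
  have hm := ha.pos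
  refine ⟨C ^ 2 * m⁻¹, by positivity, fun n f u hu => ?_⟩
  have h1 := ha.sq_norm_gradL_le hc hu
  have h2 : - f u ≤ ‖f‖ * ‖u‖ := (neg_le_abs _).trans (f.le_opNorm u)
  have h3 : ‖u‖ ^ 2 ≤ C ^ 2 * ‖gradL Ω u‖ ^ 2 := by
    rw [← mul_pow]; exact pow_le_pow_left₀ (norm_nonneg _) (hP u) 2
  have h4 : ‖u‖ * ‖u‖ ≤ C ^ 2 * m⁻¹ * ‖f‖ * ‖u‖ := by
    calc ‖u‖ * ‖u‖ = ‖u‖ ^ 2 := by ring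
      _ ≤ C ^ 2 * (m⁻¹ * (‖f‖ * ‖u‖)) := h3.trans (by gcongr; exact h1.trans (by gcongr))
      _ = _ := by ring
  by_cases h0 : ‖u‖ = 0
  · rw [h0]; positivity
  · exact le_of_mul_le_mul_right h4 (lt_of_le_of_ne (norm_nonneg _) (Ne.symm h0))

/-- Solutions `un` for the datum `f` converge to `u`, and their fluxes to `σ`. -/
structure LimPair (l : Filter ℕ) (a : ℕ → Plane → Mat2) (f : Hneg1 Ω) (un : ℕ → H10 Ω) (u : H10 Ω)
    (σ : L2V Ω) : Prop where
  sol : ∀ n, IsSol (a n) f (un n)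
  weak : WeakTendsto l un u
  fluxTendsto : FluxTendsto l (fun n => flux (a n) (un n)) σ

theorem IsCoeff.exists_flux_energy_le (ha : IsCoeff c m M a) (hc : IsWeight Ω c A)
    (hΩb : Bornology.IsBounded Ω) {un : ℕ → H10 Ω} (hu : ∀ n, IsSol (a n) f (un n)) :
    ∃ E, ∀ n, ∫ x in Ω, ‖flux (a n) (un n) x‖ ^ 2 / c n x ≤ E := by
  obtain ⟨C, hC, hb⟩ := ha.exists_norm_le hc hΩb
  have hm := ha.pos
  refine ⟨M ^ 2 * m⁻¹ * (‖f‖ * (C * ‖f‖)), fun n => (ha.flux_energy_le hc (hu n)).trans ?_⟩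
  have : - f (un n) ≤ ‖f‖ * ‖un n‖ := (neg_le_abs _).trans (f.le_opNorm _)
  gcongr
  exact this.trans (by gcongr; exact hb n f _ (hu n))

theorem IsCoeff.exists_weighted_energy_le (ha : IsCoeff c m M a) (hc : IsWeight Ω c A)
    (hΩb : Bornology.IsBounded Ω) {un : ℕ → H10 Ω} (hu : ∀ n, IsSol (a n) f (un n)) :
    ∃ E, ∀ n, ∫ x in Ω, c n x * ‖gradL Ω (un n) x‖ ^ 2 ≤ E := by
  obtain ⟨C, hC, hb⟩ := ha.exists_norm_le hc hΩb
  have hm := ha.pos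
  refine ⟨m⁻¹ * (‖f‖ * (C * ‖f‖)), fun n => (ha.weighted_energy_le hc (hu n)).trans ?_⟩
  have : - f (un n) ≤ ‖f‖ * ‖un n‖ := (neg_le_abs _).trans (f.le_opNorm _)
  gcongr
  exact this.trans (by gcongr; exact hb n f _ (hu n))

theorem IsCoeff.exists_limPair (ha : IsCoeff c m M a) (hc : IsWeight Ω c A) (hΩ : IsOpen Ω)
    (hΩb : Bornology.IsBounded Ω) (U : Ultrafilter ℕ) (hU : (U : Filter ℕ) ≤ atTop)
    {un : ℕ → H10 Ω} (hu : ∀ n, IsSol (a n) f (un n)) : ∃ u σ, LimPair U a f un u σ := by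
  obtain ⟨C, -, hb⟩ := ha.exists_norm_le hc hΩb
  obtain ⟨u, hw⟩ := exists_weak_limit U (u := un) fun n => hb n f _ (hu n)
  obtain ⟨E, hE⟩ := ha.exists_flux_energy_le hc hΩb hu
  obtain ⟨σ, hσ⟩ := hc.exists_fluxTendsto hΩ U hU (fun n => ha.memLp_flux hc n (un n)) hE
  exact ⟨u, σ, hu, hw, hσ⟩

/-- For gradients of test functions this is the weak-* limit of the equations; both sides are
continuous in v, so density concludes. -/
theorem LimPair.inner_gradL {l : Filter ℕ} [l.NeBot] {un : ℕ → H10 Ω} {σ : L2V Ω}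
    (h : LimPair l a f un u σ) (v : H10 Ω) : inner ℝ σ (gradL Ω v) = - f v := by
  refine isClosed_H10_induction (P := fun v => inner ℝ σ (gradL Ω v) = - f v)
    (isClosed_eq (gradPair σ).continuous f.continuous.neg) (fun φ hφ => ?_) v
  have h1 := h.fluxTendsto _ hφ.isTestField_gradient
  have h2 : ∀ n, ∫ x in Ω, inner ℝ (gradient φ x) (flux (a n) (un n) x) =
      - f (testElem hφ) := by
    intro n
    rw [← h.sol n (testElem hφ)]
    refine integral_congr_ae ?_
    filter_upwards [coeFn_gradL_testElem hφ] with x hx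
    rw [real_inner_comm, ← hx]
    rfl
  simp only [h2] at h1
  rw [tendsto_nhds_unique tendsto_const_nhds h1, gradL_testElem, real_inner_comm, inner_toLp_left]

/-- This is the coercivity of f ↦ -f(u) on data. The limit flux represents -f, so ‖f‖ ≤ ‖σ‖, while
‖σ‖² is at most A times the limit of the energy bounds, which are multiples of -f(u_n). -/
theorem LimPair.norm_sq_le {l : Filter ℕ} [l.NeBot] (hl : l ≤ atTop) {un : ℕ → H10 Ω} {σ : L2V Ω}
    (ha : IsCoeff c m M a) (hc : IsWeight Ω c A) (hΩ : IsOpen Ω) (h : LimPair l a f un u σ) :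
    ‖f‖ ^ 2 ≤ A * (M ^ 2 * m⁻¹ * (- f u)) := by
  have h1 := hc.norm_sq_le_of_fluxTendsto hΩ hl (fun n => ha.memLp_flux hc n (un n))
    (fun n => ha.flux_energy_le hc (h.sol n)) (((h.weak f).neg).const_mul _) h.fluxTendsto
  have h2 : ‖f‖ ≤ ‖σ‖ := ?_
  · exact le_trans (by gcongr) h1
  refine f.opNorm_le_bound (norm_nonneg _) fun v => ?_
  rw [← norm_neg, ← h.inner_gradL v]
  refine (norm_inner_le_norm _ _).trans ?_
  gcongr
  exact norm_gradL_le v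

theorem LimPair.neg_apply_nonneg {l : Filter ℕ} [l.NeBot] {un : ℕ → H10 Ω} {σ : L2V Ω}
    (ha : IsCoeff c m M a) (hc : IsWeight Ω c A) (h : LimPair l a f un u σ) : 0 ≤ - f u :=
  ge_of_tendsto' (h.weak f).neg fun n => ha.neg_apply_nonneg hc (h.sol n)

theorem WeakTendsto.unique {l : Filter ℕ} [l.NeBot] {un : ℕ → H10 Ω} {u v : H10 Ω}
    (hu : WeakTendsto l un u) (hv : WeakTendsto l un v) : u = v :=
  ext_inner_left ℝ fun w => tendsto_nhds_unique (hu (innerSL ℝ w)) (hv (innerSL ℝ w))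

theorem WeakTendsto.norm_le {l : Filter ℕ} [l.NeBot] {un : ℕ → H10 Ω} {u : H10 Ω} {B : ℝ}
    (hu : WeakTendsto l un u) (hB : ∀ n, ‖un n‖ ≤ B) : ‖u‖ ≤ B := by
  have h : ‖u‖ * ‖u‖ ≤ ‖u‖ * B := by
    rw [← real_inner_self_eq_norm_mul_norm]
    exact le_of_tendsto' (hu (innerSL ℝ u)) fun n => (real_inner_le_norm u (un n)).trans
      (mul_le_mul_of_nonneg_left (hB n) (norm_nonneg _))
  by_cases h0 : ‖u‖ = 0
  · rw [h0]; exact (norm_nonneg _).trans (hB 0)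
  · exact le_of_mul_le_mul_left h (lt_of_le_of_ne (norm_nonneg _) (Ne.symm h0))

theorem MatClass.isSol_add {B : Plane → Mat2} {α β : ℝ} (hβ : 0 < β) (h : MatClass α β Ω B)
    {g : Hneg1 Ω} {v : H10 Ω} (hu : IsSol B f u) (hv : IsSol B g v) : IsSol B (f + g) (u + v) := by
  obtain ⟨T, hT⟩ := h.exists_operator hβ
  rw [isSol_iff hT] at *
  intro w
  simp only [map_add, inner_add_left, hu w, hv w, add_apply]
  ring

theorem MatClass.isSol_sub {B : Plane → Mat2} {α β : ℝ} (hβ : 0 < β) (h : MatClass α β Ω B)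
    {g : Hneg1 Ω} {v : H10 Ω} (hu : IsSol B f u) (hv : IsSol B g v) : IsSol B (f - g) (u - v) := by
  obtain ⟨T, hT⟩ := h.exists_operator hβ
  rw [isSol_iff hT] at *
  intro w
  simp only [map_sub, inner_sub_left, hu w, hv w, sub_apply]
  ring

theorem MatClass.isSol_smul {B : Plane → Mat2} {α β : ℝ} (hβ : 0 < β) (h : MatClass α β Ω B)
    (t : ℝ) (hu : IsSol B f u) : IsSol B (t • f) (t • u) := by
  obtain ⟨T, hT⟩ := h.exists_operator hβ
  rw [isSol_iff hT] at *
  intro w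
  simp only [map_smul, real_inner_smul_left, hu w, smul_apply, smul_eq_mul]
  ring

/-- The hypothesis `h` makes -R coercive, and Lax–Milgram applies. -/
theorem surjective_of_linear_coercive {H : Type*} [NormedAddCommGroup H] [InnerProductSpace ℝ H]
    [CompleteSpace H] {R : H → H} (hadd : ∀ v w, R (v + w) = R v + R w)
    (hsmul : ∀ (t : ℝ) v, R (t • v) = t • R v) {C K : ℝ} (hC : ∀ v, ‖R v‖ ≤ C * ‖v‖) (hK : 0 ≤ K)
    (h0 : ∀ v, 0 ≤ - inner ℝ v (R v)) (h : ∀ v, ‖v‖ ^ 2 ≤ K * (- inner ℝ v (R v))) :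
    Function.Surjective R := by
  let L : H →L[ℝ] H := LinearMap.mkContinuous ⟨⟨R, hadd⟩, hsmul⟩ C hC
  have hL : ∀ v, L v = R v := fun v => rfl
  -- The constant is 1/(K + 1) because K may vanish; the extra term is nonnegative by `h0`.
  have hb : Function.Bijective (-L) := by
    refine bijective_of_coercive (-L) (C := (K + 1)⁻¹) (by positivity) fun v => ?_
    rw [inv_mul_le_iff₀ (by positivity), neg_apply, hL, inner_neg_left,
      real_inner_comm]
    linarith [h v, h0 v]
  intro w
  obtain ⟨v, hv⟩ := hb.2 (-w)
  refine ⟨v, ?_⟩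
  rw [neg_apply, hL] at hv
  exact neg_injective hv

theorem surjective_of_dual_coercive {H : Type*} [NormedAddCommGroup H] [InnerProductSpace ℝ H]
    [CompleteSpace H] {R : (H →L[ℝ] ℝ) → H} (hadd : ∀ f g, R (f + g) = R f + R g)
    (hsmul : ∀ (t : ℝ) f, R (t • f) = t • R f) {C K : ℝ} (hC : ∀ f, ‖R f‖ ≤ C * ‖f‖) (hK : 0 ≤ K)
    (h0 : ∀ f : H →L[ℝ] ℝ, 0 ≤ - f (R f))
    (h : ∀ f : H →L[ℝ] ℝ, ‖f‖ ^ 2 ≤ K * (- f (R f))) :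
    Function.Surjective R := by
  have hs : Function.Surjective fun w : H => R (innerSL ℝ w) :=
    surjective_of_linear_coercive (C := C) (K := K) (fun v w => by rw [map_add, hadd])
      (fun t v => by rw [map_smul, hsmul])
      (fun v => by simpa only [innerSL_apply_norm] using hC (innerSL ℝ v)) hK
      (fun v => h0 (innerSL ℝ v))
      (fun v => by simpa only [innerSL_apply_norm, innerSL_apply_apply] using h (innerSL ℝ v))
  exact fun u => (hs u).imp' _ fun _ hw => hw

/-- Every function in `H¹₀` is the limit of solutions for a suitable datum. -/
theorem IsCoeff.exists_limPair_of_limit (ha : IsCoeff c m M a) (hc : IsWeight Ω c A)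
    (hΩ : IsOpen Ω) (hΩb : Bornology.IsBounded Ω) (U : Ultrafilter ℕ)
    (hU : (U : Filter ℕ) ≤ atTop) (u : H10 Ω) : ∃ f un σ, LimPair U a f un u σ := by
  choose s hs using fun n (f : Hneg1 Ω) => ha.exists_sol hc hΩb n f
  have hs' : ∀ n f, IsSol (a n) f (s n f) := fun n f => (hs n f _).2 rfl
  have hadd : ∀ n f g, s n (f + g) = s n f + s n g := fun n f g => by
    obtain ⟨β, hβ, h⟩ := ha.matClass hc n
    exact ((hs n (f + g) _).1 (h.isSol_add hβ (hs' n f) (hs' n g))).symm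
  have hsmul : ∀ n (t : ℝ) f, s n (t • f) = t • s n f := fun n t f => by
    obtain ⟨β, hβ, h⟩ := ha.matClass hc n
    exact ((hs n (t • f) _).1 (h.isSol_smul hβ t (hs' n f))).symm
  -- Along a fixed ultrafilter every datum has a limit, so R is defined on the whole dual. It is
  -- linear by uniqueness of weak limits and coercive by `LimPair.norm_sq_le`.
  choose R σ hR using fun f : Hneg1 Ω => ha.exists_limPair hc hΩ hΩb U hU fun n => hs' n f
  obtain ⟨C, -, hb⟩ := ha.exists_norm_le hc hΩb
  have hsurj : Function.Surjective R := by
    refine surjective_of_dual_coercive (C := C) (K := A * (M ^ 2 * m⁻¹)) (fun f g => ?_)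
      (fun t f => ?_) (fun f => (hR f).weak.norm_le fun n => hb n _ _ (hs' n f)) ?_
      (fun f => (hR f).neg_apply_nonneg ha hc) (fun f => ?_)
    · refine (hR (f + g)).weak.unique fun k => ?_
      simp only [hadd, map_add]
      exact ((hR f).weak k).add ((hR g).weak k)
    · refine (hR (t • f)).weak.unique fun k => ?_
      simp only [hsmul, map_smul]
      exact ((hR f).weak k).const_smul t
    · have := ha.pos
      exact mul_nonneg hc.nonneg (by positivity)
    · rw [mul_assoc]
      exact (hR f).norm_sq_le hU ha hc hΩ
  obtain ⟨f, rfl⟩ := hsurj u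
  exact ⟨_, _, _, hR f⟩

end Energy

end HighContrast
end

open Filter Topology MeasureTheory

noncomputable section

namespace HighContrast

/-! ### Locally affine functions -/

theorem gradient_inner_right (ξ x : Plane) : gradient (fun y : Plane => inner ℝ ξ y) x = ξ := by
  have h : HasGradientAt (fun y : Plane => inner ℝ ξ y) ξ x := by
    rw [hasGradientAt_iff_hasFDerivAt]
    exact (innerSL ℝ ξ).hasFDerivAt
  exact h.gradient

/-- There are countably many open sets covering `Ω` on each of which every constant field is the
gradient of a function in `H¹₀`. -/
theorem exists_locally_affine {Ω : Set Plane} (hΩ : IsOpen Ω) :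
    ∃ (w : ℕ → Plane → H10 Ω) (B : ℕ → Set Plane), (∀ k, IsOpen (B k)) ∧ Ω ⊆ ⋃ k, B k ∧
      ∀ k ξ, ∀ᵐ x ∂(volume.restrict Ω), x ∈ B k → gradL Ω (w k ξ) x = ξ := by
  have hloc : ∀ x ∈ Ω, ∃ r > 0, ∃ w : Plane → H10 Ω, ∀ ξ, ∀ᵐ y ∂(volume.restrict Ω),
      y ∈ Metric.ball x r → gradL Ω (w ξ) y = ξ := by
    intro x hx
    obtain ⟨r, hr, hrΩ⟩ := Metric.nhds_basis_closedBall.mem_iff.1 (hΩ.mem_nhds hx)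
    -- The function ψ(y) ξ·y coincides with ξ·y on the ball of radius r/2, so its gradient there is
    -- ξ.
    let ψ : ContDiffBump x := ⟨r / 2, r, by positivity, by linarith⟩
    have hs : ∀ ξ : Plane, Function.support (fun y : Plane => ψ y * inner ℝ ξ y) ⊆
        Function.support ψ := fun ξ y hy h0 => hy (by simp [h0])
    have hT : ∀ ξ : Plane, IsTest Ω fun y => ψ y * inner ℝ ξ y := fun ξ =>
      ⟨ψ.contDiff.mul (contDiff_const.inner ℝ contDiff_id), ψ.hasCompactSupport.mono (hs ξ), by
        refine (closure_mono (hs ξ)).trans ?_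
        have := ψ.tsupport_eq
        rw [tsupport] at this
        rw [this]
        exact hrΩ⟩
    refine ⟨r / 2, by positivity, fun ξ => testElem (hT ξ), fun ξ => ?_⟩
    filter_upwards [coeFn_gradL_testElem (hT ξ)] with y hy hyB
    rw [hy]
    have he : (fun y => ψ y * inner ℝ ξ y) =ᶠ[𝓝 y] fun y => inner ℝ ξ y := by
      filter_upwards [Metric.isOpen_ball.mem_nhds hyB] with z hz
      rw [ψ.one_of_mem_closedBall (Metric.ball_subset_closedBall hz), one_mul]
    rw [gradient, he.fderiv_eq]
    exact gradient_inner_right ξ y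
  rcases Ω.eq_empty_or_nonempty with rfl | hne
  · exact ⟨fun _ _ => 0, fun _ => ∅, fun _ => isOpen_empty, Set.empty_subset _, fun _ _ => by simp⟩
  choose! r hr w hw using hloc
  obtain ⟨t, htΩ, htc, hcov⟩ := TopologicalSpace.countable_cover_nhdsWithin
    (s := Ω) (f := fun x => Metric.ball x (r x))
    fun x hx => mem_nhdsWithin_of_mem_nhds (Metric.ball_mem_nhds x (hr x hx))
  have htne : t.Nonempty := by
    obtain ⟨x, hx⟩ := hne
    obtain ⟨y, hy, -⟩ := Set.mem_iUnion₂.1 (hcov hx)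
    exact ⟨y, hy⟩
  obtain ⟨e, he⟩ := htc.exists_eq_range htne
  have hmem : ∀ k, e k ∈ Ω := fun k => htΩ (he ▸ Set.mem_range_self k)
  refine ⟨fun k => w (e k), fun k => Metric.ball (e k) (r (e k)), fun k => Metric.isOpen_ball,
    fun x hx => ?_, fun k ξ => hw _ (hmem k) ξ⟩
  obtain ⟨y, hy, hxy⟩ := Set.mem_iUnion₂.1 (hcov hx)
  rw [he] at hy
  obtain ⟨k, rfl⟩ := hy
  exact Set.mem_iUnion.2 ⟨k, hxy⟩

/-- A closed pointwise condition satisfied by all gradients is satisfied by all vectors. -/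
theorem ae_forall_of_gradL {Ω : Set Plane} (hΩ : IsOpen Ω) {P : Plane → Plane → Prop}
    (hcl : ∀ x, IsClosed {ξ | P x ξ})
    (h : ∀ u : H10 Ω, ∀ᵐ x ∂(volume.restrict Ω), P x (gradL Ω u x)) :
    ∀ᵐ x ∂(volume.restrict Ω), ∀ ξ, P x ξ := by
  obtain ⟨w, B, -, hB, hw⟩ := exists_locally_affine hΩ
  set d := TopologicalSpace.denseSeq Plane
  have h1 : ∀ᵐ x ∂(volume.restrict Ω), ∀ k j, x ∈ B k → gradL Ω (w k (d j)) x = d j := by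
    simp only [ae_all_iff]
    exact fun k j => hw k (d j)
  have h2 : ∀ᵐ x ∂(volume.restrict Ω), ∀ k j, P x (gradL Ω (w k (d j)) x) := by
    simp only [ae_all_iff]
    exact fun k j => h _
  filter_upwards [h1, h2, ae_restrict_mem hΩ.measurableSet] with x h1 h2 hx ξ
  obtain ⟨k, hk⟩ := Set.mem_iUnion.1 (hB hx)
  refine (TopologicalSpace.denseRange_denseSeq Plane).induction_on (p := fun ξ => P x ξ) ξ (hcl x)
    fun j => ?_
  have := h2 k j
  rwa [h1 k j hk] at this

/-! ### Two-phase microstructures -/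

theorem chi_of_mem {ω : Set Plane} {x : Plane} (h : x ∈ ω) : chi ω x = 1 := by simp [chi, h]

theorem chi_of_notMem {ω : Set Plane} {x : Plane} (h : x ∉ ω) : chi ω x = 0 := by simp [chi, h]

theorem measurable_chi {ω : Set Plane} (h : IsOpen ω) : Measurable (chi ω) :=
  measurable_one.indicator h.measurableSet

/-- The standing assumptions on the microstructure. -/
structure Micro (Ω : Set Plane) (ω : ℕ → Set Plane) (a : Plane → ℝ) : Prop where
  isOpen : IsOpen Ω
  isBounded : Bornology.IsBounded Ω
  open_phase : ∀ n, IsOpen (ω n)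
  pos : ∀ n, 0 < volume.real (ω n)
  lt_one : ∀ n, volume.real (ω n) < 1
  tendsto : Tendsto (fun n => volume.real (ω n)) atTop (𝓝 0)
  memLp : MemLp a ⊤ (volume.restrict Ω)
  weakStar : WeakStar Ω (fun n x => chi (ω n) x / volume.real (ω n)) a

theorem Micro.comp {Ω : Set Plane} {ω : ℕ → Set Plane} {a : Plane → ℝ} (h : Micro Ω ω a)
    {k : ℕ → ℕ} (hk : Tendsto k atTop atTop) : Micro Ω (fun n => ω (k n)) a :=
  ⟨h.isOpen, h.isBounded, fun _ => h.open_phase _, fun _ => h.pos _, fun _ => h.lt_one _,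
    h.tendsto.comp hk, h.memLp, fun _ => h.weakStar.1 _, h.weakStar.2.1,
    fun φ h1 h2 h3 => (h.weakStar.2.2 φ h1 h2 h3).comp hk⟩

/-- The weights of the microstructure. -/
def wt (ω : ℕ → Set Plane) (n : ℕ) (x : Plane) : ℝ :=
  1 - chi (ω n) x + chi (ω n) x / volume.real (ω n)

theorem wt_of_mem {ω : ℕ → Set Plane} {n : ℕ} {x : Plane} (h : x ∈ ω n) :
    wt ω n x = 1 / volume.real (ω n) := by simp [wt, chi_of_mem h]

theorem wt_of_notMem {ω : ℕ → Set Plane} {n : ℕ} {x : Plane} (h : x ∉ ω n) :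
    wt ω n x = 1 := by simp [wt, chi_of_notMem h]

section Micro

variable {Ω : Set Plane} {ω : ℕ → Set Plane} {a : Plane → ℝ}

theorem Micro.integrable_mul (h : Micro Ω ω a) {φ : Plane → ℝ} (hφ : Continuous φ)
    (hφc : HasCompactSupport φ) (n : ℕ) :
    Integrable (fun x => φ x * (chi (ω n) x / volume.real (ω n))) (volume.restrict Ω) := by
  refine (hφ.integrable_of_hasCompactSupport hφc).restrict.mul_bdd
    (c := 1 / volume.real (ω n))
    ((measurable_chi (h.open_phase n)).div_const _).aestronglyMeasurable
    (Eventually.of_forall fun x => ?_)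
  have hp := h.pos n
  by_cases hx : x ∈ ω n
  · rw [chi_of_mem hx, Real.norm_of_nonneg (by positivity)]
  · rw [chi_of_notMem hx, zero_div, norm_zero]; positivity

theorem Micro.integrable_mul_limit (h : Micro Ω ω a) {φ : Plane → ℝ} (hφ : Continuous φ)
    (hφc : HasCompactSupport φ) : Integrable (fun x => φ x * a x) (volume.restrict Ω) :=
  MemLp.integrable_mul (p := 1) (q := ⊤)
    (memLp_one_iff_integrable.2 (hφ.integrable_of_hasCompactSupport hφc).restrict) h.memLp

theorem Micro.ae_le (h : Micro Ω ω a) : ∀ᵐ x ∂(volume.restrict Ω), a x ≤ supNorm Ω a := by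
  filter_upwards [ae_le_eLpNormEssSup (f := a) (μ := volume.restrict Ω)] with x hx
  have h1 := ENNReal.toReal_mono (by simpa [eLpNorm_exponent_top] using h.memLp.2.ne) hx
  rw [toReal_enorm] at h1
  exact (le_abs_self _).trans (by simpa [supNorm, eLpNorm_exponent_top] using h1)

theorem supNorm_nonneg (Ω : Set Plane) (a : Plane → ℝ) : 0 ≤ supNorm Ω a := ENNReal.toReal_nonneg

theorem Micro.tendsto_integral (h : Micro Ω ω a) {φ : Plane → ℝ} (hφ : Continuous φ)
    (hφc : HasCompactSupport φ) (hφs : tsupport φ ⊆ Ω) :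
    Tendsto (fun n => ∫ x in Ω, φ x * (chi (ω n) x / volume.real (ω n))) atTop
      (𝓝 (∫ x in Ω, φ x * a x)) :=
  h.weakStar.2.2 φ hφ hφc hφs

theorem Micro.integral_limit_le (h : Micro Ω ω a) {φ : Plane → ℝ} (hφ : Continuous φ)
    (hφc : HasCompactSupport φ) (h0 : ∀ x, 0 ≤ φ x) :
    ∫ x in Ω, φ x * a x ≤ supNorm Ω a * ∫ x in Ω, φ x := by
  rw [← integral_const_mul]
  refine integral_mono_ae (h.integrable_mul_limit hφ hφc)
    ((hφ.integrable_of_hasCompactSupport hφc).restrict.const_mul _) ?_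
  filter_upwards [h.ae_le] with x hx
  rw [mul_comm]
  exact mul_le_mul_of_nonneg_right hx (h0 x)

theorem Micro.one_le_wt (h : Micro Ω ω a) (n : ℕ) (x : Plane) : 1 ≤ wt ω n x := by
  by_cases hx : x ∈ ω n
  · rw [wt_of_mem hx, le_div_iff₀ (h.pos n)]; linarith [h.lt_one n]
  · rw [wt_of_notMem hx]

theorem Micro.wt_le (h : Micro Ω ω a) (n : ℕ) (x : Plane) : wt ω n x ≤ 1 / volume.real (ω n) := by
  by_cases hx : x ∈ ω n
  · rw [wt_of_mem hx]
  · rw [wt_of_notMem hx, le_div_iff₀ (h.pos n)]; linarith [h.lt_one n]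

/-- The weight is at most 1 + χ/θ, whose integral against φ ≥ 0 tends to ∫φ + ∫aφ, and a is at most
its sup norm. -/
theorem Micro.isWeight (h : Micro Ω ω a) : IsWeight Ω (wt ω) (1 + supNorm Ω a) where
  nonneg := by linarith [supNorm_nonneg Ω a]
  measurable n := by
    have := measurable_chi (h.open_phase n)
    unfold wt
    fun_prop
  one_le := h.one_le_wt
  bdd n := ⟨_, h.wt_le n⟩
  limsup φ hφ hφc hφs h0 ε hε := by
    have hi : Integrable φ (volume.restrict Ω) :=
      (hφ.integrable_of_hasCompactSupport hφc).restrict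
    have h1 := h.tendsto_integral hφ hφc hφs
    have h2 := h.integral_limit_le hφ hφc h0
    filter_upwards [h1.eventually (gt_mem_nhds (lt_add_of_pos_right _ hε))] with n hn
    have h3 : ∫ x in Ω, wt ω n x * φ x ≤
        ∫ x in Ω, (φ x + φ x * (chi (ω n) x / volume.real (ω n))) := by
      refine integral_mono_of_nonneg (Eventually.of_forall fun x => mul_nonneg
        (zero_le_one.trans (h.one_le_wt n x)) (h0 x)) (hi.add (h.integrable_mul hφ hφc n))
        (Eventually.of_forall fun x => ?_)
      by_cases hx : x ∈ ω n
      · simp only [wt_of_mem hx, chi_of_mem hx]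
        linarith [h0 x, mul_comm (φ x) (1 / volume.real (ω n))]
      · simp [wt_of_notMem hx, chi_of_notMem hx]
    rw [integral_add hi (h.integrable_mul hφ hφc n)] at h3
    linarith

/-- The two-phase matrix field equal to `p I` outside `ω` and to `q I + r J` in `ω`. -/
def phase (ω : Set Plane) (p q r : ℝ) : Plane → Mat2 :=
  fun x => (1 - chi ω x) • (p • (1 : Mat2)) + chi ω x • (q • (1 : Mat2) + r • J)

theorem act_phase_of_mem {ω : Set Plane} {p q r : ℝ} {x : Plane} (h : x ∈ ω) (ξ : Plane) :
    act (phase ω p q r x) ξ = q • ξ + r • act J ξ := by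
  simp only [phase, chi_of_mem h, sub_self, zero_smul, zero_add, one_smul, act_add_mat,
    act_smul_mat, act_one]

theorem act_phase_of_notMem {ω : Set Plane} {p q r : ℝ} {x : Plane} (h : x ∉ ω) (ξ : Plane) :
    act (phase ω p q r x) ξ = p • ξ := by
  simp only [phase, chi_of_notMem h, sub_zero, zero_smul, add_zero, one_smul, act_smul_mat,
    act_one]

/-- Two-phase coefficients with limits `P`, `Q`, `R` after rescaling in the second phase. -/
structure IsPhase (ω : ℕ → Set Plane) (p q r : ℕ → ℝ) (P Q R : ℝ) : Prop where
  pos₁ : ∀ n, 0 < p n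
  pos₂ : ∀ n, 0 < q n
  lim_pos₁ : 0 < P
  lim_pos₂ : 0 < Q
  tendsto₁ : Tendsto p atTop (𝓝 P)
  tendsto₂ : Tendsto (fun n => volume.real (ω n) * q n) atTop (𝓝 Q)
  tendsto₃ : Tendsto (fun n => volume.real (ω n) * r n) atTop (𝓝 R)

theorem exists_bounds_of_tendsto {x : ℕ → ℝ} {L : ℝ} (hx : ∀ n, 0 < x n) (hL : 0 < L)
    (h : Tendsto x atTop (𝓝 L)) : ∃ m M, 0 < m ∧ 0 < M ∧ ∀ n, m ≤ x n ∧ x n ≤ M := by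
  obtain ⟨M, hM⟩ := h.bddAbove_range
  obtain ⟨K, hK⟩ := (h.inv₀ hL.ne').bddAbove_range
  have hM' : ∀ n, x n ≤ M := fun n => hM ⟨n, rfl⟩
  have hK' : ∀ n, (x n)⁻¹ ≤ K := fun n => hK ⟨n, rfl⟩
  have hK0 : 0 < K := (inv_pos.2 (hx 0)).trans_le (hK' 0)
  exact ⟨K⁻¹, M, inv_pos.2 hK0, (hx 0).trans_le (hM' 0), fun n =>
    ⟨inv_le_of_inv_le₀ (hx n) (hK' n), hM' n⟩⟩

theorem measurable_phase {ω : Set Plane} (h : IsOpen ω) (p q r : ℝ) (i j : Fin 2) :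
    Measurable fun x => phase ω p q r x i j := by
  have := measurable_chi h
  simp only [phase, Matrix.add_apply, Matrix.smul_apply, smul_eq_mul]
  fun_prop

/-- Only qI enters the quadratic form, as Jξ·ξ = 0, so the lower bound is unaffected by r. After
multiplication by θ the inclusion coefficients converge, hence are bounded, and those of q stay away
from zero. -/
theorem IsPhase.exists_isCoeff (h : Micro Ω ω a) {p q r : ℕ → ℝ} {P Q R : ℝ}
    (hp : IsPhase ω p q r P Q R) :
    ∃ m M, IsCoeff (wt ω) m M fun n => phase (ω n) (p n) (q n) (r n) := by
  obtain ⟨m₁, M₁, hm₁, hM₁, h₁⟩ := exists_bounds_of_tendsto hp.pos₁ hp.lim_pos₁ hp.tendsto₁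
  obtain ⟨m₂, M₂, hm₂, hM₂, h₂⟩ := exists_bounds_of_tendsto
    (fun n => mul_pos (h.pos n) (hp.pos₂ n)) hp.lim_pos₂ hp.tendsto₂
  obtain ⟨M₃, hM₃⟩ := hp.tendsto₃.abs.bddAbove_range
  have h₃ : ∀ n, |volume.real (ω n) * r n| ≤ M₃ := fun n => hM₃ ⟨n, rfl⟩
  have hM₃0 : 0 ≤ M₃ := (abs_nonneg _).trans (h₃ 0)
  refine ⟨min m₁ m₂, M₁ + M₂ + M₃, lt_min hm₁ hm₂, by positivity,
    fun n i j => measurable_phase (h.open_phase n) _ _ _ i j, fun n x ξ => ?_, fun n x ξ => ?_⟩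
  · by_cases hx : x ∈ ω n
    · rw [act_phase_of_mem hx, inner_add_left, real_inner_smul_left, real_inner_smul_left,
        inner_act_J_self, real_inner_self_eq_norm_sq, mul_zero, add_zero, wt_of_mem hx]
      have hθ := h.pos n
      have : min m₁ m₂ * (1 / volume.real (ω n)) ≤ q n := by
        rw [mul_one_div, div_le_iff₀ hθ, mul_comm (q n)]
        exact (min_le_right _ _).trans (h₂ n).1
      gcongr
    · rw [act_phase_of_notMem hx, real_inner_smul_left, real_inner_self_eq_norm_sq,
        wt_of_notMem hx, mul_one]
      have : min m₁ m₂ ≤ p n := (min_le_left _ _).trans (h₁ n).1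
      gcongr
  · by_cases hx : x ∈ ω n
    · rw [act_phase_of_mem hx, wt_of_mem hx]
      have hθ := h.pos n
      refine (norm_add_le _ _).trans ?_
      rw [norm_smul, norm_smul, norm_act_J, ← add_mul]
      have h4 : ‖q n‖ + ‖r n‖ ≤ (M₁ + M₂ + M₃) * (1 / volume.real (ω n)) := by
        rw [mul_one_div, le_div_iff₀ hθ, Real.norm_of_nonneg (hp.pos₂ n).le, Real.norm_eq_abs]
        have := h₃ n
        rw [abs_mul, abs_of_pos hθ] at this
        nlinarith [(h₂ n).2]
      gcongr
    · rw [act_phase_of_notMem hx, wt_of_notMem hx, norm_smul, mul_one,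
        Real.norm_of_nonneg (hp.pos₁ n).le]
      have : p n ≤ M₁ + M₂ + M₃ := by linarith [(h₁ n).2]
      gcongr

end Micro

end HighContrast
end

open Filter Topology MeasureTheory

noncomputable section

namespace HighContrast

/-! ### Comparison of two-phase problems -/

theorem abs_integral_mul_inner_le {Ω : Set Plane} {φ : Plane → ℝ} {K : ℝ} (hK : ∀ x, |φ x| ≤ K)
    {F G : Plane → Plane} (hF : MemLp F 2 (volume.restrict Ω))
    (hG : MemLp G 2 (volume.restrict Ω)) :
    |∫ x in Ω, φ x * inner ℝ (F x) (G x)| ≤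
      K * (√(∫ x in Ω, ‖F x‖ ^ 2) * √(∫ x in Ω, ‖G x‖ ^ 2)) := by
  have hK0 : 0 ≤ K := (abs_nonneg _).trans (hK 0)
  refine le_trans ?_ (mul_le_mul_of_nonneg_left (integral_norm_mul_norm_le hF hG) hK0)
  rw [← integral_const_mul]
  refine abs_integral_le_integral_abs.trans (integral_mono_of_nonneg
    (Eventually.of_forall fun _ => abs_nonneg _) ((integrable_norm_mul_norm hF hG).const_mul K)
    (Eventually.of_forall fun x => ?_))
  simp only [abs_mul]
  exact mul_le_mul (hK x) (abs_real_inner_le_norm _ _) (abs_nonneg _) hK0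

theorem integrable_mul_inner {Ω : Set Plane} {φ : Plane → ℝ} (hφ : Continuous φ)
    (hφc : HasCompactSupport φ) {F G : Plane → Plane} (hF : MemLp F 2 (volume.restrict Ω))
    (hG : MemLp G 2 (volume.restrict Ω)) :
    Integrable (fun x => φ x * inner ℝ (F x) (G x)) (volume.restrict Ω) :=
  (integrable_inner (memLp_continuous_mul hφ hφc hF) hG).congr
    (Eventually.of_forall fun _ => real_inner_smul_left _ _ _)

theorem exists_abs_le_of_hasCompactSupport {φ : Plane → ℝ} (hφ : Continuous φ)
    (hφc : HasCompactSupport φ) : ∃ K, 0 ≤ K ∧ ∀ x, |φ x| ≤ K := by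
  obtain ⟨K, hK⟩ := hφ.bounded_above_of_compact_support hφc
  exact ⟨K, (norm_nonneg _).trans (hK 0), hK⟩

/-- As J is orthogonal, pairing J∇ψ with JT is pairing ∇ψ with T. -/
theorem curlFree_rot {Ω : Set Plane} {T : Plane → Plane} (h : DivFree Ω T) (κ : ℝ) :
    CurlFree Ω fun x => κ • act J (T x) := by
  intro ψ h1 h2 h3
  simp only [real_inner_smul_right, inner_act_J_act_J]
  rw [integral_const_mul, h ψ h1 h2 h3, mul_zero]

section

variable {Ω : Set Plane} {c : ℕ → Plane → ℝ} {A E E' : ℝ} {f g : Hneg1 Ω}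
  {σ τ : ℕ → Plane → Plane} {φ : Plane → ℝ} {κ θ : ℕ → ℝ}

/-- From c ≤ 1/θ, the unweighted norm ∫|T|² grows at most like E/θ. -/
theorem IsWeight.integral_smul_sq_le (hc : IsWeight Ω c A) (hθ : ∀ n, 0 < θ n)
    (hcθ : ∀ n x, c n x ≤ 1 / θ n) {T : Plane → Plane} (hT : MemLp T 2 (volume.restrict Ω))
    {n : ℕ} (hE : ∫ x in Ω, ‖T x‖ ^ 2 / c n x ≤ E) :
    κ n ^ 2 * ∫ x in Ω, ‖T x‖ ^ 2 ≤ κ n ^ 2 / θ n * E := by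
  have h1 : θ n * ∫ x in Ω, ‖T x‖ ^ 2 ≤ E := by
    refine le_trans ?_ hE
    rw [← integral_const_mul]
    refine integral_mono (hT.norm.integrable_sq.const_mul _) (hc.integrable_energy hT n) fun x => ?_
    have hp := hc.pos n x
    have hq := hθ n
    simp only
    rw [le_div_iff₀ hp]
    have h2 : θ n * c n x ≤ 1 := by
      have := hcθ n x
      rw [le_div_iff₀ hq] at this
      linarith
    nlinarith [norm_nonneg (T x), sq_nonneg ‖T x‖]
  have hq := hθ n
  calc κ n ^ 2 * ∫ x in Ω, ‖T x‖ ^ 2 = κ n ^ 2 / θ n * (θ n * ∫ x in Ω, ‖T x‖ ^ 2) := by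
        field_simp
    _ ≤ _ := by gcongr

/-- Neither flux is bounded in L². However κJ(σ_n - σ_0) is curl-free and tends to zero strongly in
L², since its squared norm is O(κ²/θ); the div-curl bound against τ_n - τ_0 then needs only the
weighted energy of τ_n. -/
theorem IsWeight.tendsto_rot (hc : IsWeight Ω c A) (hΩ : IsOpen Ω) (hθ : ∀ n, 0 < θ n)
    (hcθ : ∀ n x, c n x ≤ 1 / θ n) (hκ : Tendsto (fun n => κ n ^ 2 / θ n) atTop (𝓝 0))
    (hσ : ∀ n, MemLp (σ n) 2 (volume.restrict Ω))
    (hdiv : ∀ n v, ∫ x in Ω, inner ℝ (σ n x) (gradL Ω v x) = - f v)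
    (hE : ∀ n, ∫ x in Ω, ‖σ n x‖ ^ 2 / c n x ≤ E)
    (hτ : ∀ n, MemLp (τ n) 2 (volume.restrict Ω))
    (hdiv' : ∀ n v, ∫ x in Ω, inner ℝ (τ n x) (gradL Ω v x) = - g v)
    (hE' : ∀ n, ∫ x in Ω, ‖τ n x‖ ^ 2 / c n x ≤ E') (hφ : IsLocalTest Ω φ) :
    Tendsto (fun n => ∫ x in Ω, φ x * (κ n * inner ℝ (act J (σ n x)) (τ n x))) atTop (𝓝 0) := by
  have hφ' := hφ.contDiff.continuous
  have hφc := hφ.hasCompactSupport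
  obtain ⟨K, hK0, hK⟩ := exists_abs_le_of_hasCompactSupport hφ' hφc
  have hS : ∀ n, MemLp (fun x => σ n x - σ 0 x) 2 (volume.restrict Ω) :=
    fun n => (hσ n).sub (hσ 0)
  have hT : ∀ n, MemLp (fun x => τ n x - τ 0 x) 2 (volume.restrict Ω) :=
    fun n => (hτ n).sub (hτ 0)
  set E₁ := 2 * E + 2 * ∫ x in Ω, ‖σ 0 x‖ ^ 2 with hE₁
  have hSE : ∀ n, ∫ x in Ω, ‖σ n x - σ 0 x‖ ^ 2 / c n x ≤ E₁ := fun n =>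
    (energy_sub_le hc (hσ n) (hσ 0) n).trans (by linarith [hE n])
  obtain ⟨M, hM0, hM⟩ := hc.exists_div_curl_bound (E := 2 * E' + 2 * ∫ x in Ω, ‖τ 0 x‖ ^ 2) hΩ hT
    (fun n => divFree_sub (hτ n) (hτ 0) (hdiv' n) (hdiv' 0))
    (fun n => (energy_sub_le hc (hτ n) (hτ 0) n).trans (by linarith [hE' n])) hφ
  set η : ℕ → Plane → Plane := fun n x => κ n • act J (σ n x - σ 0 x) with hη
  have hηL : ∀ n, MemLp (η n) 2 (volume.restrict Ω) := fun n =>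
    (memLp_act_J (hS n)).const_smul (κ n)
  have hη2 : ∀ n, √(∫ x in Ω, ‖η n x‖ ^ 2) ≤ √(κ n ^ 2 / θ n * E₁) := fun n => by
    refine Real.sqrt_le_sqrt (le_trans (le_of_eq ?_)
      (hc.integral_smul_sq_le (κ := κ) hθ hcθ (hS n) (hSE n)))
    rw [← integral_const_mul]
    simp only [hη, norm_smul, norm_act_J, mul_pow, Real.norm_eq_abs, sq_abs]
  have hτ2 : ∀ n, √(∫ x in Ω, ‖κ n • τ n x‖ ^ 2) ≤ √(κ n ^ 2 / θ n * E') := fun n => by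
    refine Real.sqrt_le_sqrt (le_trans (le_of_eq ?_)
      (hc.integral_smul_sq_le (κ := κ) hθ hcθ (hτ n) (hE' n)))
    rw [← integral_const_mul]
    simp only [norm_smul, mul_pow, Real.norm_eq_abs, sq_abs]
  have hlim : ∀ C : ℝ, Tendsto (fun n => √(κ n ^ 2 / θ n * C)) atTop (𝓝 0) := fun C => by
    simpa using (hκ.mul_const C).sqrt
  set a₁ := √(∫ x in Ω, ‖τ 0 x‖ ^ 2) with ha₁
  set a₂ := √(∫ x in Ω, ‖act J (σ 0 x)‖ ^ 2) with ha₂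
  refine squeeze_zero_norm' (a := fun n => M * √(κ n ^ 2 / θ n * E₁) +
    K * (√(κ n ^ 2 / θ n * E₁) * a₁) + K * (a₂ * √(κ n ^ 2 / θ n * E'))) ?_ ?_
  · filter_upwards [hM] with n hn
    -- Only the first term needs the div-curl bound; each of the others pairs a fixed L² field with
    -- a field that tends to zero in L².
    have e : ∫ x in Ω, φ x * (κ n * inner ℝ (act J (σ n x)) (τ n x)) =
        (∫ x in Ω, φ x * inner ℝ (τ n x - τ 0 x) (η n x)) +
        (∫ x in Ω, φ x * inner ℝ (η n x) (τ 0 x)) +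
        ∫ x in Ω, φ x * inner ℝ (act J (σ 0 x)) (κ n • τ n x) := by
      have i1 := integrable_mul_inner hφ' hφc (hT n) (hηL n)
      have i2 := integrable_mul_inner hφ' hφc (hηL n) (hτ 0)
      have i3 : Integrable (fun x => φ x * inner ℝ (act J (σ 0 x)) (κ n • τ n x))
          (volume.restrict Ω) :=
        integrable_mul_inner hφ' hφc (memLp_act_J (hσ 0)) ((hτ n).const_smul (κ n))
      rw [← integral_add i1 i2, ← integral_add (i1.fun_add i2) i3]
      refine integral_congr_ae (Eventually.of_forall fun x => ?_)
      simp only [hη, act_sub, smul_sub, inner_sub_left, inner_sub_right, real_inner_smul_left,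
        real_inner_smul_right]
      rw [real_inner_comm (act J (σ n x)) (τ n x), real_inner_comm (act J (σ 0 x)) (τ n x),
        real_inner_comm (act J (σ n x)) (τ 0 x), real_inner_comm (act J (σ 0 x)) (τ 0 x)]
      ring
    have b1 := hn (η n) (hηL n)
      (curlFree_rot (divFree_sub (hσ n) (hσ 0) (hdiv n) (hdiv 0)) (κ n))
    have b2 := abs_integral_mul_inner_le hK (hηL n) (hτ 0)
    have b3 := abs_integral_mul_inner_le hK (memLp_act_J (hσ 0)) ((hτ n).const_smul (κ n))
    rw [e, Real.norm_eq_abs]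
    refine (abs_add_three _ _ _).trans (add_le_add_three (b1.trans ?_) (b2.trans ?_) (b3.trans ?_))
    · exact mul_le_mul_of_nonneg_left (hη2 n) hM0
    · exact mul_le_mul_of_nonneg_left
        (mul_le_mul_of_nonneg_right (hη2 n) (Real.sqrt_nonneg _)) hK0
    · exact mul_le_mul_of_nonneg_left
        (mul_le_mul_of_nonneg_left (hτ2 n) (Real.sqrt_nonneg _)) hK0
  · have := (((hlim E₁).const_mul M).add (((hlim E₁).mul_const a₁).const_mul K)).add
      (((hlim E').const_mul a₂).const_mul K)
    simpa using this

end

/-- The isotropic two-phase coefficients with conductivities `γ₁` and `γ₂ / |ω n|`. -/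
def iso (ω : ℕ → Set Plane) (γ₁ γ₂ : ℝ) (n : ℕ) : Plane → Mat2 :=
  phase (ω n) γ₁ (γ₂ / volume.real (ω n)) 0

section Compare

variable {Ω : Set Plane} {ω : ℕ → Set Plane} {a : Plane → ℝ} {p q r : ℕ → ℝ} {P Q R : ℝ}

theorem Micro.isPhase_iso (h : Micro Ω ω a) {γ₁ γ₂ : ℝ} (h₁ : 0 < γ₁) (h₂ : 0 < γ₂) :
    IsPhase ω (fun _ => γ₁) (fun n => γ₂ / volume.real (ω n)) (fun _ => 0) γ₁ γ₂ 0 :=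
  ⟨fun _ => h₁, fun n => div_pos h₂ (h.pos n), h₁, h₂, tendsto_const_nhds, by
    refine tendsto_const_nhds.congr fun n => ?_
    rw [mul_div_cancel₀ _ (h.pos n).ne'], by simp⟩

theorem Micro.exists_isCoeff_iso (h : Micro Ω ω a) {γ₁ γ₂ : ℝ} (h₁ : 0 < γ₁) (h₂ : 0 < γ₂) :
    ∃ m M, IsCoeff (wt ω) m M (iso ω γ₁ γ₂) :=
  (h.isPhase_iso h₁ h₂).exists_isCoeff h

/-- The defect of reciprocity between the two-phase problems with phases `p I`, `q I + r J` and
`P I`, `(Q' / θ) I` is, up to a small error, the rotation term. -/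
theorem abs_defect_le {ω : ℕ → Set Plane} {n : ℕ} (hθ : 0 < volume.real (ω n)) {p q r P Q' : ℝ}
    (hq : 0 < q) (x ξ ζ : Plane) :
    |inner ℝ (act (phase (ω n) p q r x) ξ) ζ - inner ℝ (act (iso ω P Q' n x) ζ) ξ -
        r / (q ^ 2 + r ^ 2) * inner ℝ (act J (act (phase (ω n) p q r x) ξ))
          (act (iso ω P Q' n x) ζ)| ≤
      (|p - P| + |r / (q ^ 2 + r ^ 2) * p * P| +
        |volume.real (ω n) * (q - q ^ 2 / (q ^ 2 + r ^ 2) * (Q' / volume.real (ω n)))| +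
        |volume.real (ω n) * (r - q * r / (q ^ 2 + r ^ 2) * (Q' / volume.real (ω n)))|) *
        (wt ω n x * (‖ξ‖ * ‖ζ‖)) := by
  set θ := volume.real (ω n) with hθd
  set κ := r / (q ^ 2 + r ^ 2) with hκ
  have h1 : |inner ℝ ξ ζ| ≤ ‖ξ‖ * ‖ζ‖ := abs_real_inner_le_norm ξ ζ
  have h2 : |inner ℝ (act J ξ) ζ| ≤ ‖ξ‖ * ‖ζ‖ := by
    have := abs_real_inner_le_norm (act J ξ) ζ
    rwa [norm_act_J] at this
  have key : ∀ s t : ℝ, |s * inner ℝ ξ ζ + t * inner ℝ (act J ξ) ζ| ≤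
      (|s| + |t|) * (‖ξ‖ * ‖ζ‖) := fun s t => by
    refine (abs_add_le _ _).trans ?_
    rw [abs_mul, abs_mul, add_mul]
    gcongr
  have hD : 0 < q ^ 2 + r ^ 2 := by positivity
  by_cases hx : x ∈ ω n
  -- In the inclusions the defect is a combination of ξ·ζ and Jξ·ζ. With κ = r/(q²+r²) both
  -- coefficients vanish at the single value Q'/θ = q + r²/q of the isotropic conductivity; `e₁` and
  -- `e₂` measure the departure from it, rescaled by θ.
  · rw [wt_of_mem hx, iso, act_phase_of_mem hx, act_phase_of_mem hx]
    set e₁ := θ * (q - q ^ 2 / (q ^ 2 + r ^ 2) * (Q' / θ)) with he₁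
    set e₂ := θ * (r - q * r / (q ^ 2 + r ^ 2) * (Q' / θ)) with he₂
    have e : inner ℝ (q • ξ + r • act J ξ) ζ - inner ℝ ((Q' / θ) • ζ + (0 : ℝ) • act J ζ) ξ -
        κ * inner ℝ (act J (q • ξ + r • act J ξ)) ((Q' / θ) • ζ + (0 : ℝ) • act J ζ) =
        e₁ / θ * inner ℝ ξ ζ + e₂ / θ * inner ℝ (act J ξ) ζ := by
      simp only [act_add, act_smul, act_J_act_J, zero_smul, add_zero, inner_add_left,
        real_inner_smul_left, real_inner_smul_right, inner_neg_left]
      rw [real_inner_comm ξ ζ, he₁, he₂, hκ]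
      field_simp
      ring
    rw [e]
    refine (key _ _).trans ?_
    rw [abs_div, abs_div, abs_of_pos hθ, ← add_div]
    have h3 : (|e₁| + |e₂|) / θ * (‖ξ‖ * ‖ζ‖) = (|e₁| + |e₂|) * (1 / θ * (‖ξ‖ * ‖ζ‖)) := by ring
    rw [h3]
    have : 0 ≤ |p - P| + |κ * p * P| := by positivity
    refine mul_le_mul_of_nonneg_right ?_ (by positivity)
    linarith
  -- Outside the inclusions the rotation term is itself an error, of size κpP.
  · rw [wt_of_notMem hx, iso, act_phase_of_notMem hx, act_phase_of_notMem hx]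
    have e : inner ℝ (p • ξ) ζ - inner ℝ (P • ζ) ξ - κ * inner ℝ (act J (p • ξ)) (P • ζ) =
        (p - P) * inner ℝ ξ ζ + -(κ * p * P) * inner ℝ (act J ξ) ζ := by
      simp only [act_smul, real_inner_smul_left, real_inner_smul_right]
      rw [real_inner_comm ξ ζ]
      ring
    rw [e, one_mul]
    refine (key _ _).trans ?_
    rw [abs_neg]
    refine mul_le_mul_of_nonneg_right ?_ (by positivity)
    have : 0 ≤ |θ * (q - q ^ 2 / (q ^ 2 + r ^ 2) * (Q' / θ))| := abs_nonneg _
    have : 0 ≤ |θ * (r - q * r / (q ^ 2 + r ^ 2) * (Q' / θ))| := abs_nonneg _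
    linarith

/-- Written in rescaled coefficients, κ = θ · (θr)/((θq)² + (θr)²), so κ = O(θ) and κ²/θ = O(θ). -/
theorem IsPhase.tendsto_rot_coeff (h : Micro Ω ω a) (hp : IsPhase ω p q r P Q R) :
    Tendsto (fun n => r n / (q n ^ 2 + r n ^ 2)) atTop (𝓝 0) ∧
    Tendsto (fun n => (r n / (q n ^ 2 + r n ^ 2)) ^ 2 / volume.real (ω n)) atTop (𝓝 0) := by
  have hQ := hp.lim_pos₂
  have hD : Tendsto (fun n => (volume.real (ω n) * q n) ^ 2 + (volume.real (ω n) * r n) ^ 2) atTop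
      (𝓝 (Q ^ 2 + R ^ 2)) := (hp.tendsto₂.pow 2).add (hp.tendsto₃.pow 2)
  have h1 := hp.tendsto₃.div hD (by positivity)
  constructor
  · have h2 := h.tendsto.mul h1
    rw [zero_mul] at h2
    refine h2.congr fun n => ?_
    have := h.pos n
    have := hp.pos₂ n
    simp only [Pi.div_apply]
    field_simp
  · have h2 := h.tendsto.mul (h1.pow 2)
    rw [zero_mul] at h2
    refine h2.congr fun n => ?_
    have := h.pos n
    have := hp.pos₂ n
    simp only [Pi.div_apply]
    field_simp

/-- Since Q + R²/Q = (Q² + R²)/Q, the limits Q - Q²Q'/(Q²+R²) and R - QRQ'/(Q²+R²) of the two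
inclusion errors vanish together. -/
theorem IsPhase.tendsto_defect_coeff (h : Micro Ω ω a) (hp : IsPhase ω p q r P Q R) :
    Tendsto (fun n => |p n - P| + |r n / (q n ^ 2 + r n ^ 2) * p n * P| +
        |volume.real (ω n) * (q n - q n ^ 2 / (q n ^ 2 + r n ^ 2) *
          ((Q + Q⁻¹ * R ^ 2) / volume.real (ω n)))| +
        |volume.real (ω n) * (r n - q n * r n / (q n ^ 2 + r n ^ 2) *
          ((Q + Q⁻¹ * R ^ 2) / volume.real (ω n)))|) atTop (𝓝 0) := by
  have hQ := hp.lim_pos₂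
  have hD : Tendsto (fun n => (volume.real (ω n) * q n) ^ 2 + (volume.real (ω n) * r n) ^ 2) atTop
      (𝓝 (Q ^ 2 + R ^ 2)) := (hp.tendsto₂.pow 2).add (hp.tendsto₃.pow 2)
  have hD0 : Q ^ 2 + R ^ 2 ≠ 0 := by positivity
  have t1 : Tendsto (fun n => |p n - P|) atTop (𝓝 0) := by
    simpa using (hp.tendsto₁.sub_const P).abs
  have t2 : Tendsto (fun n => |r n / (q n ^ 2 + r n ^ 2) * p n * P|) atTop (𝓝 0) := by
    simpa using (((hp.tendsto_rot_coeff h).1.mul hp.tendsto₁).mul_const P).abs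
  have t3 : Tendsto (fun n => |volume.real (ω n) * (q n - q n ^ 2 / (q n ^ 2 + r n ^ 2) *
      ((Q + Q⁻¹ * R ^ 2) / volume.real (ω n)))|) atTop (𝓝 0) := by
    have := (hp.tendsto₂.sub (((hp.tendsto₂.pow 2).div hD hD0).mul_const (Q + Q⁻¹ * R ^ 2))).abs
    convert this using 2 with n
    · have := h.pos n
      have := hp.pos₂ n
      simp only [Pi.div_apply]
      congr 1
      field_simp
    · symm
      rw [abs_eq_zero]
      field_simp
      ring
  have t4 : Tendsto (fun n => |volume.real (ω n) * (r n - q n * r n / (q n ^ 2 + r n ^ 2) *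
      ((Q + Q⁻¹ * R ^ 2) / volume.real (ω n)))|) atTop (𝓝 0) := by
    have := (hp.tendsto₃.sub (((hp.tendsto₂.mul hp.tendsto₃).div hD hD0).mul_const
      (Q + Q⁻¹ * R ^ 2))).abs
    convert this using 2 with n
    · have := h.pos n
      have := hp.pos₂ n
      simp only [Pi.div_apply]
      congr 1
      field_simp
    · symm
      rw [abs_eq_zero]
      field_simp
      ring
  simpa using ((t1.add t2).add t3).add t4

end Compare

end HighContrast
end

/-! ### Reciprocity in the limit. -/

open Filter Topology MeasureTheory

noncomputable section

namespace HighContrast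

section Reciprocity

variable {Ω : Set Plane} {c : ℕ → Plane → ℝ} {A m M m' M' : ℝ} {a₁ a₂ : ℕ → Plane → Mat2}
  {f g : Hneg1 Ω} {un vn : ℕ → H10 Ω} {u v : H10 Ω} {σ τ : L2V Ω} {l : Filter ℕ} {φ : Plane → ℝ}

theorem LimPair.tendsto_inner (hc : IsWeight Ω c A) (hΩ : IsOpen Ω) (hΩb : Bornology.IsBounded Ω)
    (ha₁ : IsCoeff c m M a₁) (ha₂ : IsCoeff c m' M' a₂) (hl : l ≤ atTop)
    (h₁ : LimPair l a₁ f un u σ) (h₂ : LimPair l a₂ g vn v τ) (hφ : IsLocalTest Ω φ) :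
    Tendsto (fun n => ∫ x in Ω, φ x * inner ℝ (flux (a₁ n) (un n) x) (gradL Ω (vn n) x)) l
      (𝓝 (∫ x in Ω, φ x * inner ℝ (σ x) (gradL Ω v x))) := by
  obtain ⟨E, hE⟩ := ha₁.exists_flux_energy_le hc hΩb h₁.sol
  obtain ⟨C, -, hC⟩ := ha₂.exists_norm_le hc hΩb
  exact hc.tendsto_div_curl hΩ (fun n => ha₁.memLp_flux hc n (un n)) h₁.sol hE hl h₁.fluxTendsto hφ
    (fun n => hC n g _ (h₂.sol n)) h₂.weak

/-- A pointwise defect of size δ_n c_n|G||H| is integrated with |G||H| ≤ |G|² + |H|², so the bounded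
weighted energies and δ_n → 0 suffice. -/
theorem IsWeight.tendsto_integral_defect (hc : IsWeight Ω c A) {S T G H : ℕ → Plane → Plane}
    (hS : ∀ n, MemLp (S n) 2 (volume.restrict Ω)) (hT : ∀ n, MemLp (T n) 2 (volume.restrict Ω))
    (hG : ∀ n, MemLp (G n) 2 (volume.restrict Ω)) (hH : ∀ n, MemLp (H n) 2 (volume.restrict Ω))
    {F F' : ℝ} (hF : ∀ n, ∫ x in Ω, c n x * ‖G n x‖ ^ 2 ≤ F)
    (hF' : ∀ n, ∫ x in Ω, c n x * ‖H n x‖ ^ 2 ≤ F') {κ δ : ℕ → ℝ} (hδ0 : ∀ n, 0 ≤ δ n)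
    (hδ : Tendsto δ atTop (𝓝 0))
    (hpt : ∀ n x, |inner ℝ (S n x) (H n x) - inner ℝ (T n x) (G n x) -
      κ n * inner ℝ (act J (S n x)) (T n x)| ≤ δ n * (c n x * (‖G n x‖ * ‖H n x‖)))
    (hφ : Continuous φ) (hφc : HasCompactSupport φ) :
    Tendsto (fun n => (∫ x in Ω, φ x * inner ℝ (S n x) (H n x)) -
      (∫ x in Ω, φ x * inner ℝ (T n x) (G n x)) -
      ∫ x in Ω, φ x * (κ n * inner ℝ (act J (S n x)) (T n x))) atTop (𝓝 0) := by
  obtain ⟨K, hK0, hK⟩ := exists_abs_le_of_hasCompactSupport hφ hφc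
  refine squeeze_zero_norm (a := fun n => K * (δ n * (F + F'))) (fun n => ?_) (by
    simpa using (hδ.mul_const (F + F')).const_mul K)
  have i1 := integrable_mul_inner hφ hφc (hS n) (hH n)
  have i2 := integrable_mul_inner hφ hφc (hT n) (hG n)
  have i3 : Integrable (fun x => φ x * (κ n * inner ℝ (act J (S n x)) (T n x)))
      (volume.restrict Ω) :=
    ((integrable_mul_inner hφ hφc (memLp_act_J (hS n)) (hT n)).const_mul (κ n)).congr
      (Eventually.of_forall fun x => mul_left_comm _ _ _)
  have j1 := hc.integrable_mul_sq n (hG n)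
  have j2 := hc.integrable_mul_sq n (hH n)
  have hpt' : ∀ x, |φ x * inner ℝ (S n x) (H n x) - φ x * inner ℝ (T n x) (G n x) -
      φ x * (κ n * inner ℝ (act J (S n x)) (T n x))| ≤
      K * (δ n * (c n x * ‖G n x‖ ^ 2 + c n x * ‖H n x‖ ^ 2)) := by
    intro x
    rw [← mul_sub, ← mul_sub, abs_mul]
    refine mul_le_mul (hK x) ((hpt n x).trans ?_) (abs_nonneg _) hK0
    refine mul_le_mul_of_nonneg_left ?_ (hδ0 n)
    rw [← mul_add]
    refine mul_le_mul_of_nonneg_left ?_ (hc.pos n x).le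
    nlinarith [sq_nonneg (‖G n x‖ - ‖H n x‖), sq_nonneg (‖G n x‖), sq_nonneg (‖H n x‖)]
  calc _ = |∫ x in Ω, (φ x * inner ℝ (S n x) (H n x) - φ x * inner ℝ (T n x) (G n x) -
        φ x * (κ n * inner ℝ (act J (S n x)) (T n x)))| := by
        rw [Real.norm_eq_abs, ← integral_sub i1 i2, ← integral_sub (i1.sub_fun i2) i3]
    _ ≤ ∫ x in Ω, K * (δ n * (c n x * ‖G n x‖ ^ 2 + c n x * ‖H n x‖ ^ 2)) :=
        abs_integral_le_integral_abs.trans (integral_mono_of_nonneg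
          (Eventually.of_forall fun _ => abs_nonneg _) (((j1.add j2).const_mul _).const_mul _)
          (Eventually.of_forall hpt'))
    _ ≤ K * (δ n * (F + F')) := by
        rw [integral_const_mul, integral_const_mul, integral_add j1 j2]
        have := hδ0 n
        have := hF n
        have := hF' n
        gcongr

end Reciprocity

section Compare

variable {Ω : Set Plane} {ω : ℕ → Set Plane} {a : Plane → ℝ} {p q r : ℕ → ℝ} {P Q R : ℝ}
  {f g : Hneg1 Ω} {un vn : ℕ → H10 Ω} {u v : H10 Ω} {σ τ : L2V Ω} {l : Filter ℕ}

theorem IsPhase.tendsto_defect (h : Micro Ω ω a) (hp : IsPhase ω p q r P Q R)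
    (hu : ∀ n, IsSol (phase (ω n) (p n) (q n) (r n)) f (un n))
    (hv : ∀ n, IsSol (iso ω P (Q + Q⁻¹ * R ^ 2) n) g (vn n)) {φ : Plane → ℝ}
    (hφ : IsLocalTest Ω φ) :
    Tendsto (fun n =>
      (∫ x in Ω, φ x * inner ℝ (flux (phase (ω n) (p n) (q n) (r n)) (un n) x)
        (gradL Ω (vn n) x)) -
      ∫ x in Ω, φ x * inner ℝ (flux (iso ω P (Q + Q⁻¹ * R ^ 2) n) (vn n) x)
        (gradL Ω (un n) x)) atTop (𝓝 0) := by
  have hQ := hp.lim_pos₂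
  have hφ' := hφ.contDiff.continuous
  have hφc := hφ.hasCompactSupport
  have hc := h.isWeight
  obtain ⟨m, M, ha⟩ := hp.exists_isCoeff h
  obtain ⟨m', M', hb⟩ := h.exists_isCoeff_iso hp.lim_pos₁
    (show 0 < Q + Q⁻¹ * R ^ 2 by positivity)
  obtain ⟨E, hE⟩ := ha.exists_flux_energy_le hc h.isBounded hu
  obtain ⟨E', hE'⟩ := hb.exists_flux_energy_le hc h.isBounded hv
  obtain ⟨F, hF⟩ := ha.exists_weighted_energy_le hc h.isBounded hu
  obtain ⟨F', hF'⟩ := hb.exists_weighted_energy_le hc h.isBounded hv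
  have hs : ∀ n, MemLp (flux (phase (ω n) (p n) (q n) (r n)) (un n)) 2 (volume.restrict Ω) :=
    fun n => ha.memLp_flux hc n (un n)
  have ht : ∀ n, MemLp (flux (iso ω P (Q + Q⁻¹ * R ^ 2) n) (vn n)) 2 (volume.restrict Ω) :=
    fun n => hb.memLp_flux hc n (vn n)
  have hrot := hc.tendsto_rot h.isOpen h.pos h.wt_le (hp.tendsto_rot_coeff h).2 hs hu hE ht hv hE' hφ
  have herr := hc.tendsto_integral_defect hs ht (fun n => Lp.memLp (gradL Ω (un n)))
    (fun n => Lp.memLp (gradL Ω (vn n))) hF hF'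
    (fun n => by positivity) (hp.tendsto_defect_coeff h)
    (fun n x => abs_defect_le (h.pos n) (hp.pos₂ n) x _ _) hφ' hφc
  simpa only [sub_add_cancel, add_zero] using herr.add hrot

/-- Reciprocity between the two-phase problem with a perturbed inclusion phase and the isotropic
one with the equivalent inclusion conductivity. -/
theorem IsPhase.inner_eq (h : Micro Ω ω a) (hp : IsPhase ω p q r P Q R) [l.NeBot] (hl : l ≤ atTop)
    (h₁ : LimPair l (fun n => phase (ω n) (p n) (q n) (r n)) f un u σ)
    (h₂ : LimPair l (iso ω P (Q + Q⁻¹ * R ^ 2)) g vn v τ) :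
    ∀ᵐ x ∂(volume.restrict Ω), inner ℝ (σ x) (gradL Ω v x) = inner ℝ (τ x) (gradL Ω u x) := by
  have hQ := hp.lim_pos₂
  have hc := h.isWeight
  obtain ⟨m, M, ha⟩ := hp.exists_isCoeff h
  obtain ⟨m', M', hb⟩ := h.exists_isCoeff_iso hp.lim_pos₁
    (show 0 < Q + Q⁻¹ * R ^ 2 by positivity)
  have key := ae_eq_zero_of_localTest h.isOpen
    (g := fun x => inner ℝ (σ x) (gradL Ω v x) - inner ℝ (τ x) (gradL Ω u x))
    ((integrable_inner (Lp.memLp _) (Lp.memLp _)).sub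
      (integrable_inner (Lp.memLp _) (Lp.memLp _))) ?_
  · filter_upwards [key] with x hx
    exact sub_eq_zero.1 hx
  intro φ hφ
  have t := (h₁.tendsto_inner hc h.isOpen h.isBounded ha hb hl h₂ hφ).sub
    (h₂.tendsto_inner hc h.isOpen h.isBounded hb ha hl h₁ hφ)
  have := tendsto_nhds_unique t ((hp.tendsto_defect h h₁.sol h₂.sol hφ).mono_left hl)
  have hφ' := hφ.contDiff.continuous
  have hφc := hφ.hasCompactSupport
  simp only [mul_sub]
  rw [integral_sub (integrable_mul_inner hφ' hφc (Lp.memLp _) (Lp.memLp _))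
    (integrable_mul_inner hφ' hφc (Lp.memLp _) (Lp.memLp _))]
  exact this

/-- The case R = 0 compares the isotropic problem with itself; it makes the limit flux a symmetric
linear function of the limit gradient. -/
theorem Micro.inner_eq (h : Micro Ω ω a) {γ₁ γ₂ : ℝ} (hγ₁ : 0 < γ₁) (hγ₂ : 0 < γ₂) [l.NeBot]
    (hl : l ≤ atTop) (h₁ : LimPair l (iso ω γ₁ γ₂) f un u σ)
    (h₂ : LimPair l (iso ω γ₁ γ₂) g vn v τ) :
    ∀ᵐ x ∂(volume.restrict Ω), inner ℝ (σ x) (gradL Ω v x) = inner ℝ (τ x) (gradL Ω u x) := by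
  refine (h.isPhase_iso hγ₁ hγ₂).inner_eq h hl h₁ (g := g) (vn := vn) ?_
  simpa using h₂

end Compare

end HighContrast
end

open Filter Topology MeasureTheory

noncomputable section

namespace HighContrast

/-! ### The homogenized matrix field -/

theorem ae_forall_of_forall_ae {Ω : Set Plane} {P : Plane → Plane → Prop}
    (hcl : ∀ x, IsClosed {ξ | P x ξ}) (h : ∀ ξ, ∀ᵐ x ∂(volume.restrict Ω), P x ξ) :
    ∀ᵐ x ∂(volume.restrict Ω), ∀ ξ, P x ξ := by
  have h1 : ∀ᵐ x ∂(volume.restrict Ω), ∀ j, P x (TopologicalSpace.denseSeq Plane j) :=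
    ae_all_iff.2 fun j => h _
  filter_upwards [h1] with x hx ξ
  exact (TopologicalSpace.denseRange_denseSeq Plane).induction_on (p := fun ξ => P x ξ) ξ (hcl x) hx

theorem ae_forall₂_of_gradL {Ω : Set Plane} (hΩ : IsOpen Ω) {P : Plane → Plane → Plane → Prop}
    (hcl₁ : ∀ x ζ, IsClosed {ξ | P x ξ ζ}) (hcl₂ : ∀ x ξ, IsClosed {ζ | P x ξ ζ})
    (h : ∀ u v : H10 Ω, ∀ᵐ x ∂(volume.restrict Ω), P x (gradL Ω u x) (gradL Ω v x)) :
    ∀ᵐ x ∂(volume.restrict Ω), ∀ ξ ζ, P x ξ ζ := by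
  have h1 := ae_forall_of_gradL hΩ (P := fun x ζ => ∀ ξ, P x ξ ζ)
    (fun x => by
      simp only [Set.ofPred_forall]
      exact isClosed_iInter fun ξ => hcl₂ x ξ)
    fun v => ae_forall_of_gradL hΩ (P := fun x ξ => P x ξ (gradL Ω v x))
      (fun x => hcl₁ x _) fun u => h u v
  exact h1.mono fun x hx ξ ζ => hx ζ ξ

/-- Passage to the limit in quadratic lower bounds for energy densities. -/
theorem ae_quadratic_le {Ω : Set Plane} (hΩ : IsOpen Ω) {l : Filter ℕ} [l.NeBot]
    {G d : ℕ → Plane → ℝ} {X : ℕ → Plane → Plane} {G₀ : Plane → ℝ} {X₀ : Plane → Plane} {D : ℝ}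
    (hΩb : Bornology.IsBounded Ω) (ζ : Plane)
    (hG : ∀ n, Integrable (G n) (volume.restrict Ω))
    (hX : ∀ n, MemLp (X n) 2 (volume.restrict Ω)) (hG₀ : IntegrableOn G₀ Ω)
    (hX₀ : MemLp X₀ 2 (volume.restrict Ω))
    (hd : ∀ n (φ : Plane → ℝ), Continuous φ → HasCompactSupport φ →
      Integrable (fun x => φ x * d n x) (volume.restrict Ω))
    (hpt : ∀ n x, 2 * inner ℝ ζ (X n x) - ‖ζ‖ ^ 2 * d n x ≤ G n x)
    (tG : ∀ φ, IsLocalTest Ω φ →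
      Tendsto (fun n => ∫ x in Ω, φ x * G n x) l (𝓝 (∫ x in Ω, φ x * G₀ x)))
    (tX : ∀ φ, IsLocalTest Ω φ → Tendsto (fun n => ∫ x in Ω, inner ℝ (φ x • ζ) (X n x)) l
      (𝓝 (∫ x in Ω, inner ℝ (φ x • ζ) (X₀ x))))
    (td : ∀ φ : Plane → ℝ, IsLocalTest Ω φ → (∀ x, 0 ≤ φ x) →
      ∃ L ≤ D * ∫ x in Ω, φ x, Tendsto (fun n => ∫ x in Ω, φ x * d n x) l (𝓝 L)) :
    ∀ᵐ x ∂(volume.restrict Ω), 2 * inner ℝ ζ (X₀ x) - ‖ζ‖ ^ 2 * D ≤ G₀ x := by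
  have : IsFiniteMeasure (volume.restrict Ω) :=
    ⟨by simpa using hΩb.measure_lt_top⟩
  have hcon : Integrable (fun _ : Plane => ‖ζ‖ ^ 2 * D) (volume.restrict Ω) := integrable_const _
  have hXi : Integrable (fun x => inner ℝ ζ (X₀ x)) (volume.restrict Ω) :=
    integrable_inner (memLp_const ζ) hX₀
  have key := ae_nonneg_of_localTest hΩ
    (g := fun x => G₀ x - (2 * inner ℝ ζ (X₀ x) - ‖ζ‖ ^ 2 * D))
    (hG₀.sub ((hXi.const_mul 2).sub hcon)) ?_
  · filter_upwards [key] with x hx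
    exact sub_nonneg.1 hx
  intro φ hφ h0
  have hφ' := hφ.contDiff.continuous
  have hφc := hφ.hasCompactSupport
  obtain ⟨K, -, hK⟩ := exists_abs_le_of_hasCompactSupport hφ' hφc
  have hmul : ∀ {F : Plane → ℝ}, Integrable F (volume.restrict Ω) →
      Integrable (fun x => φ x * F x) (volume.restrict Ω) := fun hF =>
    hF.bdd_mul hφ'.aestronglyMeasurable (Eventually.of_forall hK)
  have hsm := memLp_continuous_mul (μ := volume.restrict Ω) hφ' hφc (memLp_const ζ)
  obtain ⟨L, hL, tL⟩ := td φ hφ h0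
  have hlim := ((tG φ hφ).sub ((tX φ hφ).const_mul 2)).add (tL.const_mul (‖ζ‖ ^ 2))
  have hnn : 0 ≤ (∫ x in Ω, φ x * G₀ x) - 2 * (∫ x in Ω, inner ℝ (φ x • ζ) (X₀ x)) +
      ‖ζ‖ ^ 2 * L := by
    refine ge_of_tendsto' hlim fun n => ?_
    rw [← integral_const_mul, ← integral_const_mul, ← integral_sub (hmul (hG n))
      ((integrable_inner hsm (hX n)).const_mul 2), ← integral_add
      ((hmul (hG n)).sub_fun ((integrable_inner hsm (hX n)).const_mul 2))
      ((hd n φ hφ' hφc).const_mul _)]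
    refine integral_nonneg fun x => ?_
    have := mul_nonneg (h0 x) (sub_nonneg.2 (hpt n x))
    simp only [real_inner_smul_left, Pi.zero_apply]
    linarith
  have e : ∫ x in Ω, φ x * (G₀ x - (2 * inner ℝ ζ (X₀ x) - ‖ζ‖ ^ 2 * D)) =
      (∫ x in Ω, φ x * G₀ x) - 2 * (∫ x in Ω, inner ℝ (φ x • ζ) (X₀ x)) +
      ‖ζ‖ ^ 2 * (D * ∫ x in Ω, φ x) := by
    have hφi : Integrable φ (volume.restrict Ω) :=
      (hφ'.integrable_of_hasCompactSupport hφc).restrict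
    rw [← integral_const_mul, ← integral_const_mul, ← integral_const_mul,
      ← integral_sub (hmul hG₀) ((integrable_inner hsm hX₀).const_mul 2), ← integral_add
      ((hmul hG₀).sub_fun ((integrable_inner hsm hX₀).const_mul 2))
      ((hφi.const_mul D).const_mul _)]
    refine integral_congr_ae (Eventually.of_forall fun x => ?_)
    simp only [real_inner_smul_left]
    ring
  rw [e]
  have : ‖ζ‖ ^ 2 * L ≤ ‖ζ‖ ^ 2 * (D * ∫ x in Ω, φ x) := by gcongr
  linarith

/-- The scalar conductivity of the isotropic two-phase problem. -/
def isoCoef (ω : ℕ → Set Plane) (γ₁ γ₂ : ℝ) (n : ℕ) (x : Plane) : ℝ :=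
  (1 - chi (ω n) x) * γ₁ + chi (ω n) x * (γ₂ / volume.real (ω n))

theorem act_iso (ω : ℕ → Set Plane) (γ₁ γ₂ : ℝ) (n : ℕ) (x ξ : Plane) :
    act (iso ω γ₁ γ₂ n x) ξ = isoCoef ω γ₁ γ₂ n x • ξ := by
  by_cases hx : x ∈ ω n
  · simp [iso, act_phase_of_mem hx, isoCoef, chi_of_mem hx]
  · simp [iso, act_phase_of_notMem hx, isoCoef, chi_of_notMem hx]

section Homog

variable {Ω : Set Plane} {ω : ℕ → Set Plane} {a : Plane → ℝ} {γ₁ γ₂ : ℝ}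
  {f g : Hneg1 Ω} {un vn : ℕ → H10 Ω} {u v : H10 Ω} {σ τ : L2V Ω} {l : Filter ℕ}

theorem Micro.min_le_isoCoef (h : Micro Ω ω a) (h₂ : 0 < γ₂) (n : ℕ) (x : Plane) :
    min γ₁ γ₂ ≤ isoCoef ω γ₁ γ₂ n x := by
  by_cases hx : x ∈ ω n
  · simp only [isoCoef, chi_of_mem hx]
    have : γ₂ ≤ γ₂ / volume.real (ω n) := by
      rw [le_div_iff₀ (h.pos n)]; nlinarith [h.lt_one n]
    linarith [min_le_right γ₁ γ₂]
  · simp only [isoCoef, chi_of_notMem hx]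
    linarith [min_le_left γ₁ γ₂]

theorem Micro.isoCoef_le (h : Micro Ω ω a) (h₁ : 0 < γ₁) (n : ℕ) (x : Plane) :
    isoCoef ω γ₁ γ₂ n x ≤ γ₁ + γ₂ * (chi (ω n) x / volume.real (ω n)) := by
  have := h.pos n
  by_cases hx : x ∈ ω n
  · simp only [isoCoef, chi_of_mem hx]
    have : γ₂ * (1 / volume.real (ω n)) = γ₂ / volume.real (ω n) := by ring
    linarith
  · simp [isoCoef, chi_of_notMem hx]

theorem integrable_mul_const_of_hasCompactSupport {φ : Plane → ℝ} (hφ : Continuous φ)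
    (hφc : HasCompactSupport φ) (t : ℝ) :
    Integrable (fun x => φ x * t) (volume.restrict Ω) :=
  (hφ.integrable_of_hasCompactSupport hφc).restrict.mul_const t

/-- With m = min γ₁ γ₂, the bound m|ξ|² ≥ 2ζ·mξ - m|ζ|² is affine in ξ for fixed ζ and so survives
weak convergence, while the energy density converges by the div-curl lemma. Taking ζ = ξ afterwards
recovers the quadratic bound. -/
theorem Micro.lower_of_limPair (h : Micro Ω ω a) (h₁ : 0 < γ₁) (h₂ : 0 < γ₂) [l.NeBot]
    (hl : l ≤ atTop) (hu : LimPair l (iso ω γ₁ γ₂) f un u σ) (ζ : Plane) :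
    ∀ᵐ x ∂(volume.restrict Ω),
      2 * inner ℝ ζ (min γ₁ γ₂ • gradL Ω u x) - ‖ζ‖ ^ 2 * min γ₁ γ₂ ≤
        inner ℝ (σ x) (gradL Ω u x) := by
  obtain ⟨m, M, ha⟩ := h.exists_isCoeff_iso h₁ h₂
  have hc := h.isWeight
  refine ae_quadratic_le h.isOpen (l := l) (d := fun _ _ => min γ₁ γ₂)
    (G := fun n x => inner ℝ (flux (iso ω γ₁ γ₂ n) (un n) x) (gradL Ω (un n) x))
    (X := fun n x => min γ₁ γ₂ • gradL Ω (un n) x) (X₀ := fun x => min γ₁ γ₂ • gradL Ω u x)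
    h.isBounded ζ
    (fun n => integrable_inner (ha.memLp_flux hc n _) (Lp.memLp _))
    (fun n => (Lp.memLp (gradL Ω (un n))).const_smul (min γ₁ γ₂))
    (integrable_inner (Lp.memLp _) (Lp.memLp _))
    ((Lp.memLp (gradL Ω u)).const_smul (min γ₁ γ₂))
    (fun n φ hφ hφc => integrable_mul_const_of_hasCompactSupport hφ hφc _) ?_
    (fun φ hφ => hu.tendsto_inner hc h.isOpen h.isBounded ha ha hl hu hφ) ?_ ?_
  · intro n x
    rw [flux, act_iso, real_inner_smul_left, real_inner_smul_right, real_inner_self_eq_norm_sq]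
    have h3 := h.min_le_isoCoef (γ₁ := γ₁) h₂ n x
    have h4 : 0 < min γ₁ γ₂ := lt_min h₁ h₂
    have h5 : 2 * inner ℝ ζ (gradL Ω (un n) x) ≤ ‖ζ‖ ^ 2 + ‖gradL Ω (un n) x‖ ^ 2 := by
      have := real_inner_le_norm ζ (gradL Ω (un n) x)
      nlinarith [sq_nonneg (‖ζ‖ - ‖gradL Ω (un n) x‖)]
    have h6 := mul_le_mul_of_nonneg_left h5 h4.le
    have h7 := mul_le_mul_of_nonneg_right h3 (sq_nonneg ‖gradL Ω (un n) x‖)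
    linarith
  · intro φ hφ
    have hm : MemLp (fun x => φ x • (min γ₁ γ₂ • ζ)) 2 (volume.restrict Ω) :=
      memLp_of_continuous_hasCompactSupport (hφ.contDiff.continuous.smul continuous_const)
        hφ.hasCompactSupport.smul_right
    have e : ∀ y : L2V Ω, ∫ x in Ω, inner ℝ (φ x • ζ) (min γ₁ γ₂ • y x) = inner ℝ (hm.toLp _) y := by
      intro y
      rw [inner_toLp_left]
      simp only [real_inner_smul_left, real_inner_smul_right]
      exact integral_congr_ae (Eventually.of_forall fun x => mul_left_comm _ _ _)
    simp only [e]
    exact hu.weak.inner_gradL _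
  · intro φ hφ h0
    refine ⟨_, le_refl _, ?_⟩
    rw [integral_mul_const, mul_comm]
    exact tendsto_const_nhds

/-- The energy density b|ξ|² dominates 2ζ·bξ - b|ζ|², now affine in the flux bξ. Moreover b ≤ γ₁ +
γ₂χ/θ, whose weak limit γ₁ + γ₂a is at most γ₁ + γ₂‖a‖_∞. -/
theorem Micro.upper_of_limPair (h : Micro Ω ω a) (h₁ : 0 < γ₁) (h₂ : 0 < γ₂) [l.NeBot]
    (hl : l ≤ atTop) (hu : LimPair l (iso ω γ₁ γ₂) f un u σ) (ζ : Plane) :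
    ∀ᵐ x ∂(volume.restrict Ω),
      2 * inner ℝ ζ (σ x) - ‖ζ‖ ^ 2 * (γ₁ + γ₂ * supNorm Ω a) ≤ inner ℝ (σ x) (gradL Ω u x) := by
  obtain ⟨m, M, ha⟩ := h.exists_isCoeff_iso h₁ h₂
  have hc := h.isWeight
  refine ae_quadratic_le h.isOpen (l := l)
    (d := fun n x => γ₁ + γ₂ * (chi (ω n) x / volume.real (ω n)))
    (G := fun n x => inner ℝ (flux (iso ω γ₁ γ₂ n) (un n) x) (gradL Ω (un n) x))
    (X := fun n => flux (iso ω γ₁ γ₂ n) (un n)) (X₀ := σ)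
    h.isBounded ζ
    (fun n => integrable_inner (ha.memLp_flux hc n _) (Lp.memLp _))
    (fun n => ha.memLp_flux hc n _)
    (integrable_inner (Lp.memLp _) (Lp.memLp _)) (Lp.memLp σ)
    (fun n φ hφ hφc => ?_) ?_
    (fun φ hφ => hu.tendsto_inner hc h.isOpen h.isBounded ha ha hl hu hφ)
    (fun φ hφ => hu.fluxTendsto _ (isTestField_smul hφ.contDiff.continuous hφ.hasCompactSupport
      hφ.tsupport_subset continuous_const)) ?_
  · refine ((integrable_mul_const_of_hasCompactSupport hφ hφc γ₁).add
      ((h.integrable_mul hφ hφc n).const_mul γ₂)).congr (Eventually.of_forall fun x => ?_)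
    simp only [Pi.add_apply]
    ring
  · intro n x
    rw [flux, act_iso, real_inner_smul_left, real_inner_smul_right, real_inner_self_eq_norm_sq]
    have h3 := h.isoCoef_le (γ₂ := γ₂) h₁ n x
    have h4 : 0 < isoCoef ω γ₁ γ₂ n x := (lt_min h₁ h₂).trans_le (h.min_le_isoCoef h₂ n x)
    have h5 : 2 * inner ℝ ζ (gradL Ω (un n) x) ≤ ‖ζ‖ ^ 2 + ‖gradL Ω (un n) x‖ ^ 2 := by
      have := real_inner_le_norm ζ (gradL Ω (un n) x)
      nlinarith [sq_nonneg (‖ζ‖ - ‖gradL Ω (un n) x‖)]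
    have h6 := mul_le_mul_of_nonneg_left h5 h4.le
    have h7 := mul_le_mul_of_nonneg_left h3 (sq_nonneg ‖ζ‖)
    linarith
  · intro φ hφ h0
    have hφ' := hφ.contDiff.continuous
    have hφc := hφ.hasCompactSupport
    refine ⟨γ₁ * (∫ x in Ω, φ x) + γ₂ * ∫ x in Ω, φ x * a x, ?_, ?_⟩
    · have := h.integral_limit_le hφ' hφc h0
      nlinarith
    · refine (((h.tendsto_integral hφ' hφc hφ.tsupport_subset).mono_left hl).const_mul γ₂).const_add
        (γ₁ * ∫ x in Ω, φ x) |>.congr fun n => ?_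
      rw [← integral_const_mul, ← integral_const_mul, ← integral_add
        ((hφ'.integrable_of_hasCompactSupport hφc).restrict.const_mul γ₁)
        ((h.integrable_mul hφ' hφc n).const_mul γ₂)]
      refine integral_congr_ae (Eventually.of_forall fun x => ?_)
      simp only
      ring

/-- The matrix field `S` describes the limits along `l` of the isotropic two-phase problems. -/
structure Homog (Ω : Set Plane) (ω : ℕ → Set Plane) (a : Plane → ℝ) (l : Filter ℕ) (γ₁ γ₂ : ℝ)
    (S : Plane → Mat2) : Prop where
  matClass : MatClass (min γ₁ γ₂) (γ₁ + γ₂ * supNorm Ω a) Ω S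
  symm : ∀ᵐ x ∂(volume.restrict Ω), ∀ ξ ζ, inner ℝ (act (S x) ξ) ζ = inner ℝ (act (S x) ζ) ξ
  flux_eq : ∀ (f : Hneg1 Ω) (un : ℕ → H10 Ω) (u : H10 Ω) (σ : L2V Ω),
    LimPair l (iso ω γ₁ γ₂) f un u σ →
      σ =ᵐ[volume.restrict Ω] fun x => act (S x) (gradL Ω u x)

/-- Reciprocity against a solution whose limit has gradient e_i near x says that the i-th component
of σ is τ_i·∇u. The limit fluxes τ_i of these locally affine functions are therefore the rows of S.
-/
theorem Micro.exists_flux_eq (h : Micro Ω ω a) (h₁ : 0 < γ₁) (h₂ : 0 < γ₂) (U : Ultrafilter ℕ)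
    (hU : (U : Filter ℕ) ≤ atTop) : ∃ S : Plane → Mat2, (∀ i j, Measurable fun x => S x i j) ∧
      ∀ (f : Hneg1 Ω) (un : ℕ → H10 Ω) (u : H10 Ω) (σ : L2V Ω),
        LimPair U (iso ω γ₁ γ₂) f un u σ →
          σ =ᵐ[volume.restrict Ω] fun x => act (S x) (gradL Ω u x) := by
  classical
  obtain ⟨m, M, ha⟩ := h.exists_isCoeff_iso h₁ h₂
  obtain ⟨w, B, hBo, hB, hw⟩ := exists_locally_affine h.isOpen
  choose F Un τ hτ using fun k i => ha.exists_limPair_of_limit h.isWeight h.isOpen h.isBounded U hU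
    (w k (unitVec i))
  -- Choosing the first chart containing x keeps S measurable; the alternative outside Ω makes the
  -- search total.
  have hex : ∀ x, ∃ k, x ∈ B k ∨ x ∉ Ω := fun x => by
    by_cases hx : x ∈ Ω
    · obtain ⟨k, hk⟩ := Set.mem_iUnion.1 (hB hx)
      exact ⟨k, Or.inl hk⟩
    · exact ⟨0, Or.inr hx⟩
  refine ⟨fun x => Matrix.of fun i j => τ (Nat.find (hex x)) i x j, fun i j => ?_,
    fun f un u σ hu => ?_⟩
  · refine Measurable.find (f := fun k x => τ k i x j) (fun k => ?_) (fun k => ?_) hex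
    · exact (EuclideanSpace.proj (𝕜 := ℝ) j).continuous.measurable.comp
        (Lp.stronglyMeasurable (τ k i)).measurable
    · exact (hBo k).measurableSet.union h.isOpen.measurableSet.compl
  · have h3 : ∀ᵐ x ∂(volume.restrict Ω), ∀ k i,
        inner ℝ (σ x) (gradL Ω (w k (unitVec i)) x) = inner ℝ (τ k i x) (gradL Ω u x) := by
      simp only [ae_all_iff]
      exact fun k i => h.inner_eq h₁ h₂ hU hu (hτ k i)
    have h4 : ∀ᵐ x ∂(volume.restrict Ω), ∀ k i, x ∈ B k →
        gradL Ω (w k (unitVec i)) x = unitVec i := by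
      simp only [ae_all_iff]
      exact fun k i => hw k (unitVec i)
    filter_upwards [h3, h4, ae_restrict_mem h.isOpen.measurableSet] with x h3 h4 hx
    have hk := (Nat.find_spec (hex x)).resolve_right fun h' => h' hx
    ext i
    have h5 := h3 (Nat.find (hex x)) i
    rw [h4 _ i hk] at h5
    rw [act_apply]
    simp only [Matrix.of_apply]
    rw [inner_plane, inner_plane] at h5
    rw [← h5]
    fin_cases i <;> simp [unitVec]

/-- Every function of H¹₀ is a limit of solutions, so the inequalities and the symmetry known for
limit gradients hold for all gradients, and hence for all vectors at almost every point. -/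
theorem Micro.exists_homog (h : Micro Ω ω a) (h₁ : 0 < γ₁) (h₂ : 0 < γ₂) (U : Ultrafilter ℕ)
    (hU : (U : Filter ℕ) ≤ atTop) : ∃ S : Plane → Mat2, Homog Ω ω a U γ₁ γ₂ S := by
  obtain ⟨S, hSm, hS⟩ := h.exists_flux_eq h₁ h₂ U hU
  obtain ⟨m, M, ha⟩ := h.exists_isCoeff_iso h₁ h₂
  have hsurj := ha.exists_limPair_of_limit h.isWeight h.isOpen h.isBounded U hU
  have hmin : 0 < min γ₁ γ₂ := lt_min h₁ h₂
  have hlow : ∀ᵐ x ∂(volume.restrict Ω), ∀ ζ ξ : Plane,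
      2 * inner ℝ ζ (min γ₁ γ₂ • ξ) - ‖ζ‖ ^ 2 * min γ₁ γ₂ ≤ inner ℝ (act (S x) ξ) ξ := by
    refine ae_forall_of_forall_ae (fun x => ?_) fun ζ => ae_forall_of_gradL h.isOpen (fun x => ?_)
      fun u => ?_
    · simp only [Set.ofPred_forall]
      exact isClosed_iInter fun ξ => isClosed_le (by fun_prop) (by fun_prop)
    · exact isClosed_le (by fun_prop) ((continuous_act _).inner continuous_id)
    · obtain ⟨f, un, σ, hu⟩ := hsurj u
      filter_upwards [h.lower_of_limPair h₁ h₂ hU hu ζ, hS f un u σ hu] with x h3 h4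
      rwa [h4] at h3
  have hup : ∀ᵐ x ∂(volume.restrict Ω), ∀ ζ ξ : Plane,
      2 * inner ℝ ζ (act (S x) ξ) - ‖ζ‖ ^ 2 * (γ₁ + γ₂ * supNorm Ω a) ≤
        inner ℝ (act (S x) ξ) ξ := by
    refine ae_forall_of_forall_ae (fun x => ?_) fun ζ => ae_forall_of_gradL h.isOpen (fun x => ?_)
      fun u => ?_
    · simp only [Set.ofPred_forall]
      exact isClosed_iInter fun ξ => isClosed_le (by fun_prop) (by fun_prop)
    · have := continuous_act (S x)
      exact isClosed_le (by fun_prop) ((continuous_act _).inner continuous_id)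
    · obtain ⟨f, un, σ, hu⟩ := hsurj u
      filter_upwards [h.upper_of_limPair h₁ h₂ hU hu ζ, hS f un u σ hu] with x h3 h4
      rwa [h4] at h3
  have hM : 0 < γ₁ + γ₂ * supNorm Ω a := by
    have := supNorm_nonneg Ω a
    positivity
  refine ⟨S, matClass_of hmin (fun i j => (hSm i j).aemeasurable) ?_ ?_, ?_, hS⟩
  · filter_upwards [hlow] with x hx ξ
    have := hx ξ ξ
    rw [real_inner_smul_right, real_inner_self_eq_norm_sq] at this
    linarith
  · filter_upwards [hup] with x hx ξ
    -- This ζ maximizes the left side of the quadratic bound and turns it into β⁻¹|Sξ|² with β = γ₁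
    -- + γ₂‖a‖_∞.
    have := hx ((γ₁ + γ₂ * supNorm Ω a)⁻¹ • act (S x) ξ) ξ
    rw [real_inner_smul_left, real_inner_self_eq_norm_sq, norm_smul,
      Real.norm_of_nonneg (inv_pos.2 hM).le] at this
    refine le_trans (le_of_eq ?_) this
    field_simp
    ring
  · refine ae_forall₂_of_gradL h.isOpen
      (P := fun x ξ ζ => inner ℝ (act (S x) ξ) ζ = inner ℝ (act (S x) ζ) ξ) (fun x ζ => ?_)
      (fun x ξ => ?_) fun u v => ?_
    · have := continuous_act (S x)
      exact isClosed_eq (by fun_prop) (by fun_prop)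
    · have := continuous_act (S x)
      exact isClosed_eq (by fun_prop) (by fun_prop)
    · obtain ⟨f, un, σ, hu⟩ := hsurj u
      obtain ⟨g, vn, τ, hv⟩ := hsurj v
      filter_upwards [h.inner_eq h₁ h₂ hU hu hv, hS f un u σ hu, hS g vn v τ hv] with x h3 h4 h5
      rwa [h4, h5] at h3

end Homog

end HighContrast
end

/-! ### Perturbed phases, dependence on the parameters, and uniqueness of the homogenized matrix. -/

open Filter Topology MeasureTheory

noncomputable section

namespace HighContrast

section Homog

variable {Ω : Set Plane} {ω : ℕ → Set Plane} {a : Plane → ℝ} {γ₁ γ₂ γ₁' γ₂' : ℝ}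
  {f g : Hneg1 Ω} {un vn : ℕ → H10 Ω} {u v : H10 Ω} {σ τ : L2V Ω} {U V : Ultrafilter ℕ}
  {S S' : Plane → Mat2}

/-- The perturbed two-phase problem has the homogenized matrix of the isotropic problem with the
equivalent conductivity of the inclusions. -/
theorem Homog.flux_eq_of_phase {p q r : ℕ → ℝ} {P Q R : ℝ} (h : Micro Ω ω a)
    (hU : (U : Filter ℕ) ≤ atTop) (hp : IsPhase ω p q r P Q R)
    (hS : Homog Ω ω a U P (Q + Q⁻¹ * R ^ 2) S)
    (hu : LimPair U (fun n => phase (ω n) (p n) (q n) (r n)) f un u σ) :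
    σ =ᵐ[volume.restrict Ω] fun x => act (S x) (gradL Ω u x) := by
  have hQ := hp.lim_pos₂
  obtain ⟨m, M, ha⟩ := h.exists_isCoeff_iso hp.lim_pos₁
    (show 0 < Q + Q⁻¹ * R ^ 2 by positivity)
  -- Reciprocity holds against isotropic solutions with an arbitrary limit v, and the symmetry of S
  -- moves S onto ∇u.
  have key := ae_forall_of_gradL h.isOpen
    (P := fun x ζ => inner ℝ (σ x) ζ = inner ℝ (act (S x) (gradL Ω u x)) ζ)
    (fun x => isClosed_eq (by fun_prop) (by fun_prop)) fun v => by
      obtain ⟨g, vn, τ, hv⟩ := ha.exists_limPair_of_limit h.isWeight h.isOpen h.isBounded U hU v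
      filter_upwards [hp.inner_eq h hU hu hv, hS.flux_eq g vn v τ hv, hS.symm] with x h1 h2 h3
      rw [h1, h2, h3]
  filter_upwards [key] with x hx
  exact ext_inner_right ℝ hx

/-- Errors are measured relatively, so the large factor 1/θ of the inclusions cancels. -/
theorem abs_isoCoef_sub_le (h : Micro Ω ω a) {ε : ℝ} (h₁ : |γ₁ - γ₁'| ≤ ε * γ₁)
    (h₂ : |γ₂ - γ₂'| ≤ ε * γ₂) (n : ℕ) (x : Plane) :
    |isoCoef ω γ₁ γ₂ n x - isoCoef ω γ₁' γ₂' n x| ≤ ε * isoCoef ω γ₁ γ₂ n x := by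
  have hθ := h.pos n
  by_cases hx : x ∈ ω n
  · simp only [isoCoef, chi_of_mem hx, sub_self, zero_mul, zero_add, one_mul]
    rw [← sub_div, abs_div, abs_of_pos hθ, ← mul_div_assoc]
    gcongr
  · simpa [isoCoef, chi_of_notMem hx] using h₁

theorem integral_mul_quadratic {φ : Plane → ℝ} (hφ : Continuous φ) (hφc : HasCompactSupport φ)
    {F F' G G' : Plane → Plane} (hF : MemLp F 2 (volume.restrict Ω))
    (hF' : MemLp F' 2 (volume.restrict Ω)) (hG : MemLp G 2 (volume.restrict Ω))
    (hG' : MemLp G' 2 (volume.restrict Ω)) (ε : ℝ) :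
    ∫ x in Ω, φ x * (ε * inner ℝ (F x) (G x) + ε * inner ℝ (F' x) (G' x) -
      2 * inner ℝ (F x) (G' x) + 2 * inner ℝ (F' x) (G x)) =
    ε * (∫ x in Ω, φ x * inner ℝ (F x) (G x)) + ε * (∫ x in Ω, φ x * inner ℝ (F' x) (G' x)) -
      2 * (∫ x in Ω, φ x * inner ℝ (F x) (G' x)) +
      2 * ∫ x in Ω, φ x * inner ℝ (F' x) (G x) := by
  have i1 := (integrable_mul_inner hφ hφc hF hG).const_mul ε
  have i2 := (integrable_mul_inner hφ hφc hF' hG').const_mul ε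
  have i3 := (integrable_mul_inner hφ hφc hF hG').const_mul 2
  have i4 := (integrable_mul_inner hφ hφc hF' hG).const_mul 2
  simp only [← integral_const_mul]
  rw [← integral_add i1 i2, ← integral_sub (i1.fun_add i2) i3,
    ← integral_add ((i1.fun_add i2).sub_fun i3) i4]
  refine integral_congr_ae (Eventually.of_forall fun x => ?_)
  simp only
  ring

/-- The cross terms amount to -2(b - b')ξ·ζ, which Young's inequality absorbs in |b - b'|(|ξ|² +
|ζ|²). In this form each term is a flux times a gradient, so the inequality passes to the limit by
the div-curl lemma. -/
theorem quadratic_nonneg_of_abs_sub_le {b b' ε : ℝ} (h : |b - b'| ≤ ε * b) (h' : |b - b'| ≤ ε * b')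
    (ξ ζ : Plane) : 0 ≤ ε * inner ℝ (b • ξ) ξ + ε * inner ℝ (b' • ζ) ζ - 2 * inner ℝ (b • ξ) ζ +
      2 * inner ℝ (b' • ζ) ξ := by
  simp only [real_inner_smul_left, real_inner_self_eq_norm_sq]
  rw [real_inner_comm ξ ζ]
  have c1 : (b - b') * inner ℝ ξ ζ ≤ |b - b'| * (‖ξ‖ * ‖ζ‖) :=
    (le_abs_self _).trans (by
      rw [abs_mul]
      exact mul_le_mul_of_nonneg_left (abs_real_inner_le_norm _ _) (abs_nonneg _))
  have c2 : 2 * (|b - b'| * (‖ξ‖ * ‖ζ‖)) ≤ |b - b'| * (‖ξ‖ ^ 2 + ‖ζ‖ ^ 2) := by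
    nlinarith [mul_nonneg (abs_nonneg (b - b')) (sq_nonneg (‖ξ‖ - ‖ζ‖))]
  have c3 := mul_le_mul_of_nonneg_right h (sq_nonneg ‖ξ‖)
  have c4 := mul_le_mul_of_nonneg_right h' (sq_nonneg ‖ζ‖)
  linarith

theorem integrable_quadratic {F F' G G' : Plane → Plane} (hF : MemLp F 2 (volume.restrict Ω))
    (hF' : MemLp F' 2 (volume.restrict Ω)) (hG : MemLp G 2 (volume.restrict Ω))
    (hG' : MemLp G' 2 (volume.restrict Ω)) (ε : ℝ) :
    IntegrableOn (fun x => ε * inner ℝ (F x) (G x) + ε * inner ℝ (F' x) (G' x) -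
      2 * inner ℝ (F x) (G' x) + 2 * inner ℝ (F' x) (G x)) Ω :=
  ((((integrable_inner hF hG).const_mul ε).add ((integrable_inner hF' hG').const_mul ε)).sub
    ((integrable_inner hF hG').const_mul 2)).add ((integrable_inner hF' hG).const_mul 2)

theorem LimPair.quadratic_nonneg (h : Micro Ω ω a) (h₁ : 0 < γ₁) (h₂ : 0 < γ₂) (h₁' : 0 < γ₁')
    (h₂' : 0 < γ₂') {l : Filter ℕ} [l.NeBot] (hl : l ≤ atTop) {ε : ℝ}
    (hε₁ : |γ₁ - γ₁'| ≤ ε * γ₁) (hε₂ : |γ₂ - γ₂'| ≤ ε * γ₂) (hε₁' : |γ₁ - γ₁'| ≤ ε * γ₁')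
    (hε₂' : |γ₂ - γ₂'| ≤ ε * γ₂') (hu : LimPair l (iso ω γ₁ γ₂) f un u σ)
    (hv : LimPair l (iso ω γ₁' γ₂') g vn v τ) :
    ∀ᵐ x ∂(volume.restrict Ω), 0 ≤ ε * inner ℝ (σ x) (gradL Ω u x) +
      ε * inner ℝ (τ x) (gradL Ω v x) - 2 * inner ℝ (σ x) (gradL Ω v x) +
      2 * inner ℝ (τ x) (gradL Ω u x) := by
  obtain ⟨m, M, ha⟩ := h.exists_isCoeff_iso h₁ h₂
  obtain ⟨m', M', hb⟩ := h.exists_isCoeff_iso h₁' h₂'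
  have hc := h.isWeight
  refine ae_nonneg_of_localTest h.isOpen (integrable_quadratic (Lp.memLp σ) (Lp.memLp τ)
    (Lp.memLp (gradL Ω u)) (Lp.memLp (gradL Ω v)) ε) fun φ hφ h0 => ?_
  have hφ' := hφ.contDiff.continuous
  have hφc := hφ.hasCompactSupport
  rw [integral_mul_quadratic hφ' hφc (Lp.memLp σ) (Lp.memLp τ) (Lp.memLp (gradL Ω u))
    (Lp.memLp (gradL Ω v))]
  have t := ((((hu.tendsto_inner hc h.isOpen h.isBounded ha ha hl hu hφ).const_mul ε).add
    ((hv.tendsto_inner hc h.isOpen h.isBounded hb hb hl hv hφ).const_mul ε)).sub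
    ((hu.tendsto_inner hc h.isOpen h.isBounded ha hb hl hv hφ).const_mul 2)).add
    ((hv.tendsto_inner hc h.isOpen h.isBounded hb ha hl hu hφ).const_mul 2)
  refine ge_of_tendsto' t fun n => ?_
  rw [← integral_mul_quadratic hφ' hφc (ha.memLp_flux hc n (un n)) (hb.memLp_flux hc n (vn n))
    (Lp.memLp (gradL Ω (un n))) (Lp.memLp (gradL Ω (vn n)))]
  refine integral_nonneg fun x => mul_nonneg (h0 x) ?_
  simp only [flux, act_iso]
  refine quadratic_nonneg_of_abs_sub_le (abs_isoCoef_sub_le h hε₁ hε₂ n x) ?_ _ _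
  rw [abs_sub_comm] at hε₁' hε₂' ⊢
  exact abs_isoCoef_sub_le h hε₁' hε₂' n x

theorem matNorm_le_of_bilinear {A : Mat2} {C : ℝ} (hC : 0 ≤ C)
    (h : ∀ ξ ζ : Plane, ‖ξ‖ = 1 → ‖ζ‖ = 1 → inner ℝ (act A ξ) ζ ≤ C) : matNorm A ≤ C := by
  refine ContinuousLinearMap.opNorm_le_of_unit_norm hC fun ξ hξ => ?_
  by_cases h0 : ‖act A ξ‖ = 0
  · exact h0.le.trans hC
  have h1 := h ξ (‖act A ξ‖⁻¹ • act A ξ) hξ (by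
    rw [norm_smul, norm_inv, norm_norm, inv_mul_cancel₀ h0])
  rw [real_inner_smul_right, real_inner_self_eq_norm_sq, pow_two, inv_mul_cancel_left₀ h0] at h1
  exact h1

theorem Homog.quadratic_nonneg (h : Micro Ω ω a) (hU : (U : Filter ℕ) ≤ atTop) (h₁ : 0 < γ₁)
    (h₂ : 0 < γ₂) (h₁' : 0 < γ₁') (h₂' : 0 < γ₂') {ε : ℝ}
    (hε₁ : |γ₁ - γ₁'| ≤ ε * γ₁) (hε₂ : |γ₂ - γ₂'| ≤ ε * γ₂) (hε₁' : |γ₁ - γ₁'| ≤ ε * γ₁')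
    (hε₂' : |γ₂ - γ₂'| ≤ ε * γ₂') (hS : Homog Ω ω a U γ₁ γ₂ S) (hS' : Homog Ω ω a U γ₁' γ₂' S') :
    ∀ᵐ x ∂(volume.restrict Ω), ∀ ξ ζ : Plane, 0 ≤ ε * inner ℝ (act (S x) ξ) ξ +
      ε * inner ℝ (act (S' x) ζ) ζ - 2 * inner ℝ (act (S x) ξ) ζ +
      2 * inner ℝ (act (S' x) ζ) ξ := by
  obtain ⟨m, M, ha⟩ := h.exists_isCoeff_iso h₁ h₂
  obtain ⟨m', M', hb⟩ := h.exists_isCoeff_iso h₁' h₂'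
  refine ae_forall₂_of_gradL h.isOpen (P := fun x ξ ζ => 0 ≤ ε * inner ℝ (act (S x) ξ) ξ +
    ε * inner ℝ (act (S' x) ζ) ζ - 2 * inner ℝ (act (S x) ξ) ζ +
    2 * inner ℝ (act (S' x) ζ) ξ) (fun x ζ => ?_) (fun x ξ => ?_) fun u v => ?_
  · have := continuous_act (S x)
    exact isClosed_le continuous_const ((((this.inner continuous_id).const_mul ε).add_const _ |>.sub
      ((this.inner continuous_const).const_mul 2)).add
        ((continuous_const.inner continuous_id).const_mul 2))
  · have := continuous_act (S' x)
    exact isClosed_le continuous_const ((((this.inner continuous_id).const_mul ε).const_add _ |>.sub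
      ((continuous_const.inner continuous_id).const_mul 2)).add
        ((this.inner continuous_const).const_mul 2))
  · obtain ⟨f, un, σ, hu⟩ := ha.exists_limPair_of_limit h.isWeight h.isOpen h.isBounded U hU u
    obtain ⟨g, vn, τ, hv⟩ := hb.exists_limPair_of_limit h.isWeight h.isOpen h.isBounded U hU v
    have h3 := LimPair.quadratic_nonneg h h₁ h₂ h₁' h₂' hU hε₁ hε₂ hε₁' hε₂' hu hv
    have h4 := hS.flux_eq f un u σ hu
    have h5 := hS'.flux_eq g vn v τ hv
    have key : ∀ {s s' t t' ξ ζ : Plane}, s = s' → t = t' →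
        0 ≤ ε * inner ℝ s ξ + ε * inner ℝ t ζ - 2 * inner ℝ s ζ + 2 * inner ℝ t ξ →
        0 ≤ ε * inner ℝ s' ξ + ε * inner ℝ t' ζ - 2 * inner ℝ s' ζ + 2 * inner ℝ t' ξ := by
      rintro s _ t _ ξ ζ rfl rfl h
      exact h
    filter_upwards [h3, h4, h5] with x h3 h4 h5
    exact key h4 h5 h3

/-- The symmetry of S' turns the quadratic inequality into 2(S - S')ξ·ζ ≤ ε(Sξ·ξ + S'ζ·ζ), and both
quadratic forms are bounded on unit vectors. -/
theorem Homog.matNorm_sub_le (h : Micro Ω ω a) (hU : (U : Filter ℕ) ≤ atTop) (h₁ : 0 < γ₁)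
    (h₂ : 0 < γ₂) (h₁' : 0 < γ₁') (h₂' : 0 < γ₂') {ε : ℝ} (hε : 0 ≤ ε)
    (hε₁ : |γ₁ - γ₁'| ≤ ε * γ₁) (hε₂ : |γ₂ - γ₂'| ≤ ε * γ₂) (hε₁' : |γ₁ - γ₁'| ≤ ε * γ₁')
    (hε₂' : |γ₂ - γ₂'| ≤ ε * γ₂') (hS : Homog Ω ω a U γ₁ γ₂ S) (hS' : Homog Ω ω a U γ₁' γ₂' S') :
    ∀ᵐ x ∂(volume.restrict Ω), matNorm (S x - S' x) ≤
      ε * ((γ₁ + γ₂ * supNorm Ω a) + (γ₁' + γ₂' * supNorm Ω a)) := by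
  have hs := supNorm_nonneg Ω a
  have key := Homog.quadratic_nonneg h hU h₁ h₂ h₁' h₂' hε₁ hε₂ hε₁' hε₂' hS hS'
  filter_upwards [key, hS'.symm, hS.matClass.norm_act_le (by positivity),
    hS'.matClass.norm_act_le (by positivity)] with x h3 h4 h5 h6
  refine matNorm_le_of_bilinear (by positivity) fun ξ ζ hξ hζ => ?_
  have h7 := h3 ξ ζ
  have h8 : inner ℝ (act (S x) ξ) ξ ≤ γ₁ + γ₂ * supNorm Ω a := by
    have := (real_inner_le_norm (act (S x) ξ) ξ)
    have := h5 ξ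
    rw [hξ] at *
    linarith
  have h9 : inner ℝ (act (S' x) ζ) ζ ≤ γ₁' + γ₂' * supNorm Ω a := by
    have := (real_inner_le_norm (act (S' x) ζ) ζ)
    have := h6 ζ
    rw [hζ] at *
    linarith
  rw [h4 ζ ξ] at h7
  have h10 := mul_le_mul_of_nonneg_left h8 hε
  have h11 := mul_le_mul_of_nonneg_left h9 hε
  have h12 : 0 ≤ ε * (γ₁ + γ₂ * supNorm Ω a) := by positivity
  have h13 : 0 ≤ ε * (γ₁' + γ₂' * supNorm Ω a) := by positivity
  rw [act_sub_mat, inner_sub_left]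
  linarith

theorem act_injective {A B : Mat2} (h : ∀ ξ, act A ξ = act B ξ) : A = B :=
  (Matrix.toEuclideanCLM (n := Fin 2) (𝕜 := ℝ)).injective (ContinuousLinearMap.ext h)

theorem Homog.congr {l : Filter ℕ} (hS : Homog Ω ω a l γ₁ γ₂ S)
    (h : S =ᵐ[volume.restrict Ω] S') : Homog Ω ω a l γ₁ γ₂ S' where
  matClass :=
    ⟨fun i j => (hS.matClass.measurable i j).congr (h.mono fun x hx => by simp only [hx]),
      by filter_upwards [h, hS.matClass.invertible] with x h1 h2; rwa [← h1],
      by filter_upwards [h, hS.matClass.lower] with x h1 h2; rwa [← h1],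
      by filter_upwards [h, hS.matClass.upper] with x h1 h2; rwa [← h1]⟩
  symm := by filter_upwards [h, hS.symm] with x h1 h2; rwa [← h1]
  flux_eq f un u σ hu := by
    filter_upwards [h, hS.flux_eq f un u σ hu] with x h1 h2; rw [h2, h1]

/-- Two homogenized matrix fields with the same limits of solutions and fluxes for a dense set of
data coincide. -/
theorem Homog.ae_eq (h : Micro Ω ω a) (hU : (U : Filter ℕ) ≤ atTop)
    (h₁ : 0 < γ₁) (h₂ : 0 < γ₂) (hS : Homog Ω ω a U γ₁ γ₂ S) (hS' : Homog Ω ω a V γ₁ γ₂ S')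
    {D : Set (Hneg1 Ω)} (hD : ∀ f : Hneg1 Ω, ∀ ε > 0, ∃ f' ∈ D, ‖f - f'‖ < ε)
    (hlim : ∀ f ∈ D, ∃ un u σ, LimPair U (iso ω γ₁ γ₂) f un u σ ∧
      LimPair V (iso ω γ₁ γ₂) f un u σ) : S =ᵐ[volume.restrict Ω] S' := by
  have hs := supNorm_nonneg Ω a
  obtain ⟨m, M, ha⟩ := h.exists_isCoeff_iso h₁ h₂
  obtain ⟨T, hT⟩ := hS.matClass.exists_operator (by positivity)
  obtain ⟨T', hT'⟩ := hS'.matClass.exists_operator (by positivity)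
  obtain ⟨C, hC, hb⟩ := ha.exists_norm_le h.isWeight h.isBounded
  -- The functions on whose gradients S and S' agree form a closed set. It contains the limits for
  -- data in D, and ‖u - u'‖ ≤ C‖f - f'‖ brings these close to any u.
  have hcl : IsClosed {u : H10 Ω | T (gradL Ω u) = T' (gradL Ω u)} :=
    isClosed_eq (T.continuous.comp (gradL Ω).continuous) (T'.continuous.comp (gradL Ω).continuous)
  have hall : ∀ u : H10 Ω, T (gradL Ω u) = T' (gradL Ω u) := by
    intro u
    have : u ∈ closure {u : H10 Ω | T (gradL Ω u) = T' (gradL Ω u)} := by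
      refine Metric.mem_closure_iff.2 fun ε hε => ?_
      obtain ⟨f, un, σ, hu⟩ := ha.exists_limPair_of_limit h.isWeight h.isOpen h.isBounded U hU u
      obtain ⟨f', hf', hff'⟩ := hD f (ε / C) (by positivity)
      obtain ⟨un', u', σ', hu', hv'⟩ := hlim f' hf'
      refine ⟨u', ?_, ?_⟩
      · refine Lp.ext ?_
        filter_upwards [hS.flux_eq _ _ _ _ hu', hS'.flux_eq _ _ _ _ hv', hT (gradL Ω u'),
          hT' (gradL Ω u')] with x e1 e2 e3 e4
        rw [e3, e4, ← e1, e2]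
      · have hsub : ∀ n, IsSol (iso ω γ₁ γ₂ n) (f - f') (un n - un' n) := by
          intro n
          obtain ⟨β, hβ, hm⟩ := ha.matClass h.isWeight n
          exact hm.isSol_sub hβ (hu.sol n) (hu'.sol n)
        have hw : WeakTendsto U (fun n => un n - un' n) (u - u') := by
          intro k
          simp only [map_sub]
          exact (hu.weak k).sub (hu'.weak k)
        have h3 := hw.norm_le fun n => hb n _ _ (hsub n)
        rw [dist_eq_norm]
        refine h3.trans_lt ?_
        rwa [lt_div_iff₀' hC] at hff'
    rwa [hcl.closure_eq] at this
  have key := ae_forall_of_gradL h.isOpen (P := fun x ξ => act (S x) ξ = act (S' x) ξ)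
    (fun x => isClosed_eq (continuous_act _) (continuous_act _)) fun u => by
      filter_upwards [hT (gradL Ω u), hT' (gradL Ω u)] with x e1 e2
      rw [← e1, ← e2, hall u]
  filter_upwards [key] with x hx
  exact act_injective hx

end Homog

end HighContrast
end

open Filter Topology MeasureTheory

noncomputable section

namespace HighContrast

/-! ### Extraction of a subsequence -/

theorem exists_dense_seq_dual {E : Type*} [NormedAddCommGroup E] [InnerProductSpace ℝ E]
    [SecondCountableTopology E] (K : Submodule ℝ E) [CompleteSpace K] :
    ∃ d : ℕ → (K →L[ℝ] ℝ), ∀ f : K →L[ℝ] ℝ, ∀ ε > 0, ∃ i, ‖f - d i‖ < ε := by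
  have hsep : SecondCountableTopology K := inferInstance
  refine ⟨fun i => innerSL ℝ (TopologicalSpace.denseSeq K i), fun f ε hε => ?_⟩
  obtain ⟨w, hw⟩ := exists_inner_eq f
  obtain ⟨i, hi⟩ := (TopologicalSpace.denseRange_denseSeq K).exists_dist_lt w hε
  refine ⟨i, ?_⟩
  have : f - innerSL ℝ (TopologicalSpace.denseSeq K i) =
      innerSL ℝ (w - TopologicalSpace.denseSeq K i) := by
    ext v
    rw [map_sub, sub_apply, sub_apply, ← hw v]
    rfl
  rw [this, innerSL_apply_norm, ← dist_eq_norm]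
  exact hi

theorem secondCountableTopology_Lp {E : Type*} [NormedAddCommGroup E] [SecondCountableTopology E]
    (Ω : Set Plane) : SecondCountableTopology (Lp E 2 (volume.restrict Ω)) := by
  have : Fact ((2 : ENNReal) ≠ ⊤) := ⟨ENNReal.ofNat_ne_top⟩
  infer_instance

theorem secondCountableTopology_L2Pair (Ω : Set Plane) : SecondCountableTopology (L2Pair Ω) := by
  have := secondCountableTopology_Lp (E := ℝ) Ω
  have := secondCountableTopology_Lp (E := Plane) Ω
  exact (WithLp.homeomorphProd 2 (Lp ℝ 2 (volume.restrict Ω))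
    (Lp Plane 2 (volume.restrict Ω))).secondCountableTopology

theorem exists_dense_seq_Hneg1 (Ω : Set Plane) :
    ∃ d : ℕ → Hneg1 Ω, ∀ f : Hneg1 Ω, ∀ ε > 0, ∃ i, ‖f - d i‖ < ε := by
  have := secondCountableTopology_L2Pair Ω
  exact exists_dense_seq_dual (H10 Ω)

theorem exists_dense_seq_testFields {Ω : Set Plane} (hΩ : IsOpen Ω) :
    ∃ Φ : ℕ → testFields Ω, DenseRange fun j => testFieldsToL2 Ω (Φ j) := by
  have := secondCountableTopology_Lp (E := Plane) Ω
  have hd : Dense (Set.range (testFieldsToL2 Ω)) := denseRange_testFieldsToL2 hΩ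
  obtain ⟨t, hts, htc, htd⟩ := hd.exists_countable_dense_subset
  obtain ⟨e, he⟩ := htc.exists_eq_range htd.nonempty
  have hmem : ∀ j, ∃ Φ, testFieldsToL2 Ω Φ = e j := fun j => hts (he ▸ Set.mem_range_self j)
  choose Φ hΦ using hmem
  refine ⟨Φ, ?_⟩
  simp only [hΦ]
  rwa [DenseRange, ← he]

/-- Sequential compactness of a countable product of intervals takes the place of a diagonal
extraction. -/
theorem exists_subseq_tendsto {ι : Type*} [Countable ι] {x : ι → ℕ → ℝ}
    (h : ∀ i, ∃ B, ∀ n, |x i n| ≤ B) :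
    ∃ k : ℕ → ℕ, StrictMono k ∧ ∀ i, ∃ L, Tendsto (fun n => x i (k n)) atTop (𝓝 L) := by
  choose B hB using h
  obtain ⟨L, -, k, hk, hL⟩ := (isCompact_univ_pi fun i => isCompact_Icc (a := -B i) (b := B i))
    |>.tendsto_subseq (x := fun n i => x i n) fun n i _ => abs_le.1 (hB i n)
  exact ⟨k, hk, fun i => ⟨L i, tendsto_pi_nhds.1 hL i⟩⟩

section

variable {Ω : Set Plane} {ω : ℕ → Set Plane} {a : Plane → ℝ}

theorem eq_of_dense_dual {d : ℕ → Hneg1 Ω} (hd : ∀ f : Hneg1 Ω, ∀ ε > 0, ∃ i, ‖f - d i‖ < ε)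
    {u v : H10 Ω} (h : ∀ i, d i u = d i v) : u = v := by
  refine ext_inner_left ℝ fun w => ?_
  have key : ∀ g : Hneg1 Ω, g u = g v := by
    intro g
    by_contra hne
    have hpos : 0 < |g (u - v)| := abs_pos.2 (by rw [map_sub]; exact sub_ne_zero.2 hne)
    have huv : 0 < ‖u - v‖ + 1 := by positivity
    obtain ⟨i, hi⟩ := hd g (|g (u - v)| / (‖u - v‖ + 1)) (by positivity)
    have h1 : |(g - d i) (u - v)| ≤ ‖g - d i‖ * ‖u - v‖ := (g - d i).le_opNorm _
    have h2 : (g - d i) (u - v) = g (u - v) := by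
      rw [sub_apply, map_sub (d i), h i, sub_self, sub_zero]
    rw [h2] at h1
    rw [lt_div_iff₀ huv] at hi
    nlinarith [norm_nonneg (g - d i), norm_nonneg (u - v)]
  exact key (innerSL ℝ w)

theorem eq_of_dense_testFields {Φ : ℕ → testFields Ω}
    (hΦ : DenseRange fun j => testFieldsToL2 Ω (Φ j)) {σ τ : L2V Ω}
    (h : ∀ j, ∫ x in Ω, inner ℝ ((Φ j).1 x) (σ x) = ∫ x in Ω, inner ℝ ((Φ j).1 x) (τ x)) :
    σ = τ := by
  refine ext_inner_left ℝ fun y => ?_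
  refine hΦ.induction_on (p := fun y => inner ℝ y σ = inner ℝ y τ) y
    (isClosed_eq (by fun_prop) (by fun_prop)) fun j => ?_
  rw [inner_testFieldsToL2, inner_testFieldsToL2]
  exact h j

/-- After extraction, the homogenized matrices at rational parameters do not depend on the
ultrafilter. -/
theorem Micro.exists_subseq (h : Micro Ω ω a) : ∃ k : ℕ → ℕ, StrictMono k ∧
    ∀ γ₁ γ₂ : {q : ℚ // 0 < q}, ∀ U V : Ultrafilter ℕ, (U : Filter ℕ) ≤ atTop →
      (V : Filter ℕ) ≤ atTop → ∀ S S' : Plane → Mat2,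
      Homog Ω (fun n => ω (k n)) a U γ₁ γ₂ S → Homog Ω (fun n => ω (k n)) a V γ₁ γ₂ S' →
        S =ᵐ[volume.restrict Ω] S' := by
  have hpos : ∀ γ : {q : ℚ // 0 < q}, (0 : ℝ) < (γ : ℚ) := fun γ => by exact_mod_cast γ.2
  obtain ⟨d, hd⟩ := exists_dense_seq_Hneg1 Ω
  obtain ⟨Φ, hΦ⟩ := exists_dense_seq_testFields h.isOpen
  have hex : ∀ (γ : {q : ℚ // 0 < q} × {q : ℚ // 0 < q}) (i n : ℕ),
      ∃ u : H10 Ω, IsSol (iso ω γ.1 γ.2 n) (d i) u := fun γ i n => by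
    obtain ⟨m, M, ha⟩ := h.exists_isCoeff_iso (hpos γ.1) (hpos γ.2)
    obtain ⟨u, hu⟩ := ha.exists_sol h.isWeight h.isBounded n (d i)
    exact ⟨u, (hu u).2 rfl⟩
  choose s hs using hex
  obtain ⟨k₁, hk₁, hlim₁⟩ := exists_subseq_tendsto
    (ι := ({q : ℚ // 0 < q} × {q : ℚ // 0 < q}) × ℕ × ℕ)
    (x := fun i n => d i.2.2 (s i.1 i.2.1 n)) fun ⟨γ, i, j⟩ => by
      obtain ⟨m, M, ha⟩ := h.exists_isCoeff_iso (hpos γ.1) (hpos γ.2)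
      obtain ⟨C, -, hC⟩ := ha.exists_norm_le h.isWeight h.isBounded
      exact ⟨‖d j‖ * (C * ‖d i‖), fun n => ((d j).le_opNorm _).trans
        (mul_le_mul_of_nonneg_left (hC n _ _ (hs γ i n)) (d j).opNorm_nonneg)⟩
  -- A second extraction within the first: `k₁` makes the potentials converge against a dense set of
  -- functionals, `k₂` the fluxes against a dense set of test fields.
  obtain ⟨k₂, hk₂, hlim₂⟩ := exists_subseq_tendsto
    (ι := ({q : ℚ // 0 < q} × {q : ℚ // 0 < q}) × ℕ × ℕ)
    (x := fun i n => ∫ x in Ω, inner ℝ ((Φ i.2.2).1 x)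
      (flux (iso ω i.1.1 i.1.2 (k₁ n)) (s i.1 i.2.1 (k₁ n)) x)) fun ⟨γ, i, j⟩ => by
      obtain ⟨m, M, ha⟩ := h.exists_isCoeff_iso (hpos γ.1) (hpos γ.2)
      obtain ⟨E, hE⟩ := ha.exists_flux_energy_le h.isWeight h.isBounded (hs γ i)
      obtain ⟨B, hB⟩ := h.isWeight.eventually_integral_inner_le (Φ j).2
        (fun n => ha.memLp_flux h.isWeight n (s γ i n)) hE
      -- The weights are controlled only for large n; the finitely many remaining terms are absorbed
      -- into `B'`.
      obtain ⟨B', hB'⟩ := IsBoundedUnder.bddAbove_range (f := fun n =>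
        |∫ x in Ω, inner ℝ ((Φ j).1 x) (flux (iso ω γ.1 γ.2 n) (s γ i n) x)|) ⟨B, hB⟩
      exact ⟨B', fun n => hB' ⟨k₁ n, rfl⟩⟩
  have hk : StrictMono fun n => k₁ (k₂ n) := hk₁.comp hk₂
  have h' := h.comp hk.tendsto_atTop
  refine ⟨fun n => k₁ (k₂ n), hk, fun γ₁ γ₂ U V hU hV S S' hS hS' => ?_⟩
  refine Homog.ae_eq h' hU (hpos γ₁) (hpos γ₂) hS hS' (D := Set.range d)
    (fun f ε hε => (hd f ε hε).imp' d fun i hi => ⟨⟨i, rfl⟩, hi⟩) ?_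
  rintro _ ⟨i, rfl⟩
  obtain ⟨m, M, ha⟩ := h'.exists_isCoeff_iso (hpos γ₁) (hpos γ₂)
  have hsol : ∀ n, IsSol (iso (fun n => ω (k₁ (k₂ n))) γ₁ γ₂ n) (d i)
      (s (γ₁, γ₂) i (k₁ (k₂ n))) := fun n => hs (γ₁, γ₂) i (k₁ (k₂ n))
  obtain ⟨u, σ, hu⟩ := ha.exists_limPair h'.isWeight h'.isOpen h'.isBounded U hU hsol
  obtain ⟨v, τ, hv⟩ := ha.exists_limPair h'.isWeight h'.isOpen h'.isBounded V hV hsol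
  -- The pairings converge as ordinary sequences, so the limits along U and V are tested to the same
  -- values.
  have e1 : u = v := eq_of_dense_dual hd fun j => by
    obtain ⟨L, hL⟩ := hlim₁ ((γ₁, γ₂), i, j)
    have hL' := hL.comp hk₂.tendsto_atTop
    rw [tendsto_nhds_unique (hu.weak (d j)) (hL'.mono_left hU),
      tendsto_nhds_unique (hv.weak (d j)) (hL'.mono_left hV)]
  have e2 : σ = τ := eq_of_dense_testFields hΦ fun j => by
    obtain ⟨L, hL⟩ := hlim₂ ((γ₁, γ₂), i, j)
    rw [tendsto_nhds_unique (hu.fluxTendsto _ (Φ j).2) (hL.mono_left hU),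
      tendsto_nhds_unique (hv.fluxTendsto _ (Φ j).2) (hL.mono_left hV)]
  subst e1 e2
  exact ⟨_, _, _, hu, hv⟩

end

end HighContrast
end

open Filter Topology MeasureTheory

noncomputable section

namespace HighContrast

/-! ### Convergence -/

section

variable {Ω : Set Plane} {ω : ℕ → Set Plane} {a : Plane → ℝ}

theorem matNorm_sub_le_add (A B C : Mat2) : matNorm (A - C) ≤ matNorm (A - B) + matNorm (B - C) := by
  unfold matNorm
  rw [map_sub, map_sub, map_sub]
  exact norm_sub_le_norm_sub_add_norm_sub _ _ _

theorem matNorm_sub_comm (A B : Mat2) : matNorm (A - B) = matNorm (B - A) := by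
  unfold matNorm
  rw [map_sub, map_sub, norm_sub_rev]

theorem eq_of_matNorm_sub_le_zero {A B : Mat2} (h : matNorm (A - B) ≤ 0) : A = B := by
  have h1 : ‖Matrix.toEuclideanCLM (n := Fin 2) (𝕜 := ℝ) (A - B)‖ = 0 :=
    le_antisymm h (norm_nonneg _)
  rw [norm_eq_zero, map_sub, sub_eq_zero] at h1
  exact (Matrix.toEuclideanCLM (n := Fin 2) (𝕜 := ℝ)).injective h1

/-- Positive reals are approximated by positive rationals with small relative error. -/
theorem exists_rat_approx {γ ε : ℝ} (hγ : 0 < γ) (hε : 0 < ε) (hε1 : ε ≤ 1) :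
    ∃ q : {q : ℚ // 0 < q}, |γ - (q : ℚ)| ≤ ε * γ ∧ |γ - (q : ℚ)| ≤ ε * (q : ℚ) ∧
      ((q : ℚ) : ℝ) ≤ 2 * γ := by
  obtain ⟨q, hq1, hq2⟩ := exists_rat_btwn (show γ < γ + ε * γ by nlinarith)
  have hq : (0 : ℝ) < q := hγ.trans hq1
  have h1 : |γ - (q : ℝ)| ≤ ε * γ := by
    rw [abs_sub_comm, abs_of_pos (by linarith)]
    linarith
  exact ⟨⟨q, by exact_mod_cast hq⟩, h1, h1.trans (by nlinarith), by nlinarith⟩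

/-- The homogenized matrices at all parameters do not depend on the ultrafilter. -/
theorem Micro.homog_ae_eq (h : Micro Ω ω a)
    (hrat : ∀ γ₁ γ₂ : {q : ℚ // 0 < q}, ∀ U V : Ultrafilter ℕ, (U : Filter ℕ) ≤ atTop →
      (V : Filter ℕ) ≤ atTop → ∀ S S' : Plane → Mat2,
      Homog Ω ω a U γ₁ γ₂ S → Homog Ω ω a V γ₁ γ₂ S' → S =ᵐ[volume.restrict Ω] S')
    {γ₁ γ₂ : ℝ} (h₁ : 0 < γ₁) (h₂ : 0 < γ₂) {U V : Ultrafilter ℕ} (hU : (U : Filter ℕ) ≤ atTop)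
    (hV : (V : Filter ℕ) ≤ atTop) {S S' : Plane → Mat2} (hS : Homog Ω ω a U γ₁ γ₂ S)
    (hS' : Homog Ω ω a V γ₁ γ₂ S') : S =ᵐ[volume.restrict Ω] S' := by
  have hs := supNorm_nonneg Ω a
  set M := γ₁ + γ₂ * supNorm Ω a with hM
  have hM0 : 0 < M := by positivity
  -- Triangle inequality through the matrices at nearby rational parameters, where U and V agree.
  -- Each of the two legs costs at most ε(M + 2M).
  have key : ∀ ε : ℝ, 0 < ε → ε ≤ 1 → ∀ᵐ x ∂(volume.restrict Ω),
      matNorm (S x - S' x) ≤ 6 * ε * M := by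
    intro ε hε hε1
    obtain ⟨q₁, a1, a2, a3⟩ := exists_rat_approx h₁ hε hε1
    obtain ⟨q₂, b1, b2, b3⟩ := exists_rat_approx h₂ hε hε1
    have p1 : (0 : ℝ) < (q₁ : ℚ) := by exact_mod_cast q₁.2
    have p2 : (0 : ℝ) < (q₂ : ℚ) := by exact_mod_cast q₂.2
    obtain ⟨T, hT⟩ := h.exists_homog p1 p2 U hU
    obtain ⟨T', hT'⟩ := h.exists_homog p1 p2 V hV
    have hle : ((q₁ : ℚ) : ℝ) + ((q₂ : ℚ) : ℝ) * supNorm Ω a ≤ 2 * M := by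
      have := mul_le_mul_of_nonneg_right b3 hs
      rw [hM]; linarith
    filter_upwards [Homog.matNorm_sub_le h hU h₁ h₂ p1 p2 hε.le a1 b1 a2 b2 hS hT,
      Homog.matNorm_sub_le h hV h₁ h₂ p1 p2 hε.le a1 b1 a2 b2 hS' hT',
      hrat q₁ q₂ U V hU hV T T' hT hT'] with x e1 e2 e3
    rw [← e3, matNorm_sub_comm] at e2
    have := matNorm_sub_le_add (S x) (T x) (S' x)
    have := mul_le_mul_of_nonneg_left hle hε.le
    linarith
  have h3 : ∀ᵐ x ∂(volume.restrict Ω), ∀ j : ℕ,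
      matNorm (S x - S' x) ≤ 6 * (1 / ((j : ℝ) + 1)) * M :=
    ae_all_iff.2 fun j => key _ (by positivity) (by
      rw [div_le_one (by positivity)]
      linarith [Nat.cast_nonneg (α := ℝ) j])
  filter_upwards [h3] with x hx
  have t : Tendsto (fun j : ℕ => 6 * (1 / ((j : ℝ) + 1)) * M) atTop (𝓝 0) := by
    simpa using ((tendsto_one_div_add_atTop_nhds_zero_nat (𝕜 := ℝ)).const_mul 6).mul_const M
  exact eq_of_matNorm_sub_le_zero (ge_of_tendsto' t hx)

/-- Adding a multiple of `J` keeps the matrix class. -/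
theorem MatClass.add_J {A : Plane → Mat2} {α β : ℝ} (hα : 0 < α) (hβ : 0 < β)
    (h : MatClass α β Ω A) (b : ℝ) :
    ∃ α' β' : ℝ, 0 < α' ∧ α' ≤ β' ∧ MatClass α' β' Ω fun x => A x + b • J := by
  have hΛ : 0 < β + |b| := by positivity
  have : MatClass α ((β + |b|) ^ 2 / α) Ω fun x => A x + b • J := by
    refine matClass_of_bound hα hΛ (fun i j => (h.measurable i j).add_const _) ?_ ?_
    · filter_upwards [h.lower] with x hx ξ
      rw [act_add_mat, act_smul_mat, inner_add_left, real_inner_smul_left, inner_act_J_self,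
        mul_zero, add_zero]
      exact hx ξ
    · filter_upwards [h.norm_act_le hβ] with x hx ξ
      rw [act_add_mat, act_smul_mat]
      refine (norm_add_le _ _).trans ?_
      rw [norm_smul, norm_act_J, Real.norm_eq_abs, add_mul]
      gcongr
      exact hx ξ
  exact this.exists_le hα (by positivity)

theorem inner_act_J_swap (ξ ζ : Plane) : inner ℝ (act J ξ) ζ = -inner ℝ (act J ζ) ξ := by
  simp only [inner_plane, act_J_zero, act_J_one]
  ring

/-- J∇u is divergence-free, so a constant multiple of J added to the coefficients leaves the
Dirichlet problem unchanged and affects only the flux. -/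
theorem integral_rot_gradL (u v : H10 Ω) :
    ∫ x in Ω, inner ℝ (act J (gradL Ω u x)) (gradL Ω v x) = 0 := by
  have hm := memLp_act_J (Lp.memLp (gradL Ω v))
  have e : ∀ u : H10 Ω, ∫ x in Ω, inner ℝ (act J (gradL Ω u x)) (gradL Ω v x) =
      - gradPair (hm.toLp _) u := fun u => by
    rw [gradPair_apply, inner_toLp_left, ← integral_neg]
    exact integral_congr_ae (Eventually.of_forall fun x => inner_act_J_swap _ _)
  refine isClosed_H10_induction
    (P := fun u => ∫ x in Ω, inner ℝ (act J (gradL Ω u x)) (gradL Ω v x) = 0) ?_ ?_ u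
  · simp only [e]
    exact isClosed_eq (gradPair (hm.toLp _)).continuous.neg continuous_const
  · intro φ hφ
    rw [← curlFree_gradL v φ hφ.contDiff hφ.hasCompactSupport hφ.tsupport_subset]
    refine integral_congr_ae ?_
    have key : ∀ {s s' t : Plane}, s = s' → inner ℝ (act J s) t = inner ℝ (act J s') t := by
      rintro s _ t rfl
      rfl
    filter_upwards [coeFn_gradL_testElem hφ] with x hx
    exact key hx

theorem isSol_add_J {A : Plane → Mat2} {α β : ℝ} (hβ : 0 < β) (h : MatClass α β Ω A) (b : ℝ)
    {f : Hneg1 Ω} {u : H10 Ω} : IsSol (fun x => A x + b • J) f u ↔ IsSol A f u := by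
  refine forall_congr' fun v => ?_
  have e : ∫ x in Ω, inner ℝ (act (A x + b • J) (grad u x)) (grad v x) =
      ∫ x in Ω, inner ℝ (act (A x) (grad u x)) (grad v x) := by
    have i1 : Integrable (fun x => inner ℝ (act (A x) (gradL Ω u x)) (gradL Ω v x))
        (volume.restrict Ω) := integrable_inner (h.memLp_act hβ (Lp.memLp _)) (Lp.memLp _)
    have i2 : Integrable (fun x => inner ℝ (act J (gradL Ω u x)) (gradL Ω v x))
        (volume.restrict Ω) := integrable_inner (memLp_act_J (Lp.memLp _)) (Lp.memLp _)
    simp only [act_add_mat, act_smul_mat, inner_add_left, real_inner_smul_left, grad_eq]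
    rw [integral_add i1 (i2.const_mul b), integral_const_mul, integral_rot_gradL, mul_zero,
      add_zero]
  rw [e]

theorem tendsto_plane {l : Filter ℕ} {y : ℕ → Plane} {y₀ : Plane}
    (h : ∀ ξ : Plane, Tendsto (fun n => inner ℝ ξ (y n)) l (𝓝 (inner ℝ ξ y₀))) :
    Tendsto y l (𝓝 y₀) := by
  have e : ∀ (i : Fin 2) (z : Plane), inner ℝ (unitVec i) z = z i := fun i z => by
    rw [inner_plane]
    fin_cases i <;> simp [unitVec]
  have h0 := h (unitVec 0)
  have h1 := h (unitVec 1)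
  simp only [e] at h0 h1
  rw [plane_eq y₀]
  exact ((h0.smul_const (unitVec 0)).add (h1.smul_const (unitVec 1))).congr
    fun n => (plane_eq (y n)).symm

theorem locallyIntegrableOn_of_memLp {F : Plane → Plane} (hF : MemLp F 2 (volume.restrict Ω)) :
    LocallyIntegrableOn F Ω :=
  locallyIntegrableOn_of_locallyIntegrable_restrict (hF.locallyIntegrable one_le_two)

theorem MatClass.memLp_act_add_J {A : Plane → Mat2} {α β : ℝ} (hβ : 0 < β)
    (h : MatClass α β Ω A) (b : ℝ) (u : H10 Ω) :
    MemLp (fun x => act (A x + b • J) (grad u x)) 2 (volume.restrict Ω) := by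
  simp only [act_add_mat, act_smul_mat, grad_eq]
  exact (h.memLp_act hβ (Lp.memLp _)).add ((memLp_act_J (Lp.memLp (gradL Ω u))).const_smul b)

theorem MatClass.integral_inner_act_add_J {A : Plane → Mat2} {α β : ℝ} (hβ : 0 < β)
    (h : MatClass α β Ω A) (b : ℝ) (u : H10 Ω) {Φ : Plane → Plane} (hΦ : IsTestField Ω Φ) :
    ∫ x in Ω, inner ℝ (Φ x) (act (A x + b • J) (grad u x)) =
      (∫ x in Ω, inner ℝ (Φ x) (flux A u x)) -
        b * inner ℝ ((memLp_act_J hΦ.memLp).toLp _) (gradL Ω u) := by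
  have i1 : Integrable (fun x => inner ℝ (Φ x) (flux A u x)) (volume.restrict Ω) :=
    integrable_inner hΦ.memLp (h.memLp_act hβ (Lp.memLp _))
  have i2 := (integrable_inner (memLp_act_J hΦ.memLp) (Lp.memLp (gradL Ω u))).const_mul b
  rw [inner_toLp_left, ← integral_const_mul, ← integral_sub i1 i2]
  refine integral_congr_ae (Eventually.of_forall fun x => ?_)
  simp only [act_add_mat, act_smul_mat, inner_add_right, real_inner_smul_right, grad_eq, flux,
    inner_act_J_left]
  ring

variable {S : ℝ → ℝ → Plane → Mat2}

/-- Along each ultrafilter the solutions converge to a solution of one and the same limit problem.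
That solution is unique, so all ultrafilter limits coincide and the whole sequence converges. The
extra flux bJ∇u_n is linear in ∇u_n and follows by weak convergence. -/
theorem Homog.hconverges (h : Micro Ω ω a)
    {p q r : ℕ → ℝ} {P Q R : ℝ} (hp : IsPhase ω p q r P Q R) {S : Plane → Mat2}
    (hS : ∀ U : Ultrafilter ℕ, (U : Filter ℕ) ≤ atTop → Homog Ω ω a U P (Q + Q⁻¹ * R ^ 2) S)
    (b : ℝ) :
    HConverges Ω (fun n x => phase (ω n) (p n) (q n) (r n) x + b • J) (fun x => S x + b • J) := by
  have hQ := hp.lim_pos₂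
  have hP := hp.lim_pos₁
  have hs := supNorm_nonneg Ω a
  have hQ' : 0 < Q + Q⁻¹ * R ^ 2 := by positivity
  obtain ⟨m, M, ha⟩ := hp.exists_isCoeff h
  have hmS := (hS _ Nat.hyperfilter_le_atTop).matClass
  have hα : 0 < min P (Q + Q⁻¹ * R ^ 2) := lt_min hP hQ'
  have hβ : 0 < P + (Q + Q⁻¹ * R ^ 2) * supNorm Ω a := by positivity
  choose β hβn hmn using ha.matClass h.isWeight
  refine ⟨fun n => (hmn n).add_J ha.pos (hβn n) b, hmS.add_J hα hβ b, fun f => ?_⟩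
  choose u hu using fun n => ha.exists_sol h.isWeight h.isBounded n f
  obtain ⟨u₀, hu₀⟩ := hmS.exists_sol h.isBounded hα hβ f
  have hsol : ∀ n, IsSol (phase (ω n) (p n) (q n) (r n)) f (u n) := fun n => (hu n _).2 rfl
  have hlim : ∀ U : Ultrafilter ℕ, (U : Filter ℕ) ≤ atTop → ∃ σ : L2V Ω,
      LimPair U (fun n => phase (ω n) (p n) (q n) (r n)) f u u₀ σ ∧
      σ =ᵐ[volume.restrict Ω] flux S u₀ := by
    intro U hU
    obtain ⟨v, σ, hv⟩ := ha.exists_limPair h.isWeight h.isOpen h.isBounded U hU hsol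
    have hσ := (hS U hU).flux_eq_of_phase h hU hp hv
    -- The limit flux keeps the divergence f and equals S∇v, so v solves the homogenized problem.
    have : v = u₀ := (hu₀ v).1 fun w => by
      rw [← hv.inner_gradL w, L2V_inner_eq]
      refine integral_congr_ae ?_
      filter_upwards [hσ] with x hx
      rw [hx]; rfl
    subst this
    exact ⟨σ, hv, hσ⟩
  refine ⟨u, u₀, fun n v => (isSol_add_J (hβn n) (hmn n) b).trans (hu n v),
    fun v => (isSol_add_J hβ hmS b).trans (hu₀ v), fun g => ?_, fun n =>
    locallyIntegrableOn_of_memLp ((hmn n).memLp_act_add_J (hβn n) b _),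
    locallyIntegrableOn_of_memLp (hmS.memLp_act_add_J hβ b _), fun φ hφ hφc hφs => ?_⟩
  · refine (tendsto_iff_ultrafilter _ _ _).2 fun U hU => ?_
    obtain ⟨σ, hσ, -⟩ := hlim U hU
    exact hσ.weak g
  · refine (tendsto_iff_ultrafilter _ _ _).2 fun U hU => ?_
    obtain ⟨σ, hσ, hσ'⟩ := hlim U hU
    refine tendsto_plane fun ξ => ?_
    have hΦ : IsTestField Ω fun x => φ x • ξ := isTestField_smul hφ hφc hφs continuous_const
    have e : ∀ {A : Plane → Mat2} {α β : ℝ} (_ : 0 < β) (_ : MatClass α β Ω A) (v : H10 Ω),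
        inner ℝ ξ (∫ x in Ω, φ x • act (A x + b • J) (grad v x)) =
        (∫ x in Ω, inner ℝ (φ x • ξ) (flux A v x)) -
          b * inner ℝ ((memLp_act_J hΦ.memLp).toLp _) (gradL Ω v) := by
      intro A α β hβ hA v
      have hm := memLp_continuous_mul hφ hφc (hA.memLp_act_add_J hβ b v)
      have : IsFiniteMeasure (volume.restrict Ω) := ⟨by simpa using h.isBounded.measure_lt_top⟩
      rw [← hA.integral_inner_act_add_J hβ b v hΦ, ← integral_inner (hm.integrable one_le_two)]
      simp only [real_inner_smul_left, real_inner_smul_right]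
    rw [e hβ hmS]
    simp only [fun n => e (hβn n) (hmn n)]
    refine Tendsto.sub ?_ ((hσ.weak.inner_gradL _).const_mul b)
    have e2 : ∫ x in Ω, inner ℝ (φ x • ξ) (flux S u₀ x) =
        ∫ x in Ω, inner ℝ (φ x • ξ) (σ x) := by
      refine integral_congr_ae ?_
      filter_upwards [hσ'] with x hx
      rw [hx]
    rw [e2]
    exact hσ.fluxTendsto _ hΦ

/-- On a compact set of positive parameters both coordinates are at least some δ > 0, so a distance
D is a relative error of at most D/δ. The pointwise estimate `Homog.matNorm_sub_le` is then uniform,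
and Ω has finite measure. -/
theorem Micro.locallyLipschitzL1 (h : Micro Ω ω a) {U : Ultrafilter ℕ}
    (hU : (U : Filter ℕ) ≤ atTop)
    (hS : ∀ γ₁ γ₂, 0 < γ₁ → 0 < γ₂ → Homog Ω ω a U γ₁ γ₂ (S γ₁ γ₂)) :
    LocallyLipschitzL1 Ω S := by
  have hs := supNorm_nonneg Ω a
  intro K hK hKpos
  rcases K.eq_empty_or_nonempty with rfl | hne
  · exact ⟨1, one_pos, by simp⟩
  obtain ⟨z₁, hz₁, hmin₁⟩ := hK.exists_isMinOn hne continuous_fst.continuousOn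
  obtain ⟨z₂, hz₂, hmin₂⟩ := hK.exists_isMinOn hne continuous_snd.continuousOn
  obtain ⟨y₁, -, hmax₁⟩ := hK.exists_isMaxOn hne continuous_fst.continuousOn
  obtain ⟨y₂, -, hmax₂⟩ := hK.exists_isMaxOn hne continuous_snd.continuousOn
  set δ := min z₁.1 z₂.2 with hδ
  have hδ0 : 0 < δ := lt_min (hKpos hz₁).1 (hKpos hz₂).2
  set M := y₁.1 + y₂.2 * supNorm Ω a with hM
  have hfin : volume Ω ≠ ⊤ := h.isBounded.measure_lt_top.ne
  refine ⟨|δ⁻¹ * (M + M) * volume.real Ω| + 1, by positivity, fun γ hγ γ' hγ' => ?_⟩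
  have g1 : (0 : ℝ) < γ.1 := (hKpos hγ).1
  have g2 : (0 : ℝ) < γ.2 := (hKpos hγ).2
  have g1' : (0 : ℝ) < γ'.1 := (hKpos hγ').1
  have g2' : (0 : ℝ) < γ'.2 := (hKpos hγ').2
  set D := dist γ γ' with hD
  have hD0 : 0 ≤ D := dist_nonneg
  have d1 : |γ.1 - γ'.1| ≤ D := by
    rw [← Real.dist_eq, hD, Prod.dist_eq]; exact le_max_left _ _
  have d2 : |γ.2 - γ'.2| ≤ D := by
    rw [← Real.dist_eq, hD, Prod.dist_eq]; exact le_max_right _ _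
  have hscale : ∀ t : ℝ, δ ≤ t → D ≤ D * δ⁻¹ * t := fun t ht => by
    calc D = D * δ⁻¹ * δ := by field_simp
      _ ≤ D * δ⁻¹ * t := by gcongr
  have hm1 : ∀ γ ∈ K, δ ≤ γ.1 := fun γ hγ => (min_le_left _ _).trans (hmin₁ hγ)
  have hm2 : ∀ γ ∈ K, δ ≤ γ.2 := fun γ hγ => (min_le_right _ _).trans (hmin₂ hγ)
  have hMle : ∀ γ ∈ K, γ.1 + γ.2 * supNorm Ω a ≤ M := fun γ hγ => by
    have e1 : γ.1 ≤ y₁.1 := hmax₁ hγ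
    have e2 : γ.2 ≤ y₂.2 := hmax₂ hγ
    rw [hM]; gcongr
  have key := Homog.matNorm_sub_le h hU g1 g2 g1' g2' (ε := D * δ⁻¹) (by positivity)
    (d1.trans (hscale _ (hm1 γ hγ))) (d2.trans (hscale _ (hm2 γ hγ)))
    (d1.trans (hscale _ (hm1 γ' hγ'))) (d2.trans (hscale _ (hm2 γ' hγ')))
    (hS _ _ g1 g2) (hS _ _ g1' g2')
  calc ∫⁻ x in Ω, ENNReal.ofReal (matNorm (S γ.1 γ.2 x - S γ'.1 γ'.2 x)) ≤
        ∫⁻ _ in Ω, ENNReal.ofReal (D * δ⁻¹ * (M + M)) := by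
        refine lintegral_mono_ae ?_
        filter_upwards [key] with x hx
        refine ENNReal.ofReal_le_ofReal (hx.trans ?_)
        have := hMle γ hγ
        have := hMle γ' hγ'
        gcongr
    _ = ENNReal.ofReal (D * δ⁻¹ * (M + M) * volume.real Ω) := by
        rw [lintegral_const, Measure.restrict_apply_univ, ENNReal.ofReal_mul' measureReal_nonneg,
          Measure.real, ENNReal.ofReal_toReal hfin]
    _ ≤ _ := by
        refine ENNReal.ofReal_le_ofReal ?_
        have e : D * δ⁻¹ * (M + M) * volume.real Ω = δ⁻¹ * (M + M) * volume.real Ω * D := by ring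
        rw [e]
        refine mul_le_mul_of_nonneg_right ?_ hD0
        linarith [le_abs_self (δ⁻¹ * (M + M) * volume.real Ω)]

theorem sigmaZero_eq (ω : Set Plane) (p q : ℝ) (x : Plane) :
    sigmaZero ω p q x = phase ω p q 0 x + (0 : ℝ) • J := by
  simp [sigmaZero, phase, smul_smul]

/-- The term hβ₁J is extended from the complement of ω to the whole plane and compensated inside ω.
After multiplication by θ the compensation is -θhβ₁, which vanishes in the limit. -/
theorem sigmaField_eq {ω : Set Plane} (hω : volume.real ω ≠ 0) (α₁ α₂ β₁ β₂ h : ℝ) (x : Plane) :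
    sigmaField ω α₁ α₂ β₁ β₂ h x =
      phase ω α₁ (α₂ / volume.real ω) (h * β₂ / volume.real ω - h * β₁) x + (h * β₁) • J := by
  ext i j
  simp only [sigmaField, phase, Matrix.add_apply, Matrix.smul_apply, smul_eq_mul]
  field_simp
  ring

end

end HighContrast
end

/-! ### The main theorem. -/

open Filter Topology MeasureTheory

theorem mainTheorem1 (Ω : Set HighContrast.Plane) (hΩ : IsOpen Ω)
    (hΩb : Bornology.IsBounded Ω) (hΩf : volume (frontier Ω) = 0)
    (ω : ℕ → Set HighContrast.Plane) (hω : ∀ n, IsOpen (ω n)) (hωΩ : ∀ n, ω n ⊆ Ω)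
    (hθpos : ∀ n, 0 < volume.real (ω n)) (hθlt : ∀ n, volume.real (ω n) < 1)
    (hθ : Tendsto (fun n => volume.real (ω n)) atTop (𝓝 0))
    (a : HighContrast.Plane → ℝ) (ha : MemLp a ⊤ (volume.restrict Ω))
    (hχ : HighContrast.WeakStar Ω
      (fun n x => HighContrast.chi (ω n) x / volume.real (ω n)) a) :
    ∃ (k : ℕ → ℕ) (S : ℝ → ℝ → HighContrast.Plane → HighContrast.Mat2),
      StrictMono k ∧
      (∀ γ₁ γ₂ : ℝ, 0 < γ₁ → 0 < γ₂ →
        HighContrast.MatClass (min γ₁ γ₂) (2 * (γ₁ + γ₂ * HighContrast.supNorm Ω a)) Ω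
          (S γ₁ γ₂)) ∧
      HighContrast.LocallyLipschitzL1 Ω S ∧
      HighContrast.IsHomogenizedMap Ω (fun n => ω (k n)) S ∧
      ∀ α₁ α₂ β₁ β₂ : ℝ, 0 < α₁ → 0 < α₂ → (β₁, β₂) ≠ (0, 0) → ∀ h : ℝ,
        HighContrast.HConverges Ω
          (fun n => HighContrast.sigmaField (ω (k n)) α₁ α₂ β₁ β₂ h)
          (fun x => S α₁ (α₂ + α₂⁻¹ * β₂ ^ 2 * h ^ 2) x + (h * β₁) • HighContrast.J) := by
  have hmicro : HighContrast.Micro Ω ω a := ⟨hΩ, hΩb, hω, hθpos, hθlt, hθ, ha, hχ⟩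
  obtain ⟨k, hk, hrat⟩ := hmicro.exists_subseq
  have hm := hmicro.comp hk.tendsto_atTop
  have hU := Nat.hyperfilter_le_atTop
  have hex : ∀ γ₁ γ₂ : ℝ, ∃ S : HighContrast.Plane → HighContrast.Mat2, 0 < γ₁ → 0 < γ₂ →
      HighContrast.Homog Ω (fun n => ω (k n)) a (hyperfilter ℕ) γ₁ γ₂ S := fun γ₁ γ₂ => by
    by_cases h : 0 < γ₁ ∧ 0 < γ₂
    · obtain ⟨S, hS⟩ := hm.exists_homog h.1 h.2 (hyperfilter ℕ) hU
      exact ⟨S, fun _ _ => hS⟩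
    · exact ⟨0, fun h₁ h₂ => absurd ⟨h₁, h₂⟩ h⟩
  choose S hS using hex
  have hSall : ∀ γ₁ γ₂ : ℝ, 0 < γ₁ → 0 < γ₂ → ∀ V : Ultrafilter ℕ, (V : Filter ℕ) ≤ atTop →
      HighContrast.Homog Ω (fun n => ω (k n)) a V γ₁ γ₂ (S γ₁ γ₂) := by
    intro γ₁ γ₂ h₁ h₂ V hV
    obtain ⟨S', hS'⟩ := hm.exists_homog h₁ h₂ V hV
    exact hS'.congr (hm.homog_ae_eq hrat h₁ h₂ hV hU hS' (hS γ₁ γ₂ h₁ h₂))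
  have hsup := HighContrast.supNorm_nonneg Ω a
  refine ⟨k, S, hk, fun γ₁ γ₂ h₁ h₂ => ?_, hm.locallyLipschitzL1 hU hS, ?_, ?_⟩
  -- The upper bound obtained is γ₁ + γ₂‖a‖_∞; the factor 2 is slack.
  · have hpos : 0 < γ₁ + γ₂ * HighContrast.supNorm Ω a := by positivity
    exact (hS γ₁ γ₂ h₁ h₂).matClass.mono_upper hpos (by linarith)
  · intro γ₁ γ₂ h₁ h₂ g₁ g₂ hg₁ hg₂ t₁ t₂
    have hp : HighContrast.IsPhase (fun n => ω (k n)) g₁ g₂ (fun _ => 0) γ₁ γ₂ 0 :=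
      ⟨hg₁, hg₂, h₁, h₂, t₁, t₂, by simp⟩
    have e := HighContrast.Homog.hconverges hm hp (S := S γ₁ γ₂)
      (fun V hV => by simpa using hSall γ₁ γ₂ h₁ h₂ V hV) 0
    have e1 : (fun n => HighContrast.sigmaZero (ω (k n)) (g₁ n) (g₂ n)) = fun n x =>
        HighContrast.phase (ω (k n)) (g₁ n) (g₂ n) 0 x + (0 : ℝ) • HighContrast.J :=
      funext fun n => funext fun x => HighContrast.sigmaZero_eq _ _ _ x
    rw [e1]
    simpa using e
  · intro α₁ α₂ β₁ β₂ h₁ h₂ _ h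
    have hθk : Tendsto (fun n => volume.real (ω (k n))) atTop (𝓝 0) := hm.tendsto
    have hp : HighContrast.IsPhase (fun n => ω (k n)) (fun _ => α₁)
        (fun n => α₂ / volume.real (ω (k n)))
        (fun n => h * β₂ / volume.real (ω (k n)) - h * β₁) α₁ α₂ (h * β₂) := by
      refine ⟨fun _ => h₁, fun n => div_pos h₂ (hθpos _), h₁, h₂, tendsto_const_nhds, ?_, ?_⟩
      · refine tendsto_const_nhds.congr fun n => ?_
        rw [mul_div_cancel₀ _ (hθpos (k n)).ne']
      -- The rescaled rotation coefficient is hβ₂ - θhβ₁, so R = hβ₂ and the equivalent conductivity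
      -- is α₂ + (hβ₂)²/α₂.
      · have t := (hθk.mul_const (h * β₁)).const_sub (h * β₂)
        rw [zero_mul, sub_zero] at t
        refine t.congr fun n => ?_
        rw [mul_sub, mul_div_cancel₀ _ (hθpos (k n)).ne']
    have hγ : α₂ + α₂⁻¹ * β₂ ^ 2 * h ^ 2 = α₂ + α₂⁻¹ * (h * β₂) ^ 2 := by ring
    have hpos : 0 < α₂ + α₂⁻¹ * (h * β₂) ^ 2 := by positivity
    rw [hγ]
    have e := HighContrast.Homog.hconverges hm hp (hSall _ _ h₁ hpos) (h * β₁)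
    have e1 : (fun n => HighContrast.sigmaField (ω (k n)) α₁ α₂ β₁ β₂ h) = fun n x =>
        HighContrast.phase (ω (k n)) α₁ (α₂ / volume.real (ω (k n)))
          (h * β₂ / volume.real (ω (k n)) - h * β₁) x + (h * β₁) • HighContrast.J :=
      funext fun n => funext fun x => HighContrast.sigmaField_eq (hθpos (k n)).ne' _ _ _ _ _ x
    rw [e1]
    exact e
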